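/- Let $A\in C^1([0,\infty))\cap C^\infty((0,\infty))$ satisfy $A(0)=A'(0)=0$; $A,A',A''>0$ on $(0,\infty)$; $\int_0^1 \frac{A'(r)}{r}\,dr<\infty$; and $\frac{rA''(r)}{A'(r)}\to A_*$ as $r\to0^+$ for some $A_*>0$. Let $f\in C^2([0,\infty))$ have exactly the four zeros $0<s_1<s_2<1$ in $[0,\infty)$, with $f>0$ on $(0,s_1)$, $f<0$ on $(s_1,s_2)$, $f>0$ on $(s_2,1)$, $f'(0)>0$, $f'(s_1)<0$, $f'(1)<0$ and $\int_{s_1}^1A'(s)f(s)\,ds>0$. Put $\Lambda(u)=\int_0^u\frac{A'(r)}{r}\,dr$, and let $g'(0-0)\in[-\infty,\infty]$ denote the left derivative of $g$ at $0$. A traveling wave of $u_t=[A(u)]_{xx}+f(u)$ with speed $c>0$ is $Q(x-ct)$, where the profile $Q\in C(\mathbb R)$, $Q\ge 0$, satisfies $\int_{\mathbb R}[A(Q)\varphi''-cQ\varphi'+f(Q)\varphi]\,d\xi=0$ for all $\varphi\in C_c^\infty(\mathbb R)$. For $s\in\{s_1,1\}$, a sharp wave from $s$ to $0$ is a traveling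 wave with $Q(-\infty)=s$, $Q'(\xi)<0$ for $\xi<0$, $Q(\xi)=0$ for $\xi\ge0$, and (Darcy's law) $c=-[\Lambda(Q)]'(0-0)$. Then there exist $c_s>0$ and $c_z>0$ such that: 1. There is a sharp wave $Q_{c_s}(x-c_st)$ from $s_1$ to $0$ (the small sharp wave). It is unique: every sharp wave from $s_1$ to $0$, of any speed, has speed $c_s$ and profile $Q_{c_s}$. 2. There is a traveling wave $Q_{c_z}(x-c_zt)$ with $Q_{c_z}(-\infty)=1$, $Q_{c_z}(+\infty)=s_1$ and $Q_{c_z}'(\xi)<0$ for all $\xi\in\mathbb R$. It is unique: every traveling wave with these properties, of any speed, has speed $c_z$ and a profile that is a translate of $Q_{c_z}$. 3. If $c_s<c_z$, there are $c_b\in(c_s,c_z)$ and a sharp wave $Q_{c_b}(x-c_bt)$ from $1$ to $0$ (the big sharp wave). It is unique: every sharp wave from $1$ to $0$, of any speed, has speed $c_b$ and profile $Q_{c_b}$. 4. If $c_s=c_z$, then for every $c'\in(0,c_s)$ there is $\delta>0$ such that for every $d\in(1-\delta,1)$ there are $L_1>0$ and $U_1\in C(\mathbb R)$ with $U_1>0$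 in $(-L_1,0)$, $U_1=0$ outside $(-L_1,0)$, $U_1\in C^2((-L_1,0))$, $[A(U_1)]''+c'U_1'+f(U_1)=0$ in $(-L_1,0)$, $\max_{[-L_1,0]}U_1=d$ and $[\Lambda(U_1)]'(0-0)<-c'$ (the value $-\infty$ being allowed). 5. If $c_s=c_z$, then for every $c''>c_s$ there are $L_2\in(0,\infty]$ and $U_2\in C((-L_2,\infty))$ with $U_2>0$ in $(-L_2,0)$, $U_2(x)=0$ for $x\ge0$, $U_2\in C^2((-L_2,0))$, $[A(U_2)]''+c''U_2'+f(U_2)=0$ in $(-L_2,0)$, $U_2(x)\to+\infty$ as $x\to-L_2$, and $[\Lambda(U_2)]'(0-0)\ge-c''$. -/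

import Mathlib

open Set Filter Topology MeasureTheory
open scoped ContDiff

namespace DegenDiff

noncomputable section

/-- The class of admissible nonlinear diffusion terms `A : [0,∞) → ℝ`. Only the values of `A` on
`[0,∞)` matter; the derivative at the endpoint `0` is the one-sided one. -/
structure AdmissibleDiffusion (A : ℝ → ℝ) : Prop where
  contDiffOn_one : ContDiffOn ℝ 1 A (Ici 0)
  contDiffOn_top : ContDiffOn ℝ ∞ A (Ioi 0)
  pos : ∀ u, 0 < u → 0 < A u
  deriv_pos : ∀ u, 0 < u → 0 < deriv A u
  deriv_two_pos : ∀ u, 0 < u → 0 < deriv (deriv A) u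
  map_zero : A 0 = 0
  deriv_zero : derivWithin A (Ici 0) 0 = 0
  integrable : IntegrableOn (fun r => deriv A r / r) (Ioc 0 1)
  limit : ∃ Astar : ℝ, 0 < Astar ∧
    Tendsto (fun r => r * deriv (deriv A) r / deriv A r) (𝓝[>] 0) (𝓝 Astar)

/-- Monostable (on `[0,s₁]`) - bistable (on `[s₁,1]`) reactions `f : [0,∞) → ℝ`, relative to the
diffusion term `A`. -/
structure MonostableBistable (A f : ℝ → ℝ) (s₁ s₂ : ℝ) : Prop where
  contDiffOn : ContDiffOn ℝ 2 f (Ici 0)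
  s₁_pos : 0 < s₁
  s₁_lt_s₂ : s₁ < s₂
  s₂_lt_one : s₂ < 1
  zeros : ∀ u, 0 ≤ u → (f u = 0 ↔ u = 0 ∨ u = s₁ ∨ u = s₂ ∨ u = 1)
  deriv_zero : 0 < derivWithin f (Ici 0) 0
  deriv_s₁ : deriv f s₁ < 0
  deriv_one : deriv f 1 < 0
  monostable : ∀ u ∈ Ioo 0 s₁, 0 < f u
  bistable_neg : ∀ u ∈ Ioo s₁ s₂, f u < 0
  bistable_pos : ∀ u ∈ Ioo s₂ 1, 0 < f u
  integral_pos : 0 < ∫ s in s₁..1, deriv A s * f s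

/-- The generalized pressure `Λ(u) = ∫₀ᵘ A'(r)/r dr`. -/
def pressure (A : ℝ → ℝ) (u : ℝ) : ℝ := ∫ r in (0 : ℝ)..u, deriv A r / r

/-- `g` has the left derivative `m ∈ [-∞,∞]` at `a`. -/
def HasLeftDeriv (g : ℝ → ℝ) (a : ℝ) (m : EReal) : Prop :=
  Tendsto (fun x => ((slope g a x : ℝ) : EReal)) (𝓝[<] a) (𝓝 m)

/-- `Q(x - ct)` is a traveling wave, of speed `c > 0`, of `u_t = [A(u)]_xx + f(u)`: the profile is
continuous and nonnegative and solves `[A(Q)]'' + c Q' + f(Q) = 0` on the line in the sense of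
distributions. -/
structure IsTravelingWave (A f : ℝ → ℝ) (c : ℝ) (Q : ℝ → ℝ) : Prop where
  speed_pos : 0 < c
  continuous : Continuous Q
  nonneg : ∀ x, 0 ≤ Q x
  weak : ∀ η : ℝ → ℝ, ContDiff ℝ ∞ η → HasCompactSupport η →
    ∫ x, (A (Q x) * deriv (deriv η) x - c * Q x * deriv η x + f (Q x) * η x) = 0

/-- A sharp wave from the state `s` at `-∞` to `0`, with free boundary at `0` and Darcy's law
there. A negative value of `deriv` entails differentiability. -/
structure IsSharpWave (A f : ℝ → ℝ) (s c : ℝ) (Q : ℝ → ℝ) : Prop where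
  wave : IsTravelingWave A f c Q
  limit : Tendsto Q atBot (𝓝 s)
  zero : ∀ x, 0 ≤ x → Q x = 0
  deriv_neg : ∀ x, x < 0 → deriv Q x < 0
  darcy : HasLeftDeriv (fun x => pressure A (Q x)) 0 ((-c : ℝ) : EReal)

/-- A strictly decreasing traveling wave connecting `a` at `-∞` and `b` at `+∞`. -/
structure IsMonotoneWave (A f : ℝ → ℝ) (a b c : ℝ) (Q : ℝ → ℝ) : Prop where
  wave : IsTravelingWave A f c Q
  limit_left : Tendsto Q atBot (𝓝 a)
  limit_right : Tendsto Q atTop (𝓝 b)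
  deriv_neg : ∀ x, deriv Q x < 0

/-- `U` is a `C²` classical solution of `[A(U)]'' + c U' + f(U) = 0` on the open set `I`. -/
def IsClassicalProfileOn (A f : ℝ → ℝ) (c : ℝ) (U : ℝ → ℝ) (I : Set ℝ) : Prop :=
  ContDiffOn ℝ 2 U I ∧
    ∀ x ∈ I, deriv (deriv (fun y => A (U y))) x + c * deriv U x + f (U x) = 0

/-- A compactly supported profile of speed `c` with support `[-L,0]` and maximum `d`, which solves
the equation classically where it is positive, and whose pressure has at `0` a left derivative
(possibly `-∞`) less than `-c`. -/
structure IsCompactProfile (A f : ℝ → ℝ) (c d L : ℝ) (U : ℝ → ℝ) : Prop where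
  L_pos : 0 < L
  continuous : Continuous U
  pos : ∀ x ∈ Ioo (-L) 0, 0 < U x
  zero : ∀ x, x ∉ Ioo (-L) 0 → U x = 0
  classical : IsClassicalProfileOn A f c U (Ioo (-L) 0)
  max : IsGreatest (U '' Icc (-L) 0) d
  slope_lt : ∃ m : EReal, HasLeftDeriv (fun x => pressure A (U x)) 0 m ∧ m < ((-c : ℝ) : EReal)

/-- A profile of speed `c`, defined on `(-L,∞)` with `L ∈ (0,∞]` (the values of `U` elsewhere are
irrelevant), which solves the equation classically in `(-L,0)`, where it is positive, vanishes on
`[0,∞)`, blows up at `-L`, and whose pressure has at `0` a left derivative at least `-c`. -/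
structure IsBlowUpProfile (A f : ℝ → ℝ) (c : ℝ) (L : EReal) (U : ℝ → ℝ) : Prop where
  L_pos : 0 < L
  continuousOn : ContinuousOn U {x : ℝ | -L < (x : EReal)}
  pos : ∀ x : ℝ, -L < (x : EReal) → x < 0 → 0 < U x
  zero : ∀ x : ℝ, 0 ≤ x → U x = 0
  classical : IsClassicalProfileOn A f c U {x : ℝ | -L < (x : EReal) ∧ x < 0}
  blow_up : ∀ M : ℝ, ∃ y : ℝ, -L < (y : EReal) ∧ ∀ x : ℝ, -L < (x : EReal) → x < y → M < U x
  le_slope : ∃ m : EReal, HasLeftDeriv (fun x => pressure A (U x)) 0 m ∧ ((-c : ℝ) : EReal) ≤ m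

end

end DegenDiff

namespace DegenDiff

/-! ### One-sided differential inequalities -/

/-! Along a decreasing profile `Q` the flux `V = [A(Q)]'` is a function of the density `u = Q`. With
`q = V² / 2` and `h = A' f` the profile equation becomes the scalar equation `q' = c √(2q) - h(u)`,
and all waves and comparison profiles are read off from its solutions. Since `√` vanishes on
negative numbers in Lean, the equation makes sense for `q` of any sign. For `c ≥ 0` its right side
is nondecreasing in `q`, so the backward problem, with data at the right end, has unique solutions
that decrease with `c` and depend on data and speed in a Lipschitz way, although `√` is not
Lipschitz at `0` (`backward_bound`, `IsOrbit.le_of_le`, `IsOrbit.sub_le_add`, `exists_orbit`).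

The speed `c_s` is the first speed at which the solution with `q(s₁) = 0` reaches `q(0) = 0`; `c_z`
is the first at which the solution with `q(1) = 0` reaches `q(s₁) = 0`; `c_b` is the first at which
that solution reaches `q(0) = 0` (`exists_critical_speed`).

Darcy's law means `√(2q) ~ c u` at the origin, because the pressure has derivative `V / Q`. As `h(u)
= o(u)`, an orbit ending at the origin either satisfies this law or dips below the parabola `(c u /
2)² / 2` arbitrarily close to `0` (`IsOrbit.sharp_or_slow`). The second behavior survives small
perturbations of speed and data (`IsOrbit.left_nonpos_of_near`), so it cannot occur at a minimal
speed, nor on the maximal orbit issuing from the origin. Two sharp orbits of different speeds are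
ordered near `0` in the way opposite to the backward comparison, which gives uniqueness of the speed
and, with `IsOrbit.le_of_isSharp`, the strict inequalities `c_s < c_b < c_z`. For fronts from `1` to
`s₁` uniqueness of the speed comes from the growth of `√(2q)` on `(s₁, s₂)`, where `h < 0`.

Below both critical speeds, the orbits ending at `(d, 0)` with `d` near `1` stay positive down to `u
= 0`; glued to an orbit of speed `-c'`, they give the compactly supported profiles. Above both, the
maximal orbit from the origin stays positive for all `u > 0` and gives the blow-up profiles.

An orbit is turned into a profile by inverting the position `X`, where `X' = -A' / √(2q)`.
Integrability of `A'(r) / r` makes `X` finite at density `0`, and linear bounds on `√(2q)` at `s₁`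
and `1` push the other ends to infinity. Conversely, a weak solution has a continuous flux by a
twofold du Bois-Reymond argument, so each wave produces an orbit, and uniqueness of orbits gives
uniqueness of waves. -/

lemma monotoneOn_Icc_of_hasDerivAt {a b : ℝ} {D D' : ℝ → ℝ} (hc : ContinuousOn D (Icc a b))
    (hd : ∀ x ∈ Ioo a b, HasDerivAt D (D' x) x) (hn : ∀ x ∈ Ioo a b, 0 ≤ D' x) :
    MonotoneOn D (Icc a b) := by
  refine monotoneOn_of_deriv_nonneg (convex_Icc a b) hc ?_ ?_
  · rw [interior_Icc]
    exact fun x hx => (hd x hx).differentiableAt.differentiableWithinAt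
  · rw [interior_Icc]
    intro x hx
    rw [(hd x hx).deriv]
    exact hn x hx

/-- While `D` is positive, `D + εx` is nondecreasing, so a large value at `u` would persist up to
the next point where `D ≤ 0`, or up to `b`. Only the sign of `D` at the point matters in `hn`, which
suits nonlinearities that are monotone but not Lipschitz. -/
lemma backward_bound {a b ε : ℝ} {D D' : ℝ → ℝ} (hε : 0 ≤ ε) (hc : ContinuousOn D (Icc a b))
    (hd : ∀ x ∈ Ioo a b, HasDerivAt D (D' x) x)
    (hn : ∀ x ∈ Ioo a b, 0 < D x → -ε ≤ D' x) {u : ℝ} (hu : u ∈ Icc a b) :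
    D u ≤ max 0 (D b) + ε * (b - u) := by
  by_contra! hlt
  have hDu : 0 < D u := by
    have : 0 ≤ ε * (b - u) := mul_nonneg hε (by linarith [hu.2])
    linarith [le_max_left 0 (D b)]
  -- `v` is the first point of `[u, b]` with `D ≤ 0`, or `b` if there is none.
  obtain ⟨v, hv, hpos, hvle⟩ : ∃ v ∈ Icc u b, (∀ x ∈ Ioo u v, 0 < D x) ∧ D v ≤ max 0 (D b) := by
    by_cases hS : ∃ x ∈ Icc u b, D x ≤ 0
    · set S := {x | x ∈ Icc u b ∧ D x ≤ 0} with hSdef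
      have hSc : IsClosed S := by
        have := (hc.mono (Icc_subset_Icc_left hu.1)).preimage_isClosed_of_isClosed isClosed_Icc
          (isClosed_Iic (a := (0 : ℝ)))
        exact this
      have hne : S.Nonempty := by obtain ⟨x, hx, h⟩ := hS; exact ⟨x, hx, h⟩
      have hbdd : BddBelow S := ⟨u, fun x hx => hx.1.1⟩
      have hmem := hSc.csInf_mem hne hbdd
      refine ⟨sInf S, hmem.1, fun x hx => ?_, hmem.2.trans (le_max_left _ _)⟩
      by_contra! hx0
      exact absurd (csInf_le hbdd (show x ∈ S from ⟨⟨hx.1.le, hx.2.le.trans hmem.1.2⟩, hx0⟩))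
        (not_le.2 hx.2)
    · push Not at hS
      exact ⟨b, ⟨hu.2, le_rfl⟩, fun x hx => hS x ⟨hx.1.le, hx.2.le⟩, le_max_right _ _⟩
  have hmono : MonotoneOn (fun x => D x + ε * x) (Icc u v) := by
    refine monotoneOn_Icc_of_hasDerivAt (D' := fun x => D' x + ε) ?_ ?_ ?_
    · exact (hc.mono (Icc_subset_Icc hu.1 hv.2)).add (by fun_prop)
    · intro x hx
      have h1 := hd x ⟨hu.1.trans_lt hx.1, hx.2.trans_le hv.2⟩
      convert! h1.add ((hasDerivAt_id x).const_mul ε) using 1; ring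
    · intro x hx
      have h1 := hn x ⟨hu.1.trans_lt hx.1, hx.2.trans_le hv.2⟩ (hpos x hx)
      linarith
  have := hmono ⟨le_rfl, hv.1⟩ ⟨hv.1, le_rfl⟩ hv.1
  simp only at this
  nlinarith [mul_le_mul_of_nonneg_left hv.2 hε]

lemma forward_bound {a b : ℝ} {D D' : ℝ → ℝ} (hc : ContinuousOn D (Icc a b))
    (hd : ∀ x ∈ Ioo a b, HasDerivAt D (D' x) x)
    (hn : ∀ x ∈ Ioo a b, 0 < D x → D' x ≤ 0) {u : ℝ} (hu : u ∈ Icc a b) :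
    D u ≤ max 0 (D a) := by
  have key := backward_bound (a := -b) (b := -a) (ε := 0) (D := fun x => D (-x))
    (D' := fun x => -D' (-x)) le_rfl ?_ ?_ ?_ (u := -u) ⟨by linarith [hu.2], by linarith [hu.1]⟩
  · simpa using key
  · exact hc.comp (by fun_prop) fun x hx => ⟨by linarith [hx.2], by linarith [hx.1]⟩
  · intro x hx
    have := (hd (-x) ⟨by linarith [hx.2], by linarith [hx.1]⟩).comp x (hasDerivAt_neg x)
    simpa [Function.comp_def] using this
  · intro x hx h
    have := hn (-x) ⟨by linarith [hx.2], by linarith [hx.1]⟩ h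
    simpa using this

/-! ### The phase-plane equation -/

/-- `q` solves `q' = c √(2q) - h` on `[a,b]`; for a profile `q` is half the squared flux as a
function of the density. -/
structure IsOrbit (h : ℝ → ℝ) (c a b : ℝ) (q : ℝ → ℝ) : Prop where
  cont : ContinuousOn q (Icc a b)
  deriv : ∀ u ∈ Ioo a b, HasDerivAt q (c * √(2 * q u) - h u) u

lemma IsOrbit.mono {h : ℝ → ℝ} {c a b a' b' : ℝ} {q : ℝ → ℝ} (hq : IsOrbit h c a b q)
    (ha : a ≤ a') (hb : b' ≤ b) : IsOrbit h c a' b' q :=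
  ⟨hq.cont.mono (Icc_subset_Icc ha hb), fun u hu => hq.deriv u ⟨ha.trans_lt hu.1, hu.2.trans_le hb⟩⟩

/-- Where `q₂ > q₁` and `c₂ ≥ c₁`, the derivative of `q₂ - q₁` is nonnegative, so an excess of `q₂`
could not disappear before the right end. -/
lemma IsOrbit.le_of_le {h : ℝ → ℝ} {c₁ c₂ a b : ℝ} {q₁ q₂ : ℝ → ℝ} (h₁ : IsOrbit h c₁ a b q₁)
    (h₂ : IsOrbit h c₂ a b q₂) (hc₂ : 0 ≤ c₂) (hc : c₁ ≤ c₂) (hb : q₂ b ≤ q₁ b) {u : ℝ}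
    (hu : u ∈ Icc a b) : q₂ u ≤ q₁ u := by
  have key := backward_bound (D := fun x => q₂ x - q₁ x)
    (D' := fun x => (c₂ * √(2 * q₂ x) - h x) - (c₁ * √(2 * q₁ x) - h x)) (le_refl (0 : ℝ))
    (h₂.cont.sub h₁.cont) (fun x hx => (h₂.deriv x hx).sub (h₁.deriv x hx)) ?_ hu
  · have : max 0 (q₂ b - q₁ b) = 0 := max_eq_left (by linarith)
    simp only [this] at key
    linarith
  · intro x _ hx
    have h1 : √(2 * q₁ x) ≤ √(2 * q₂ x) := Real.sqrt_le_sqrt (by linarith)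
    have h2 := mul_le_mul hc h1 (Real.sqrt_nonneg _) hc₂
    linarith

lemma IsOrbit.eqOn {h : ℝ → ℝ} {c a b : ℝ} {q₁ q₂ : ℝ → ℝ} (h₁ : IsOrbit h c a b q₁)
    (h₂ : IsOrbit h c a b q₂) (hc : 0 ≤ c) (hb : q₁ b = q₂ b) : EqOn q₁ q₂ (Icc a b) :=
  fun _ hu => le_antisymm (h₂.le_of_le h₁ hc le_rfl hb.le hu) (h₁.le_of_le h₂ hc le_rfl hb.ge hu)

lemma IsOrbit.sub_le_sub {h : ℝ → ℝ} {c₁ c₂ a b : ℝ} {q₁ q₂ : ℝ → ℝ} (h₁ : IsOrbit h c₁ a b q₁)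
    (h₂ : IsOrbit h c₂ a b q₂) (hc₂ : 0 ≤ c₂) (hc : c₁ ≤ c₂) {u : ℝ} (hu : u ∈ Icc a b)
    (hlt : q₁ u < q₂ u) : q₂ u - q₁ u ≤ q₂ b - q₁ b := by
  have key := backward_bound (D := fun x => q₂ x - q₁ x)
    (D' := fun x => (c₂ * √(2 * q₂ x) - h x) - (c₁ * √(2 * q₁ x) - h x)) (le_refl (0 : ℝ))
    (h₂.cont.sub h₁.cont) (fun x hx => (h₂.deriv x hx).sub (h₁.deriv x hx)) ?_ hu
  · rcases le_total (q₂ b - q₁ b) 0 with h0 | h0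
    · simp only [max_eq_left h0] at key
      linarith
    · simp only [max_eq_right h0] at key
      linarith
  · intro x _ hx
    have h1 : √(2 * q₁ x) ≤ √(2 * q₂ x) := Real.sqrt_le_sqrt (by linarith)
    have h2 := mul_le_mul hc h1 (Real.sqrt_nonneg _) hc₂
    linarith

/-- In `c₁ √(2q₁) - c₂ √(2q₂) = c₁ (√(2q₁) - √(2q₂)) + (c₁ - c₂) √(2q₂)` the first term has the sign
of `q₁ - q₂` and helps; only the second one costs. Hence a bound `M` is needed for `q₂` alone, and
at equal speeds differences do not grow backward. -/
lemma IsOrbit.sub_le_add {h : ℝ → ℝ} {c₁ c₂ a b M : ℝ} {q₁ q₂ : ℝ → ℝ} (h₁ : IsOrbit h c₁ a b q₁)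
    (h₂ : IsOrbit h c₂ a b q₂) (hc₁ : 0 ≤ c₁) (hM : ∀ u ∈ Icc a b, √(2 * q₂ u) ≤ M)
    {u : ℝ} (hu : u ∈ Icc a b) :
    |q₁ u - q₂ u| ≤ |q₁ b - q₂ b| + |c₁ - c₂| * M * (b - a) := by
  have hM0 : 0 ≤ M := (Real.sqrt_nonneg _).trans (hM u hu)
  have hE : 0 ≤ |c₁ - c₂| * M := mul_nonneg (abs_nonneg _) hM0
  have hfin : |c₁ - c₂| * M * (b - u) ≤ |c₁ - c₂| * M * (b - a) :=
    mul_le_mul_of_nonneg_left (by linarith [hu.1]) hE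
  have hprod : ∀ x ∈ Icc a b, |(c₁ - c₂) * √(2 * q₂ x)| ≤ |c₁ - c₂| * M := by
    intro x hx
    rw [abs_mul, abs_of_nonneg (Real.sqrt_nonneg _)]
    exact mul_le_mul_of_nonneg_left (hM x hx) (abs_nonneg _)
  have k1 := backward_bound (D := fun x => q₁ x - q₂ x)
    (D' := fun x => (c₁ * √(2 * q₁ x) - h x) - (c₂ * √(2 * q₂ x) - h x)) hE
    (h₁.cont.sub h₂.cont) (fun x hx => (h₁.deriv x hx).sub (h₂.deriv x hx)) (by
      intro x hx hpos
      have h1 : √(2 * q₂ x) ≤ √(2 * q₁ x) := Real.sqrt_le_sqrt (by linarith)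
      have h2 := mul_le_mul_of_nonneg_left h1 hc₁
      have h3 := neg_le_of_abs_le (hprod x (Ioo_subset_Icc_self hx))
      linarith) hu
  have k2 := backward_bound (D := fun x => q₂ x - q₁ x)
    (D' := fun x => (c₂ * √(2 * q₂ x) - h x) - (c₁ * √(2 * q₁ x) - h x)) hE
    (h₂.cont.sub h₁.cont) (fun x hx => (h₂.deriv x hx).sub (h₁.deriv x hx)) (by
      intro x hx hpos
      have h1 : √(2 * q₁ x) ≤ √(2 * q₂ x) := Real.sqrt_le_sqrt (by linarith)
      have h2 := mul_le_mul_of_nonneg_left h1 hc₁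
      have h3 := le_of_abs_le (hprod x (Ioo_subset_Icc_self hx))
      linarith) hu
  have m1 : max 0 (q₁ b - q₂ b) ≤ |q₁ b - q₂ b| := max_le (abs_nonneg _) (le_abs_self _)
  have m2 : max 0 (q₂ b - q₁ b) ≤ |q₁ b - q₂ b| := by
    rw [abs_sub_comm]; exact max_le (abs_nonneg _) (le_abs_self _)
  rw [abs_le]
  constructor <;> linarith

/-! ### Existence for the backward problem -/

lemma sqrt_add_sq_sub_le {x y ε : ℝ} (hx : 0 ≤ x) (hy : 0 ≤ y) (hε : 0 < ε) :
    |√(x + ε ^ 2) - √(y + ε ^ 2)| ≤ (1 / ε) * |x - y| := by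
  wlog hxy : y ≤ x generalizing x y
  · rw [abs_sub_comm, abs_sub_comm x y]
    exact this hy hx (le_of_not_ge hxy)
  have h1 : √(y + ε ^ 2) ≤ √(x + ε ^ 2) := Real.sqrt_le_sqrt (by linarith)
  rw [abs_of_nonneg (by linarith), abs_of_nonneg (by linarith)]
  have hεx : ε ≤ √(x + ε ^ 2) := Real.le_sqrt_of_sq_le (by linarith)
  have hεy : ε ≤ √(y + ε ^ 2) := Real.le_sqrt_of_sq_le (by linarith)
  have e1 := Real.sq_sqrt (show 0 ≤ x + ε ^ 2 by positivity)
  have e2 := Real.sq_sqrt (show 0 ≤ y + ε ^ 2 by positivity)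
  rw [div_mul_eq_mul_div, one_mul, le_div_iff₀ hε]
  nlinarith

/-- A Lipschitz regularization of `q ↦ √(2q)`. -/
noncomputable def regSqrt (ε q : ℝ) : ℝ := √(2 * max q 0 + ε ^ 2)

lemma sqrt_le_regSqrt (ε q : ℝ) : √(2 * q) ≤ regSqrt ε q :=
  Real.sqrt_le_sqrt (by nlinarith [le_max_left q 0])

lemma regSqrt_le {ε : ℝ} (hε : 0 ≤ ε) (q : ℝ) : regSqrt ε q ≤ √(2 * q) + ε := by
  rcases le_total q 0 with hq | hq
  · rw [regSqrt, max_eq_right hq, mul_zero, zero_add, Real.sqrt_sq hε]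
    linarith [Real.sqrt_nonneg (2 * q)]
  · rw [regSqrt, max_eq_left hq]
    refine Real.sqrt_le_iff.2 ⟨by positivity, ?_⟩
    nlinarith [Real.sq_sqrt (show 0 ≤ 2 * q by linarith), Real.sqrt_nonneg (2 * q)]

lemma regSqrt_lipschitz {ε : ℝ} (hε : 0 < ε) (x y : ℝ) :
    |regSqrt ε x - regSqrt ε y| ≤ (2 / ε) * |x - y| := by
  have h := sqrt_add_sq_sub_le (x := 2 * max x 0) (y := 2 * max y 0) (by positivity) (by positivity) hε
  refine h.trans ?_
  rw [← mul_sub, abs_mul, abs_two, ← mul_assoc]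
  have h2 : |max x 0 - max y 0| ≤ |x - y| := abs_max_sub_max_le_abs x y 0
  have : 1 / ε * 2 = 2 / ε := by ring
  rw [this]
  exact mul_le_mul_of_nonneg_left h2 (by positivity)

/-- Picard-Lindelöf on the whole interval at once: the regularized right side is Lipschitz and grows
like a square root, so a large enough ball around `θ` is never left. -/
lemma exists_regularized_orbit {h : ℝ → ℝ} (hh : Continuous h) {c a b ε : ℝ} (hc : 0 ≤ c)
    (hab : a ≤ b) (hε : 0 < ε) (θ : ℝ) :
    ∃ q : ℝ → ℝ, q b = θ ∧ ContinuousOn q (Icc a b) ∧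
      ∀ u ∈ Ioo a b, HasDerivAt q (c * regSqrt ε (q u) - h u) u := by
  obtain ⟨K, hK⟩ := (isCompact_Icc (a := a) (b := b)).exists_bound_of_continuousOn hh.continuousOn
  have hK0 : 0 ≤ K := (norm_nonneg _).trans (hK a ⟨le_rfl, hab⟩)
  set T := b - a with hT
  have hT0 : 0 ≤ T := by linarith
  -- The radius must satisfy `T (c √(2ρ + y₀) + K) ≤ ρ`. By `√y ≤ (y / lam + lam) / 2` with `lam >
  -- 2cT`, the root contributes at most `y / 4 + c T lam / 2`, where `y = 2ρ + y₀`. Half of `ρ` is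
  -- absorbed and the remaining half is the constant in the definition of `ρ`.
  set lam := 2 * c * T + 1 with hlam
  have hlam0 : 0 < lam := by positivity
  set y₀ := 2 * |θ| + ε ^ 2 with hy₀
  have hy₀' : 0 ≤ y₀ := by positivity
  set ρ := 2 * (y₀ / 4 + c * T * lam / 2 + K * T) with hρ
  have hρ0 : 0 ≤ ρ := by positivity
  set L := c * √(2 * ρ + y₀) + K with hL
  have hL0 : 0 ≤ L := by positivity
  have hLT : L * T ≤ ρ := by
    set y := 2 * ρ + y₀ with hy
    have hy0 : 0 ≤ y := by positivity
    have hs : √y ≤ (y / lam + lam) / 2 := by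
      have : y ≤ ((y / lam + lam) / 2) ^ 2 := by
        have e : y = (y / lam) * lam := by field_simp
        nlinarith [sq_nonneg (y / lam - lam)]
      exact Real.sqrt_le_iff.2 ⟨by positivity, this⟩
    have h1 : c * T * √y ≤ c * T * ((y / lam + lam) / 2) :=
      mul_le_mul_of_nonneg_left hs (by positivity)
    have h2 : c * T * (y / lam) ≤ y / 2 := by
      rw [← mul_div_assoc, div_le_div_iff₀ hlam0 two_pos]
      nlinarith
    have : L * T = c * T * √y + K * T := by rw [hL]; ring
    rw [this]
    have h3 : ρ = 2 * (y₀ / 4 + c * T * lam / 2 + K * T) := hρ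
    nlinarith
  have hPL : IsPicardLindelof (fun t x => c * regSqrt ε x - h t) (tmin := a) (tmax := b)
      ⟨b, hab, le_rfl⟩ θ ρ.toNNReal 0 L.toNNReal (c * (2 / ε)).toNNReal := by
    have hcε : 0 ≤ c * (2 / ε) := by positivity
    refine ⟨fun t _ => ?_, fun x _ => by fun_prop, fun t ht x hx => ?_, ?_⟩
    · refine LipschitzWith.lipschitzOnWith (LipschitzWith.of_dist_le_mul fun x y => ?_)
      rw [Real.coe_toNNReal _ hcε, Real.dist_eq, Real.dist_eq]
      have : c * regSqrt ε x - h t - (c * regSqrt ε y - h t) = c * (regSqrt ε x - regSqrt ε y) := by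
        ring
      rw [this, abs_mul, abs_of_nonneg hc, mul_assoc]
      exact mul_le_mul_of_nonneg_left (regSqrt_lipschitz hε x y) hc
    · rw [Real.coe_toNNReal _ hρ0, Metric.mem_closedBall, Real.dist_eq] at hx
      rw [Real.coe_toNNReal _ hL0]
      have hx' : max x 0 ≤ |θ| + ρ := by
        refine max_le ?_ (by positivity)
        have := (abs_le.1 hx).2
        linarith [le_abs_self θ]
      have hr : regSqrt ε x ≤ √(2 * ρ + y₀) := Real.sqrt_le_sqrt (by rw [hy₀]; linarith)
      have h0 : 0 ≤ regSqrt ε x := Real.sqrt_nonneg _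
      refine (norm_sub_le _ _).trans ?_
      rw [Real.norm_of_nonneg (mul_nonneg hc h0)]
      exact add_le_add (mul_le_mul_of_nonneg_left hr hc) (hK t ht)
    · simp only [sub_self, NNReal.coe_zero, sub_zero]
      rw [Real.coe_toNNReal _ hρ0, Real.coe_toNNReal _ hL0, max_eq_right hT0]
      exact hLT
  obtain ⟨q, hq, hd⟩ := hPL.exists_eq_forall_mem_Icc_hasDerivWithinAt₀
  refine ⟨q, hq, fun u hu => (hd u hu).continuousWithinAt, fun u hu => ?_⟩
  exact (hd u (Ioo_subset_Icc_self hu)).hasDerivAt (Icc_mem_nhds hu.1 hu.2)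

lemma abs_sqrt_sub_sqrt_le (x y : ℝ) : |√x - √y| ≤ √|x - y| := by
  wlog hxy : y ≤ x generalizing x y
  · rw [abs_sub_comm, abs_sub_comm x y]
    exact this y x (le_of_not_ge hxy)
  rw [abs_of_nonneg (sub_nonneg.2 (Real.sqrt_le_sqrt hxy)), abs_of_nonneg (sub_nonneg.2 hxy)]
  rcases le_total y 0 with hy | hy
  · rw [Real.sqrt_eq_zero_of_nonpos hy, sub_zero]
    exact Real.sqrt_le_sqrt (by linarith)
  · refine Real.le_sqrt_of_sq_le ?_
    have e1 := Real.sq_sqrt hy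
    have e2 := Real.sq_sqrt (hy.trans hxy)
    nlinarith [Real.sqrt_nonneg y, Real.sqrt_le_sqrt hxy]

/-- The regularizations satisfy `√(2q) ≤ regSqrt ε q ≤ √(2q) + ε`, so the one-sided comparison makes
the approximate solutions Cauchy with the explicit rate `c ε (b - a)`. No compactness argument is
needed, and the derivatives converge uniformly too. -/
theorem exists_orbit {h : ℝ → ℝ} (hh : Continuous h) {c a b : ℝ} (hc : 0 ≤ c)
    (hab : a ≤ b) (θ : ℝ) : ∃ q : ℝ → ℝ, q b = θ ∧ IsOrbit h c a b q := by
  set e : ℕ → ℝ := fun n => 1 / ((n : ℝ) + 1) with he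
  have he0 : ∀ n, 0 < e n := fun n => Nat.one_div_pos_of_nat
  have helim : Tendsto e atTop (𝓝 0) := tendsto_one_div_add_atTop_nhds_zero_nat
  choose Q hQb hQc hQd using fun n => exists_regularized_orbit hh hc hab (he0 n) θ
  have one_side : ∀ n m, ∀ u ∈ Icc a b, Q n u - Q m u ≤ c * e m * (b - a) := by
    intro n m u hu
    have hE : 0 ≤ c * e m := mul_nonneg hc (he0 m).le
    have key := backward_bound (D := fun x => Q n x - Q m x) hE ((hQc n).sub (hQc m))
      (fun x hx => (hQd n x hx).sub (hQd m x hx)) (by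
        intro x hx hpos
        have h1 : √(2 * Q m x) ≤ √(2 * Q n x) := Real.sqrt_le_sqrt (by linarith)
        have h2 : regSqrt (e m) (Q m x) - e m ≤ regSqrt (e n) (Q n x) := by
          linarith [sqrt_le_regSqrt (e n) (Q n x), regSqrt_le (he0 m).le (Q m x)]
        have := mul_le_mul_of_nonneg_left h2 hc
        linarith) hu
    simp only [hQb, sub_self, max_self, zero_add] at key
    exact key.trans (mul_le_mul_of_nonneg_left (by linarith [hu.1]) hE)
  have hcauchy : ∀ u ∈ Icc a b, CauchySeq fun n => Q n u := by
    intro u hu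
    refine cauchySeq_of_le_tendsto_0 (fun n => c * e n * (b - a)) (fun n m N hn hm => ?_) ?_
    · have mono : ∀ k, N ≤ k → c * e k * (b - a) ≤ c * e N * (b - a) := fun k hk =>
        mul_le_mul_of_nonneg_right (mul_le_mul_of_nonneg_left
          (Nat.one_div_le_one_div hk) hc) (by linarith)
      rw [Real.dist_eq, abs_le]
      constructor
      · linarith [one_side m n u hu, mono n hn]
      · linarith [one_side n m u hu, mono m hm]
    · simpa using (helim.const_mul c).mul_const (b - a)
  choose! q hq using fun u (hu : u ∈ Icc a b) => cauchySeq_tendsto_of_complete (hcauchy u hu)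
  have hdist : ∀ n, ∀ u ∈ Icc a b, |q u - Q n u| ≤ c * e n * (b - a) := by
    intro n u hu
    rw [abs_le]
    constructor
    · have h1 : Tendsto (fun m => Q n u - Q m u) atTop (𝓝 (Q n u - q u)) :=
        tendsto_const_nhds.sub (hq u hu)
      have h2 : Tendsto (fun m => c * e m * (b - a)) atTop (𝓝 0) := by
        simpa using (helim.const_mul c).mul_const (b - a)
      have := le_of_tendsto_of_tendsto' h1 h2 (fun m => one_side n m u hu)
      have h3 : 0 ≤ c * e n * (b - a) :=
        mul_nonneg (mul_nonneg hc (he0 n).le) (by linarith)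
      linarith
    · exact le_of_tendsto' ((hq u hu).sub_const _) (fun m => one_side m n u hu)
  have hunif : TendstoUniformlyOn Q q atTop (Icc a b) := by
    rw [Metric.tendstoUniformlyOn_iff]
    intro δ hδ
    have h2 : Tendsto (fun m => c * e m * (b - a)) atTop (𝓝 0) := by
      simpa using (helim.const_mul c).mul_const (b - a)
    filter_upwards [h2.eventually_lt_const hδ] with n hn u hu
    exact (hdist n u hu).trans_lt hn
  refine ⟨q, ?_, hunif.continuousOn (Frequently.of_forall hQc), fun u hu => ?_⟩
  · have := hq b ⟨hab, le_rfl⟩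
    simp only [hQb] at this
    exact tendsto_nhds_unique this tendsto_const_nhds
  · refine hasDerivAt_of_tendstoUniformlyOn (l := atTop) isOpen_Ioo
      (f := Q) (f' := fun n u => c * regSqrt (e n) (Q n u) - h u)
      (g' := fun u => c * √(2 * q u) - h u) ?_ (Eventually.of_forall hQd)
      (fun x hx => hq x (Ioo_subset_Icc_self hx)) hu
    rw [Metric.tendstoUniformlyOn_iff]
    intro δ hδ
    have h2 : Tendsto (fun m => c * (√(2 * (c * e m * (b - a))) + e m)) atTop (𝓝 0) := by
      have h3 : Tendsto (fun m => 2 * (c * e m * (b - a))) atTop (𝓝 0) := by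
        simpa using ((helim.const_mul c).mul_const (b - a)).const_mul 2
      have h4 := (Real.continuous_sqrt.tendsto 0).comp h3
      simpa using (h4.add helim).const_mul c
    filter_upwards [h2.eventually_lt_const hδ] with n hn x hx
    refine lt_of_le_of_lt ?_ hn
    rw [Real.dist_eq]
    have e1 : c * √(2 * q x) - h x - (c * regSqrt (e n) (Q n x) - h x)
        = c * (√(2 * q x) - regSqrt (e n) (Q n x)) := by ring
    rw [e1, abs_mul, abs_of_nonneg hc]
    refine mul_le_mul_of_nonneg_left ?_ hc
    have h5 : |√(2 * q x) - √(2 * Q n x)| ≤ √(2 * (c * e n * (b - a))) := by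
      refine (abs_sqrt_sub_sqrt_le _ _).trans (Real.sqrt_le_sqrt ?_)
      rw [← mul_sub, abs_mul, abs_two]
      exact mul_le_mul_of_nonneg_left (hdist n x (Ioo_subset_Icc_self hx)) two_pos.le
    have h6 := sqrt_le_regSqrt (e n) (Q n x)
    have h7 := regSqrt_le (he0 n).le (Q n x)
    rw [abs_le] at h5 ⊢
    have := (he0 n).le
    constructor <;> linarith

/-! ### Barriers and positivity -/

/-- The parabola `(ηu)² / 2` is the exact solution for the reaction `η (c - η) u`. A smaller
reaction makes `q` increase faster, so backward in `u` it stays below. -/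
lemma IsOrbit.le_parabola {h : ℝ → ℝ} {c r η : ℝ} {q : ℝ → ℝ} (hq : IsOrbit h c 0 r q)
    (hc : 0 ≤ c) (hh : ∀ u ∈ Ioo 0 r, h u ≤ η * (c - η) * u)
    (hr : q r ≤ (η * r) ^ 2 / 2) {u : ℝ} (hu : u ∈ Icc 0 r) : q u ≤ (η * u) ^ 2 / 2 := by
  have key := backward_bound (D := fun x => q x - (η * x) ^ 2 / 2)
    (D' := fun x => (c * √(2 * q x) - h x) - η ^ 2 * x) (le_refl (0 : ℝ))
    (hq.cont.sub (by fun_prop)) (fun x hx => (hq.deriv x hx).sub (by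
      have := (((hasDerivAt_id x).const_mul η).pow 2).div_const 2
      convert! this using 1
      simp; ring)) ?_ hu
  · have : max 0 (q r - (η * r) ^ 2 / 2) = 0 := max_eq_left (by linarith)
    simp only [this] at key
    linarith
  · intro x hx hpos
    have h1 : η * x ≤ √(2 * q x) := Real.le_sqrt_of_sq_le (by linarith)
    have h2 := mul_le_mul_of_nonneg_left h1 hc
    have := hh x hx
    nlinarith

/-- Where `q < 0` the root is `0` and `q' = -h < 0`, so a negative value would persist up to `b`. -/
lemma IsOrbit.nonneg {h : ℝ → ℝ} {c a b : ℝ} {q : ℝ → ℝ} (hq : IsOrbit h c a b q)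
    (hh : ∀ u ∈ Ioo a b, 0 < h u) (hb : 0 ≤ q b) {u : ℝ} (hu : u ∈ Icc a b) : 0 ≤ q u := by
  have key := backward_bound (D := fun x => - q x) (D' := fun x => -(c * √(2 * q x) - h x))
    (le_refl (0 : ℝ)) hq.cont.neg (fun x hx => (hq.deriv x hx).neg) (by
      intro x hx hpos
      rw [Real.sqrt_eq_zero_of_nonpos (by linarith)]
      have := hh x hx
      linarith) hu
  have : max 0 (-q b) = 0 := max_eq_left (by linarith)
  simp only [this] at key
  linarith

lemma IsOrbit.pos {h : ℝ → ℝ} {c a b : ℝ} {q : ℝ → ℝ} (hq : IsOrbit h c a b q)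
    (hh : ∀ u ∈ Ioo a b, 0 < h u) (hb : 0 ≤ q b) {u : ℝ} (hu : u ∈ Ioo a b) : 0 < q u := by
  refine (hq.nonneg hh hb (Ioo_subset_Icc_self hu)).lt_of_ne' fun h0 => ?_
  have hmin : IsLocalMin q u := by
    filter_upwards [Icc_mem_nhds hu.1 hu.2] with x hx
    rw [h0]
    exact hq.nonneg hh hb hx
  have := hmin.hasDerivAt_eq_zero (hq.deriv u hu)
  rw [h0] at this
  simp only [mul_zero, Real.sqrt_zero, zero_sub, neg_eq_zero] at this
  exact (hh u hu).ne' this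

lemma IsOrbit.monotoneOn {h : ℝ → ℝ} {c a b : ℝ} {q : ℝ → ℝ} (hq : IsOrbit h c a b q)
    (hc : 0 ≤ c) (hh : ∀ u ∈ Ioo a b, h u ≤ 0) : MonotoneOn q (Icc a b) :=
  monotoneOn_Icc_of_hasDerivAt hq.cont hq.deriv fun x hx => by
    have := mul_nonneg hc (Real.sqrt_nonneg (2 * q x))
    linarith [hh x hx]

lemma IsOrbit.hasDerivAt_sqrt {h : ℝ → ℝ} {c a b : ℝ} {q : ℝ → ℝ} (hq : IsOrbit h c a b q)
    {u : ℝ} (hu : u ∈ Ioo a b) (hpos : 0 < q u) :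
    HasDerivAt (fun x => √(2 * q x)) (c - h u / √(2 * q u)) u := by
  have hs : √(2 * q u) ≠ 0 := (Real.sqrt_pos.2 (by linarith)).ne'
  have := ((hq.deriv u hu).const_mul 2).sqrt (by positivity)
  convert! this using 1
  field_simp

lemma IsOrbit.exists_sqrt_le {h : ℝ → ℝ} {c a b : ℝ} {q : ℝ → ℝ} (hq : IsOrbit h c a b q) :
    ∃ M, 0 ≤ M ∧ ∀ u ∈ Icc a b, √(2 * q u) ≤ M := by
  have hc : ContinuousOn (fun u => √(2 * q u)) (Icc a b) :=
    Real.continuous_sqrt.comp_continuousOn (hq.cont.const_smul (2 : ℝ))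
  obtain ⟨M, hM⟩ := isCompact_Icc.exists_bound_of_continuousOn hc
  exact ⟨max M 0, le_max_right _ _, fun u hu =>
    (le_abs_self _).trans ((hM u hu).trans (le_max_left _ _))⟩

/-- The shifted parabola `(N (x + 1))² / 2`, with `N = c + K + 1`, increases faster than any orbit
lying below it, so an orbit above it at `R` is above it at `0`, where it equals `N² / 2 > 0`. -/
lemma IsOrbit.left_pos_of_large {h : ℝ → ℝ} {c R K : ℝ} {q : ℝ → ℝ} (hq : IsOrbit h c 0 R q)
    (hc : 0 ≤ c) (hR : 0 ≤ R) (hK : ∀ u ∈ Icc 0 R, |h u| ≤ K)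
    (hqR : ((c + K + 1) * (R + 1)) ^ 2 / 2 ≤ q R) : 0 < q 0 := by
  have hK0 : 0 ≤ K := (abs_nonneg _).trans (hK 0 ⟨le_rfl, hR⟩)
  set N := c + K + 1 with hN
  have hN1 : 1 ≤ N := by linarith
  have key := backward_bound (D := fun x => (N * (x + 1)) ^ 2 / 2 - q x)
    (D' := fun x => N ^ 2 * (x + 1) - (c * √(2 * q x) - h x)) (le_refl (0 : ℝ))
    (ContinuousOn.sub (by fun_prop) hq.cont) (fun x hx => HasDerivAt.sub (by
      have := ((((hasDerivAt_id x).add_const 1).const_mul N).pow 2).div_const 2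
      convert! this using 1
      simp; ring) (hq.deriv x hx)) ?_ (u := 0) ⟨le_rfl, hR⟩
  · have : max 0 ((N * (R + 1)) ^ 2 / 2 - q R) = 0 := max_eq_left (by linarith)
    simp only [this] at key
    nlinarith
  · intro x hx hpos
    have hx0 : 0 ≤ x := hx.1.le
    have h1 : √(2 * q x) ≤ N * (x + 1) := Real.sqrt_le_iff.2 ⟨by positivity, by linarith⟩
    have h2 := mul_le_mul_of_nonneg_left h1 hc
    have h3 := neg_le_of_abs_le (hK x (Ioo_subset_Icc_self hx))
    have h4 : K ≤ (K + 1) * N * (x + 1) := by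
      have : 1 ≤ N * (x + 1) := by nlinarith
      nlinarith
    nlinarith

lemma IsOrbit.left_nonpos_of_small {h : ℝ → ℝ} {c R K : ℝ} {q : ℝ → ℝ} (hq : IsOrbit h c 0 R q)
    (hc : 0 ≤ c) (hR : 0 ≤ R) (hK : ∀ u ∈ Icc 0 R, |h u| ≤ K) (hqR : q R ≤ -K * R) : q 0 ≤ 0 := by
  have key := monotoneOn_Icc_of_hasDerivAt (D := fun x => q x + K * x)
    (D' := fun x => (c * √(2 * q x) - h x) + K)
    (hq.cont.add (by fun_prop)) (fun x hx => (hq.deriv x hx).add (by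
      simpa using (hasDerivAt_id x).const_mul K)) (by
      intro x hx
      have h1 := mul_nonneg hc (Real.sqrt_nonneg (2 * q x))
      have h2 := le_of_abs_le (hK x (Ioo_subset_Icc_self hx))
      linarith) ⟨le_rfl, hR⟩ ⟨hR, le_rfl⟩ hR
  simp only at key
  linarith

/-! ### Sharp orbits and the dichotomy at the origin -/

/-- The flux `√(2q)` leaves the origin with slope `c`. -/
def IsSharpAtZero (c : ℝ) (q : ℝ → ℝ) : Prop :=
  Tendsto (fun u => √(2 * q u) / u) (𝓝[>] 0) (𝓝 c)

/-- `h u = o(u)` as `u → 0+`. -/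
def IsFlatAtZero (h : ℝ → ℝ) : Prop := ∀ ε > 0, ∃ r > 0, ∀ u ∈ Ioo 0 r, |h u| ≤ ε * u

/-- With `√(2q) ≥ ηu` and `h = o(u)`, the derivative `c - h / √(2q)` of the flux tends to `c`; any
positive lower slope thus improves to slope exactly `c`. -/
lemma IsOrbit.isSharp_of_lower {h : ℝ → ℝ} (hflat : IsFlatAtZero h) {c R r η : ℝ} {q : ℝ → ℝ}
    (hq : IsOrbit h c 0 R q) (hr : 0 < r) (hR : 0 < R) (hη : 0 < η) (h0 : q 0 = 0)
    (hlow : ∀ u ∈ Ioo 0 r, (η * u) ^ 2 / 2 ≤ q u) : IsSharpAtZero c q := by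
  have hpos : ∀ u ∈ Ioo 0 (min r R), 0 < q u := fun u hu => by
    have h1 := hlow u ⟨hu.1, hu.2.trans_le (min_le_left _ _)⟩
    have : 0 < η * u := mul_pos hη hu.1
    nlinarith
  have hd : ∀ u ∈ Ioo 0 (min r R),
      HasDerivAt (fun x => √(2 * q x)) (c - h u / √(2 * q u)) u := fun u hu =>
    hq.hasDerivAt_sqrt ⟨hu.1, hu.2.trans_le (min_le_right _ _)⟩ (hpos u hu)
  have hm : 0 < min r R := lt_min hr hR
  have hmem : Ioo 0 (min r R) ∈ 𝓝[>] (0 : ℝ) := Ioo_mem_nhdsGT hm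
  have hlim : Tendsto (fun u => h u / √(2 * q u)) (𝓝[>] 0) (𝓝 0) := by
    rw [Metric.tendsto_nhds]
    intro ε hε
    obtain ⟨r', hr', hr''⟩ := hflat (ε / 2 * η) (by positivity)
    filter_upwards [hmem, Ioo_mem_nhdsGT hr'] with u hu hu'
    rw [Real.dist_eq, sub_zero, abs_div, abs_of_nonneg (Real.sqrt_nonneg _)]
    have h1 : η * u ≤ √(2 * q u) := Real.le_sqrt_of_sq_le (by
      linarith [hlow u ⟨hu.1, hu.2.trans_le (min_le_left _ _)⟩])
    have hs : 0 < √(2 * q u) := Real.sqrt_pos.2 (by linarith [hpos u hu])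
    rw [div_lt_iff₀ hs]
    have h2 := hr'' u hu'
    have h3 : 0 < η * u := mul_pos hη hu.1
    nlinarith
  have hcont : ContinuousWithinAt (fun x => √(2 * q x)) (Ioo 0 (min r R)) 0 := by
    have := (hq.cont.const_smul (2 : ℝ)) 0 ⟨le_rfl, hR.le⟩
    exact (Real.continuous_sqrt.continuousAt.comp_continuousWithinAt this).mono
      fun x hx => ⟨hx.1.le, hx.2.le.trans (min_le_right _ _)⟩
  have hder : HasDerivWithinAt (fun x => √(2 * q x)) c (Ici 0) 0 := by
    refine hasDerivWithinAt_Ici_of_tendsto_deriv (s := Ioo 0 (min r R))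
      (fun u hu => (hd u hu).differentiableAt.differentiableWithinAt) hcont hmem ?_
    have h1 : Tendsto (fun u => c - h u / √(2 * q u)) (𝓝[>] 0) (𝓝 c) := by
      simpa using hlim.const_sub c
    refine h1.congr' ?_
    filter_upwards [hmem] with u hu
    exact (hd u hu).deriv.symm
  have h2 := (hasDerivWithinAt_iff_tendsto_slope.1 hder)
  rw [show Ici (0 : ℝ) \ {0} = Ioi 0 by ext; simp [lt_iff_le_and_ne, eq_comm]] at h2
  refine h2.congr' ?_
  filter_upwards with u
  simp [slope_def_field, h0]

lemma IsOrbit.sharp_or_slow {h : ℝ → ℝ} (hflat : IsFlatAtZero h) {c R : ℝ} {q : ℝ → ℝ}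
    (hq : IsOrbit h c 0 R q) (hc : 0 < c) (hR : 0 < R) (h0 : q 0 = 0) :
    IsSharpAtZero c q ∨ ∀ r > 0, ∃ u ∈ Ioo 0 (min r R), q u < (c / 2 * u) ^ 2 / 2 := by
  by_cases hS : ∃ r > 0, ∀ u ∈ Ioo 0 (min r R), (c / 2 * u) ^ 2 / 2 ≤ q u
  · obtain ⟨r, hr, hl⟩ := hS
    exact .inl (hq.isSharp_of_lower hflat (lt_min hr hR) hR (half_pos hc) h0 hl)
  · push Not at hS
    exact .inr hS

/-- A non-sharp orbit is strictly below the parabola of slope `c / 2` at some small `u`. Nearby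
orbits are below it at the same `u`, and the parabola then carries them down to a nonpositive value
at `0`. This openness is what makes extremal orbits sharp. -/
lemma IsOrbit.left_nonpos_of_near {h : ℝ → ℝ} (hflat : IsFlatAtZero h) {c R : ℝ} {q : ℝ → ℝ}
    (hq : IsOrbit h c 0 R q) (hc : 0 < c) (hR : 0 < R) (h0 : q 0 = 0)
    (hns : ¬ IsSharpAtZero c q) :
    ∃ ε > 0, ∀ (c' : ℝ) (q' : ℝ → ℝ), IsOrbit h c' 0 R q' → |c' - c| < ε → |q' R - q R| < ε →
      q' 0 ≤ 0 := by
  have hslow := (hq.sharp_or_slow hflat hc hR h0).resolve_left hns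
  obtain ⟨r, hr, hrh⟩ := hflat (c ^ 2 / 8) (by positivity)
  obtain ⟨u, hu, hqu⟩ := hslow r hr
  obtain ⟨M, hM0, hM⟩ := hq.exists_sqrt_le
  set g := (c / 2 * u) ^ 2 / 2 - q u with hg
  have hg0 : 0 < g := by linarith
  have hden : 0 < 1 + M * R := by positivity
  -- The first bound gives `c' > 3c / 4`, hence `(c / 2) (c' - c / 2) ≥ c² / 8`, the constant taken
  -- in the flatness of `h`. The second keeps the total perturbation at `u` within the gap `g`.
  refine ⟨min (c / 4) (g / (1 + M * R)), lt_min (by linarith) (by positivity), ?_⟩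
  intro c' q' hq' hcc hqq
  have hc4 : |c' - c| < c / 4 := hcc.trans_le (min_le_left _ _)
  have hc' : 3 * c / 4 < c' := by linarith [(abs_lt.1 hc4).1]
  have huR : u ∈ Icc 0 R := ⟨hu.1.le, hu.2.le.trans (min_le_right _ _)⟩
  have hur : u < r := hu.2.trans_le (min_le_left _ _)
  have h1 := hq'.sub_le_add hq (by linarith) hM huR
  have h2 : |q' R - q R| + |c' - c| * M * (R - 0) ≤ g := by
    have a1 := hqq.le.trans (min_le_right _ _)
    have a2 := hcc.le.trans (min_le_right (c / 4) _)
    have hMR : 0 ≤ M * R := by positivity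
    have a3 := mul_le_mul_of_nonneg_right a2 hMR
    have a4 : g / (1 + M * R) + g / (1 + M * R) * (M * R) = g := by field_simp
    rw [sub_zero, mul_assoc]
    linarith
  have h3 : q' u ≤ (c / 2 * u) ^ 2 / 2 := by
    have := (abs_le.1 (h1.trans h2)).2
    linarith
  have h4 := (hq'.mono le_rfl huR.2).le_parabola (by linarith) (fun x hx => by
    have b1 := (le_abs_self _).trans (hrh x ⟨hx.1, hx.2.trans hur⟩)
    refine b1.trans (mul_le_mul_of_nonneg_right ?_ hx.1.le)
    nlinarith) h3 (u := 0) ⟨le_rfl, hu.1.le⟩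
  simpa using h4

/-- Sharpness would put the faster orbit above the slower one near `0`, and such a gap is
nondecreasing up to `s`, against `hend`. -/
lemma IsOrbit.not_sharp_of_lt {h : ℝ → ℝ} {c₁ c₂ s : ℝ} {q₁ q₂ : ℝ → ℝ} (hs : 0 < s)
    (h₁ : IsOrbit h c₁ 0 s q₁) (h₂ : IsOrbit h c₂ 0 s q₂) (hc₁ : 0 < c₁) (hc : c₁ < c₂)
    (hend : q₂ s ≤ q₁ s) (hsharp₁ : IsSharpAtZero c₁ q₁) : ¬ IsSharpAtZero c₂ q₂ := by
  intro hsharp₂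
  obtain ⟨m, hm1, hm2⟩ := exists_between hc
  have e1 : ∀ᶠ u in 𝓝[>] (0 : ℝ), √(2 * q₁ u) / u < m := hsharp₁.eventually_lt_const hm1
  have e2 : ∀ᶠ u in 𝓝[>] (0 : ℝ), m < √(2 * q₂ u) / u := hsharp₂.eventually_const_lt hm2
  obtain ⟨u, h1, h2, hu⟩ := (e1.and (e2.and (Ioo_mem_nhdsGT hs))).exists
  have hlt : √(2 * q₁ u) < √(2 * q₂ u) := by
    rw [div_lt_iff₀ hu.1] at h1
    rw [lt_div_iff₀ hu.1] at h2
    exact h1.trans h2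
  have hq : q₁ u < q₂ u := by
    by_contra! hle
    exact absurd (Real.sqrt_le_sqrt (show 2 * q₂ u ≤ 2 * q₁ u by linarith)) (not_le.2 hlt)
  have := h₁.sub_le_sub h₂ (hc₁.trans hc).le hc.le (Ioo_subset_Icc_self hu) hq
  linarith

lemma IsSharpAtZero.eventually_le {c : ℝ} {q : ℝ → ℝ} (hc : 0 < c) (hs : IsSharpAtZero c q) :
    ∃ r > 0, ∀ u ∈ Ioo 0 r, c / 2 * u ≤ √(2 * q u) := by
  have h1 : ∀ᶠ u in 𝓝[>] (0 : ℝ), c / 2 < √(2 * q u) / u :=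
    hs.eventually_const_lt (half_lt_self hc)
  obtain ⟨r, hr, hsub⟩ := (mem_nhdsGT_iff_exists_Ioo_subset).1 h1
  refine ⟨r, hr, fun u hu => ?_⟩
  have := hsub hu
  simp only [mem_ofPred_eq, lt_div_iff₀ hu.1] at this
  exact this.le

/-- Forward uniqueness: as long as `q₁` is positive the square root is Lipschitz between the two
ordered orbits, and Grönwall's argument applies on compact subintervals. -/
lemma IsOrbit.le_of_eq_of_pos {h : ℝ → ℝ} {c a b : ℝ} {q₁ q₂ : ℝ → ℝ} (h₁ : IsOrbit h c a b q₁)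
    (h₂ : IsOrbit h c a b q₂) (hc : 0 ≤ c) (hpos : ∀ u ∈ Ioo a b, 0 < q₁ u)
    (hle : ∀ u ∈ Icc a b, q₁ u ≤ q₂ u) {u : ℝ} (hu : u ∈ Ioo a b) (heq : q₁ u = q₂ u) :
    q₂ b ≤ q₁ b := by
  have main : ∀ x ∈ Ioo u b, q₂ x ≤ q₁ x := by
    intro x hx
    have hsub : Icc u x ⊆ Ioo a b := fun y hy => ⟨hu.1.trans_le hy.1, hy.2.trans_lt hx.2⟩
    obtain ⟨y, hy, hymin⟩ := isCompact_Icc.exists_isMinOn (nonempty_Icc.2 hx.1.le)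
      (h₁.cont.mono (hsub.trans Ioo_subset_Icc_self))
    have hm : 0 < √(2 * q₁ y) := Real.sqrt_pos.2 (by linarith [hpos y (hsub hy)])
    set m := √(2 * q₁ y)
    -- `√(2q₂) - √(2q₁) = 2 (q₂ - q₁) / (√(2q₂) + √(2q₁))`, and the denominator is at least `m`.
    set L := 2 * c / m with hL
    have hanti := monotoneOn_Icc_of_hasDerivAt (a := u) (b := x)
      (D := fun t => -((q₂ t - q₁ t) * Real.exp (-(L * t))))
      (D' := fun t => -((c * √(2 * q₂ t) - h t - (c * √(2 * q₁ t) - h t)) * Real.exp (-(L * t))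
        + (q₂ t - q₁ t) * (Real.exp (-(L * t)) * (-L)))) ?_ ?_ ?_ ⟨le_rfl, hx.1.le⟩
      ⟨hx.1.le, le_rfl⟩ hx.1.le
    · simp only [heq, sub_self, zero_mul, neg_zero] at hanti
      have := Real.exp_pos (-(L * x))
      by_contra! hlt
      have := mul_pos (sub_pos.2 hlt) this
      linarith
    · exact (((h₂.cont.sub h₁.cont).mono (hsub.trans Ioo_subset_Icc_self)).mul
        (by fun_prop)).neg
    · intro t ht
      have ht' := hsub (Ioo_subset_Icc_self ht)
      refine (((h₂.deriv t ht').sub (h₁.deriv t ht')).mul (HasDerivAt.exp ?_)).neg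
      convert! ((hasDerivAt_id t).const_mul L).neg using 1
      simp
    · intro t ht
      have ht' := hsub (Ioo_subset_Icc_self ht)
      have h1 : m ≤ √(2 * q₁ t) := Real.sqrt_le_sqrt (by
        have : q₁ y ≤ q₁ t := hymin (Ioo_subset_Icc_self ht)
        linarith)
      have h0 := hle t (Ioo_subset_Icc_self ht')
      have hp := hpos t ht'
      have h2 : √(2 * q₁ t) ≤ √(2 * q₂ t) := Real.sqrt_le_sqrt (by linarith)
      have e1 := Real.sq_sqrt (show 0 ≤ 2 * q₁ t by linarith)
      have e2 := Real.sq_sqrt (show 0 ≤ 2 * q₂ t by linarith)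
      have h3 : c * (√(2 * q₂ t) - √(2 * q₁ t)) ≤ L * (q₂ t - q₁ t) := by
        have : √(2 * q₂ t) - √(2 * q₁ t) ≤ 2 * (q₂ t - q₁ t) / m := by
          rw [le_div_iff₀ hm]
          nlinarith
        refine (mul_le_mul_of_nonneg_left this hc).trans_eq ?_
        rw [hL]; ring
      have := Real.exp_pos (-(L * t))
      nlinarith
  have hlt : u < b := hu.2
  have hmem : Ioo u b ∈ 𝓝[<] b := Ioo_mem_nhdsLT hlt
  have hab : a < b := hu.1.trans hu.2
  have t1 : Tendsto q₁ (𝓝[<] b) (𝓝 (q₁ b)) :=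
    (h₁.cont b ⟨hab.le, le_rfl⟩).mono_left
      (nhdsWithin_le_iff.2 (mem_of_superset (Ioo_mem_nhdsLT hab) Ioo_subset_Icc_self))
  have t2 : Tendsto q₂ (𝓝[<] b) (𝓝 (q₂ b)) :=
    (h₂.cont b ⟨hab.le, le_rfl⟩).mono_left
      (nhdsWithin_le_iff.2 (mem_of_superset (Ioo_mem_nhdsLT hab) Ioo_subset_Icc_self))
  exact le_of_tendsto_of_tendsto t2 t1 (mem_of_superset hmem main)

/-- A sharp orbit is determined by its speed. If `q₂` ended strictly higher, it would lie above `q₁`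
throughout. The normalized flux gap tends to `0` at the origin and does not increase near it, so the
orbits touch at a positive density and forward uniqueness forces the end values to agree. -/
lemma IsOrbit.le_of_isSharp {h : ℝ → ℝ} (hflat : IsFlatAtZero h) {c s : ℝ} {q₁ q₂ : ℝ → ℝ}
    (hs : 0 < s) (h₁ : IsOrbit h c 0 s q₁) (h₂ : IsOrbit h c 0 s q₂) (hc : 0 < c)
    (hpos : ∀ u ∈ Ioo 0 s, 0 < q₁ u)
    (hsharp₁ : IsSharpAtZero c q₁) (hsharp₂ : IsSharpAtZero c q₂) : q₂ s ≤ q₁ s := by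
  by_contra! hlt
  obtain ⟨r₁, hr₁, hl₁⟩ := hsharp₁.eventually_le hc
  obtain ⟨r₂, hr₂, hl₂⟩ := hsharp₂.eventually_le hc
  obtain ⟨r₃, hr₃, hl₃⟩ := hflat (c ^ 2 / 4) (by positivity)
  set r := min (min r₁ r₂) (min r₃ s) with hr
  have hr0 : 0 < r := lt_min (lt_min hr₁ hr₂) (lt_min hr₃ hs)
  have hr1 : r ≤ r₁ := (min_le_left _ _).trans (min_le_left _ _)
  have hr2 : r ≤ r₂ := (min_le_left _ _).trans (min_le_right _ _)
  have hr3 : r ≤ r₃ := (min_le_right _ _).trans (min_le_left _ _)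
  have hrs : r ≤ s := (min_le_right _ _).trans (min_le_right _ _)
  have hord : ∀ u ∈ Icc 0 s, q₁ u ≤ q₂ u := fun u hu => h₂.le_of_le h₁ hc.le le_rfl hlt.le hu
  have hpos₂ : ∀ u ∈ Ioo 0 s, 0 < q₂ u := fun u hu =>
    (hpos u hu).trans_le (hord u (Ioo_subset_Icc_self hu))
  -- the quotient `(√(2q₂) - √(2q₁)) / u` decreases near `0` and tends to `0` there
  set z : ℝ → ℝ := fun u => √(2 * q₂ u) / u - √(2 * q₁ u) / u with hz
  have hzlim : Tendsto z (𝓝[>] 0) (𝓝 0) := by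
    simpa only [sub_self] using hsharp₂.sub hsharp₁
  have hzd : ∀ u ∈ Ioo 0 r, HasDerivAt z
      (((c - h u / √(2 * q₂ u)) * u - √(2 * q₂ u) * 1) / u ^ 2 -
        ((c - h u / √(2 * q₁ u)) * u - √(2 * q₁ u) * 1) / u ^ 2) u := fun u hu => by
    have hus : u ∈ Ioo 0 s := ⟨hu.1, hu.2.trans_le hrs⟩
    exact ((h₂.hasDerivAt_sqrt hus (hpos₂ u hus)).div (hasDerivAt_id u) hu.1.ne').sub
      ((h₁.hasDerivAt_sqrt hus (hpos u hus)).div (hasDerivAt_id u) hu.1.ne')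
  have hzd0 : ∀ u ∈ Ioo 0 r, (((c - h u / √(2 * q₂ u)) * u - √(2 * q₂ u) * 1) / u ^ 2 -
        ((c - h u / √(2 * q₁ u)) * u - √(2 * q₁ u) * 1) / u ^ 2) ≤ 0 := fun u hu => by
    have b1 := hl₁ u ⟨hu.1, hu.2.trans_le hr1⟩
    have b2 := hl₂ u ⟨hu.1, hu.2.trans_le hr2⟩
    have b3 := (abs_le.1 (hl₃ u ⟨hu.1, hu.2.trans_le hr3⟩)).2
    have hle : √(2 * q₁ u) ≤ √(2 * q₂ u) :=
      Real.sqrt_le_sqrt (by linarith [hord u ⟨hu.1.le, hu.2.le.trans hrs⟩])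
    generalize √(2 * q₁ u) = x at *
    generalize √(2 * q₂ u) = y at *
    have hu0 := hu.1
    have hcu : 0 < c / 2 * u := by positivity
    have hx : 0 < x := by linarith
    have hy : 0 < y := by linarith
    have e : ((c - h u / y) * u - y * 1) / u ^ 2 - ((c - h u / x) * u - x * 1) / u ^ 2
        = (y - x) * (h u * u - x * y) / (x * y * u ^ 2) := by
      field_simp; ring
    rw [e]
    refine div_nonpos_of_nonpos_of_nonneg (mul_nonpos_of_nonneg_of_nonpos (by linarith) ?_)
      (by positivity)
    have : (c / 2 * u) * (c / 2 * u) ≤ x * y := mul_le_mul b1 b2 hcu.le hx.le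
    nlinarith [mul_le_mul_of_nonneg_right b3 hu0.le]
  have hu : r / 2 ∈ Ioo 0 r := ⟨half_pos hr0, half_lt_self hr0⟩
  have hz0 : z (r / 2) ≤ 0 := by
    refine ge_of_tendsto hzlim ?_
    filter_upwards [Ioo_mem_nhdsGT hu.1] with x hx
    have := monotoneOn_Icc_of_hasDerivAt (a := x) (b := r / 2) (D := fun t => - z t)
      (fun t ht => ((hzd t ⟨hx.1.trans_le ht.1, ht.2.trans_lt hu.2⟩).neg).continuousAt.continuousWithinAt)
      (fun t ht => (hzd t ⟨hx.1.trans ht.1, ht.2.trans hu.2⟩).neg)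
      (fun t ht => neg_nonneg.2 (hzd0 t ⟨hx.1.trans ht.1, ht.2.trans hu.2⟩))
      ⟨le_rfl, hx.2.le⟩ ⟨hx.2.le, le_rfl⟩ hx.2.le
    simpa using this
  have heq : q₁ (r / 2) = q₂ (r / 2) := by
    refine le_antisymm (hord _ ⟨hu.1.le, hu.2.le.trans hrs⟩) ?_
    have : √(2 * q₂ (r / 2)) ≤ √(2 * q₁ (r / 2)) := by
      simp only [hz] at hz0
      rwa [← sub_div, div_le_iff₀ hu.1, zero_mul, sub_nonpos] at hz0
    rw [Real.sqrt_le_sqrt_iff (by linarith [hpos _ ⟨hu.1, hu.2.trans_le hrs⟩])] at this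
    linarith
  exact absurd (h₁.le_of_eq_of_pos h₂ hc.le hpos hord ⟨hu.1, hu.2.trans_le hrs⟩ heq)
    (not_le.2 hlt)

/-! ### Critical speeds -/

/-- The solution on `[0,b]` of the phase-plane equation with end value `θ` at `b`. -/
noncomputable def backSol (h : ℝ → ℝ) (c b θ : ℝ) : ℝ → ℝ :=
  Classical.epsilon fun q => q b = θ ∧ IsOrbit h c 0 b q

section backSol

variable {h : ℝ → ℝ} (hh : Continuous h) {c b θ : ℝ}

include hh

lemma backSol_spec (hc : 0 ≤ c) (hb : 0 ≤ b) :
    backSol h c b θ b = θ ∧ IsOrbit h c 0 b (backSol h c b θ) :=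
  Classical.epsilon_spec (exists_orbit hh hc hb θ)

lemma backSol_end (hc : 0 ≤ c) (hb : 0 ≤ b) : backSol h c b θ b = θ := (backSol_spec hh hc hb).1

lemma isOrbit_backSol (hc : 0 ≤ c) (hb : 0 ≤ b) : IsOrbit h c 0 b (backSol h c b θ) :=
  (backSol_spec hh hc hb).2

lemma IsOrbit.eqOn_backSol {q : ℝ → ℝ} (hq : IsOrbit h c 0 b q) (hc : 0 ≤ c) (hb : 0 ≤ b)
    (hqb : q b = θ) : EqOn q (backSol h c b θ) (Icc 0 b) :=
  hq.eqOn (isOrbit_backSol hh hc hb) hc (by rw [hqb, backSol_end hh hc hb])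

lemma backSol_le {c' : ℝ} (hc : 0 ≤ c) (hcc : c ≤ c') (hb : 0 ≤ b) {u : ℝ} (hu : u ∈ Icc 0 b) :
    backSol h c' b θ u ≤ backSol h c b θ u :=
  (isOrbit_backSol hh hc hb).le_of_le (isOrbit_backSol hh (hc.trans hcc) hb) (hc.trans hcc) hcc
    (by rw [backSol_end hh hc hb, backSol_end hh (hc.trans hcc) hb]) hu

lemma continuousOn_backSol_speed (hb : 0 ≤ b) {u : ℝ} (hu : u ∈ Icc 0 b) :
    ContinuousOn (fun c => backSol h c b θ u) (Ici 0) := by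
  intro c hc
  obtain ⟨M, hM0, hM⟩ := (isOrbit_backSol hh hc hb (θ := θ)).exists_sqrt_le
  have hbound : ∀ c' ∈ Ici (0 : ℝ),
      dist (backSol h c' b θ u) (backSol h c b θ u) ≤ |c' - c| * M * b := fun c' hc' => by
    have := (isOrbit_backSol hh hc' hb (θ := θ)).sub_le_add (isOrbit_backSol hh hc hb) hc' hM hu
    rwa [backSol_end hh hc hb, backSol_end hh hc' hb, sub_self, abs_zero, zero_add, sub_zero] at this
  have hlim : Tendsto (fun c' => |c' - c| * M * b) (𝓝[Ici 0] c) (𝓝 0) := by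
    have : Continuous fun c' => |c' - c| * M * b := by fun_prop
    have := (this.tendsto c).mono_left (nhdsWithin_le_nhds (s := Ici 0))
    simpa using this
  exact tendsto_iff_dist_tendsto_zero.2 (squeeze_zero' (Eventually.of_forall fun _ => dist_nonneg)
    (mem_of_superset self_mem_nhdsWithin hbound) hlim)

lemma continuous_backSol_end (hc : 0 ≤ c) (hb : 0 ≤ b) {u : ℝ} (hu : u ∈ Icc 0 b) :
    Continuous fun θ => backSol h c b θ u := by
  refine (LipschitzWith.of_dist_le_mul (K := 1) fun θ θ' => ?_).continuous
  have := (isOrbit_backSol hh hc hb (θ := θ)).sub_le_add (isOrbit_backSol hh hc hb (θ := θ')) hc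
    (isOrbit_backSol hh hc hb).exists_sqrt_le.choose_spec.2 hu
  rw [sub_self, abs_zero, zero_mul, zero_mul, add_zero, backSol_end hh hc hb,
    backSol_end hh hc hb] at this
  simpa [Real.dist_eq] using this

/-- The critical speed is the least one whose solution is nonpositive at `u`; continuity in the
speed gives the value `0` there. Being the least is used later to prove sharpness. -/
lemma exists_critical_speed (hb : 0 ≤ b) {u C : ℝ} (hu : u ∈ Icc 0 b)
    (h0 : 0 < backSol h 0 b θ u) (hC0 : 0 ≤ C) (hC : backSol h C b θ u ≤ 0) :
    ∃ cr, 0 < cr ∧ cr ≤ C ∧ backSol h cr b θ u = 0 ∧ ∀ c, 0 ≤ c → c < cr → 0 < backSol h c b θ u := by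
  set S := {c | c ∈ Icc 0 C ∧ backSol h c b θ u ≤ 0} with hS
  have hcont := continuousOn_backSol_speed hh hb (θ := θ) hu
  have hSc : IsClosed S :=
    (hcont.mono Icc_subset_Ici_self).preimage_isClosed_of_isClosed isClosed_Icc
      (isClosed_Iic (a := (0 : ℝ)))
  have hbdd : BddBelow S := ⟨0, fun x hx => hx.1.1⟩
  have hmem : sInf S ∈ S := hSc.csInf_mem ⟨C, ⟨hC0, le_rfl⟩, hC⟩ hbdd
  have hbelow : ∀ c, 0 ≤ c → c < sInf S → 0 < backSol h c b θ u := fun c hc hlt => by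
    by_contra! hle
    exact absurd (csInf_le hbdd (show c ∈ S from ⟨⟨hc, hlt.le.trans hmem.1.2⟩, hle⟩)) (not_le.2 hlt)
  have hpos : 0 < sInf S := hmem.1.1.lt_of_ne fun h => by
    have := hmem.2
    rw [← h] at this
    linarith
  refine ⟨sInf S, hpos, hmem.1.2, le_antisymm hmem.2 ?_, hbelow⟩
  have ht : Tendsto (fun c => backSol h c b θ u) (𝓝[<] (sInf S)) (𝓝 (backSol h (sInf S) b θ u)) :=
    ((hcont _ hmem.1.1).mono_left (nhdsWithin_le_iff.2
      (mem_of_superset (Ioo_mem_nhdsLT hpos) fun x hx => hx.1.le)))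
  exact ge_of_tendsto ht (mem_of_superset (Ioo_mem_nhdsLT hpos) fun x hx => (hbelow x hx.1.le hx.2).le)

end backSol

/-- The sign and regularity conditions on `h = A' f` for a monostable-bistable reaction. -/
structure IsBistableFlux (h : ℝ → ℝ) (s₁ s₂ : ℝ) : Prop where
  cont : Continuous h
  flat : IsFlatAtZero h
  s₁_pos : 0 < s₁
  s₁_lt_s₂ : s₁ < s₂
  s₂_lt_one : s₂ < 1
  pos₁ : ∀ u ∈ Ioo 0 s₁, 0 < h u
  neg : ∀ u ∈ Ioo s₁ s₂, h u < 0
  pos₂ : ∀ u ∈ Ioo s₂ 1, 0 < h u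
  neg_top : ∀ u, 1 < u → h u < 0
  integral_pos : 0 < ∫ u in s₁..1, h u

/-- A sharp orbit from the state `s` to `0`. -/
structure IsSharpOrbit (h : ℝ → ℝ) (s c : ℝ) (q : ℝ → ℝ) : Prop where
  speed_pos : 0 < c
  orbit : IsOrbit h c 0 s q
  left : q 0 = 0
  right : q s = 0
  pos : ∀ u ∈ Ioo 0 s, 0 < q u
  sharp : IsSharpAtZero c q

/-- An orbit connecting the states `b` and `a`. -/
structure IsFrontOrbit (h : ℝ → ℝ) (a b c : ℝ) (q : ℝ → ℝ) : Prop where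
  speed_pos : 0 < c
  orbit : IsOrbit h c a b q
  left : q a = 0
  right : q b = 0
  pos : ∀ u ∈ Ioo a b, 0 < q u

lemma IsSharpOrbit.speed_unique {h : ℝ → ℝ} {s c₁ c₂ : ℝ} {q₁ q₂ : ℝ → ℝ} (hs : 0 < s)
    (h₁ : IsSharpOrbit h s c₁ q₁) (h₂ : IsSharpOrbit h s c₂ q₂) : c₁ = c₂ := by
  rcases lt_trichotomy c₁ c₂ with hc | hc | hc
  · exact absurd h₂.sharp (h₁.orbit.not_sharp_of_lt hs h₂.orbit h₁.speed_pos hc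
      (by rw [h₁.right, h₂.right]) h₁.sharp)
  · exact hc
  · exact absurd h₁.sharp (h₂.orbit.not_sharp_of_lt hs h₁.orbit h₂.speed_pos hc
      (by rw [h₁.right, h₂.right]) h₂.sharp)

lemma exists_bound_Icc {h : ℝ → ℝ} (hh : Continuous h) (a b : ℝ) :
    ∃ K, 0 ≤ K ∧ ∀ u ∈ Icc a b, |h u| ≤ K := by
  obtain ⟨K, hK⟩ := (isCompact_Icc (a := a) (b := b)).exists_bound_of_continuousOn hh.continuousOn
  exact ⟨max K 0, le_max_right _ _, fun u hu => (hK u hu).trans (le_max_left _ _)⟩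

lemma IsFlatAtZero.exists_linear_bound {h : ℝ → ℝ} (hflat : IsFlatAtZero h) (hh : Continuous h)
    (b : ℝ) : ∃ K, 0 ≤ K ∧ ∀ u ∈ Ioo 0 b, h u ≤ K * u := by
  obtain ⟨K, hK0, hK⟩ := exists_bound_Icc hh 0 b
  obtain ⟨r, hr, hl⟩ := hflat 1 one_pos
  refine ⟨1 + K / r, by positivity, fun u hu => ?_⟩
  have hu0 := hu.1
  rcases lt_or_ge u r with hur | hur
  · have h1 := (le_abs_self _).trans (hl u ⟨hu.1, hur⟩)
    have : 0 ≤ K / r * u := by positivity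
    linarith
  · have h1 := (le_abs_self _).trans (hK u (Ioo_subset_Icc_self hu))
    have : K ≤ K / r * u := by
      rw [div_mul_eq_mul_div, le_div_iff₀ hr]
      exact mul_le_mul_of_nonneg_left hur hK0
    linarith

lemma IsOrbit.sub_eq_integral {h : ℝ → ℝ} (hh : Continuous h) {a b : ℝ} {q : ℝ → ℝ} (hab : a ≤ b)
    (hq : IsOrbit h 0 a b q) : q a - q b = ∫ u in a..b, h u := by
  have := intervalIntegral.integral_eq_sub_of_hasDerivAt_of_le hab hq.cont
    (f' := fun u => - h u) (fun u hu => by simpa using hq.deriv u hu)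
    (hh.neg.intervalIntegrable _ _)
  rw [intervalIntegral.integral_neg] at this
  linarith

section flux

variable {h : ℝ → ℝ} {s₁ s₂ : ℝ} (H : IsBistableFlux h s₁ s₂)

include H

lemma IsBistableFlux.integral_pos_left : 0 < ∫ u in (0 : ℝ)..s₁, h u :=
  intervalIntegral.intervalIntegral_pos_of_pos_on (H.cont.intervalIntegrable _ _) H.pos₁ H.s₁_pos

lemma IsBistableFlux.s₁_lt_one : s₁ < 1 := H.s₁_lt_s₂.trans H.s₂_lt_one

/-- The minimal speed of the monostable part. -/
lemma IsBistableFlux.exists_small_speed : ∃ cs, 0 < cs ∧ backSol h cs s₁ 0 0 = 0 ∧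
    ∀ c, 0 ≤ c → c < cs → 0 < backSol h c s₁ 0 0 := by
  have hs := H.s₁_pos.le
  obtain ⟨K, hK0, hK⟩ := H.flat.exists_linear_bound H.cont s₁
  have h0 : 0 < backSol h 0 s₁ 0 0 := by
    have := (isOrbit_backSol H.cont le_rfl hs (θ := 0)).sub_eq_integral H.cont hs
    rw [backSol_end H.cont le_rfl hs] at this
    linarith [H.integral_pos_left]
  -- With speed `K + 1` and `h ≤ K u`, the parabola of slope `η = 1` is a barrier, since `η (c - η)
  -- = K`.
  have hC : backSol h (K + 1) s₁ 0 0 ≤ 0 := by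
    have := (isOrbit_backSol H.cont (show 0 ≤ K + 1 by linarith) hs (θ := 0)).le_parabola
      (η := 1) (by linarith) (fun u hu => by simpa using hK u hu)
      (by rw [backSol_end H.cont (by linarith) hs]; positivity) (u := 0) ⟨le_rfl, hs⟩
    simpa using this
  obtain ⟨cr, h1, -, h2, h3⟩ := exists_critical_speed H.cont hs ⟨le_rfl, hs⟩ h0 (by linarith) hC
  exact ⟨cr, h1, h2, h3⟩

/-- The speed of the bistable part. -/
lemma IsBistableFlux.exists_bistable_speed : ∃ cz, 0 < cz ∧ backSol h cz 1 0 s₁ = 0 ∧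
    ∀ c, 0 ≤ c → c < cz → 0 < backSol h c 1 0 s₁ := by
  have hs1 : s₁ ∈ Icc 0 (1 : ℝ) := ⟨H.s₁_pos.le, H.s₁_lt_one.le⟩
  have h0 : 0 < backSol h 0 1 0 s₁ := by
    have := ((isOrbit_backSol H.cont le_rfl zero_le_one (θ := 0)).mono hs1.1
      le_rfl).sub_eq_integral H.cont hs1.2
    rw [backSol_end H.cont le_rfl zero_le_one] at this
    linarith [H.integral_pos]
  obtain ⟨K, hK0, hK⟩ := exists_bound_Icc H.cont s₂ 1
  set I := ∫ u in s₁..s₂, - h u with hI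
  have hI0 : 0 < I := intervalIntegral.intervalIntegral_pos_of_pos_on
    (H.cont.neg.intervalIntegrable _ _) (fun u hu => neg_pos.2 (H.neg u hu)) H.s₁_lt_s₂
  have hsI : 0 < √(2 * I) := Real.sqrt_pos.2 (by linarith)
  -- At this speed a positive value at `s₁` forces `q(s₂) > I`. On `[s₂, 1]` the term `C √(2q)` is
  -- at least `K ≥ h` as long as `q ≥ I`, so `q` could not return to `0` at `1`.
  set C := K / √(2 * I) with hCdef
  have hC0 : 0 ≤ C := by positivity
  have hC : backSol h C 1 0 s₁ ≤ 0 := by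
    by_contra! hpos
    have hq := isOrbit_backSol H.cont hC0 zero_le_one (θ := 0) (b := 1)
    have hq1 := backSol_end H.cont hC0 zero_le_one (θ := 0) (b := 1)
    set q := backSol h C 1 0
    have h12 := hq.mono H.s₁_pos.le H.s₂_lt_one.le
    have h21 := hq.mono (H.s₁_pos.trans H.s₁_lt_s₂).le le_rfl
    have hge : I < q s₂ := by
      have hsol : IsOrbit h 0 s₁ s₂ (fun u => ∫ x in s₁..u, - h x) := by
        have hd : ∀ u, HasDerivAt (fun u => ∫ x in s₁..u, - h x) (- h u) u := fun u =>
          intervalIntegral.integral_hasDerivAt_right (H.cont.neg.intervalIntegrable _ _)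
            H.cont.neg.stronglyMeasurable.stronglyMeasurableAtFilter H.cont.neg.continuousAt
        exact ⟨fun u _ => (hd u).continuousAt.continuousWithinAt, fun u _ => by simpa using hd u⟩
      have := hsol.sub_le_sub h12 hC0 hC0 ⟨le_rfl, H.s₁_lt_s₂.le⟩ (by simpa using hpos)
      simp only [intervalIntegral.integral_same, sub_zero] at this
      linarith
    have key := backward_bound (D := fun u => q u - I) (le_refl (0 : ℝ))
      (h21.cont.sub continuousOn_const) (fun u hu => (h21.deriv u hu).sub_const I) (by
        intro u hu hpos
        have h1 : √(2 * I) ≤ √(2 * q u) := Real.sqrt_le_sqrt (by linarith)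
        have h2 := mul_le_mul_of_nonneg_left h1 hC0
        have h3 : C * √(2 * I) = K := by rw [hCdef]; field_simp
        have h4 := (le_abs_self _).trans (hK u (Ioo_subset_Icc_self hu))
        linarith) (u := s₂) ⟨le_rfl, H.s₂_lt_one.le⟩
    rw [max_eq_left (by rw [hq1]; linarith)] at key
    linarith
  obtain ⟨cr, h1, -, h2, h3⟩ := exists_critical_speed H.cont zero_le_one hs1 h0 hC0 hC
  exact ⟨cr, h1, h2, h3⟩

/-- On `(s₂, d)` the sign of `h` gives positivity. On `(s₁, s₂]` the orbit is nondecreasing from a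
nonnegative value; a zero there would make it vanish identically to its left, where `q' = -h ≠ 0`.
-/
lemma IsBistableFlux.pos_Ioo_of_pos {c d : ℝ} {q : ℝ → ℝ} (hc : 0 ≤ c) (hd : s₂ < d) (hd1 : d ≤ 1)
    (hq : IsOrbit h c 0 d q) (hqd : 0 ≤ q d) (hs : 0 ≤ q s₁) : ∀ u ∈ Ioo s₁ d, 0 < q u := by
  have h2 : ∀ u ∈ Ioo s₂ d, 0 < q u := fun u hu =>
    (hq.mono (H.s₁_pos.trans H.s₁_lt_s₂).le le_rfl).pos
      (fun x hx => H.pos₂ x ⟨hx.1, hx.2.trans_le hd1⟩) hqd hu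
  have h12 := hq.mono H.s₁_pos.le hd.le
  have hmono := h12.monotoneOn hc fun u hu => (H.neg u hu).le
  have hmid : ∀ u ∈ Ioc s₁ s₂, 0 < q u := fun u hu => by
    have hge : 0 ≤ q u := hs.trans (hmono ⟨le_rfl, H.s₁_lt_s₂.le⟩ ⟨hu.1.le, hu.2⟩ hu.1.le)
    refine hge.lt_of_ne' fun h0 => ?_
    obtain ⟨x, hx⟩ := exists_between hu.1
    have hx0 : ∀ y ∈ Ioo s₁ u, q y = 0 := fun y hy =>
      le_antisymm (h0 ▸ hmono ⟨hy.1.le, hy.2.le.trans hu.2⟩ ⟨hu.1.le, hu.2⟩ hy.2.le)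
        (hs.trans (hmono ⟨le_rfl, H.s₁_lt_s₂.le⟩ ⟨hy.1.le, hy.2.le.trans hu.2⟩ hy.1.le))
    have hder := h12.deriv x ⟨hx.1, hx.2.trans_le hu.2⟩
    have hzero : HasDerivAt q 0 x := (hasDerivAt_const x (0 : ℝ)).congr_of_eventuallyEq
      (mem_of_superset (Ioo_mem_nhds hx.1 hx.2) hx0)
    have := hder.unique hzero
    rw [hx0 x hx] at this
    simp only [mul_zero, Real.sqrt_zero, zero_sub, neg_eq_zero] at this
    exact (H.neg x ⟨hx.1, hx.2.trans_le hu.2⟩).ne this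
  intro u hu
  rcases le_or_gt u s₂ with h | h
  · exact hmid u ⟨hu.1, h⟩
  · exact h2 u ⟨h, hu.2⟩

lemma IsBistableFlux.pos_of_pos {c d : ℝ} {q : ℝ → ℝ} (hc : 0 ≤ c) (hd : s₂ < d) (hd1 : d ≤ 1)
    (hq : IsOrbit h c 0 d q) (hqd : 0 ≤ q d) (hs : 0 < q s₁) : ∀ u ∈ Ioo 0 d, 0 < q u := by
  intro u hu
  rcases lt_trichotomy u s₁ with h | h | h
  · exact (hq.mono le_rfl (H.s₁_lt_s₂.trans hd).le).pos H.pos₁ hs.le ⟨hu.1, h⟩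
  · rwa [h]
  · exact H.pos_Ioo_of_pos hc hd hd1 hq hqd hs.le u ⟨h, hu.2⟩

/-- If the critical orbit were not sharp, slightly smaller speeds would also give a nonpositive
value at `0`, against minimality. -/
lemma IsBistableFlux.sharp_of_minimal {b cr : ℝ} (hb : 0 < b) (hcr : 0 < cr)
    (hzero : backSol h cr b 0 0 = 0)
    (hmin : ∀ c, 0 ≤ c → c < cr → 0 < backSol h c b 0 0) :
    IsSharpAtZero cr (backSol h cr b 0) := by
  by_contra hns
  obtain ⟨ε, hε, hnear⟩ := (isOrbit_backSol H.cont hcr.le hb.le).left_nonpos_of_near H.flat hcr hb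
    hzero hns
  obtain ⟨c, hc1, hc2⟩ := exists_between (show max 0 (cr - ε) < cr from max_lt hcr (by linarith))
  have hc0 : 0 ≤ c := (le_max_left _ _).trans hc1.le
  have hc3 : cr - ε < c := (le_max_right _ _).trans_lt hc1
  refine absurd (hnear c _ (isOrbit_backSol H.cont hc0 hb.le) ?_ ?_) (not_le.2 (hmin c hc0 hc2))
  · rw [abs_lt]; constructor <;> linarith
  · rw [backSol_end H.cont hc0 hb.le, backSol_end H.cont hcr.le hb.le]; simpa using hε

/-- Backward comparison from `1` puts the faster orbit below. Yet on `[s₁, s₂]`, where `h ≤ 0`, this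
very order makes `√(2q₂) - √(2q₁)` grow at rate at least `c₂ - c₁` from the value `0` at `s₁`, so
the faster orbit is above at `s₂`. -/
lemma IsBistableFlux.front_speed_unique {c₁ c₂ : ℝ} {q₁ q₂ : ℝ → ℝ}
    (h₁ : IsFrontOrbit h s₁ 1 c₁ q₁) (h₂ : IsFrontOrbit h s₁ 1 c₂ q₂) : c₁ = c₂ := by
  wlog hc : c₁ < c₂ generalizing c₁ c₂ q₁ q₂
  · rcases (not_lt.1 hc).eq_or_lt with h | h
    · exact h.symm
    · exact (this h₂ h₁ h).symm
  exfalso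
  have hlt : s₁ < 1 := H.s₁_lt_one
  have hsub : ∀ u ∈ Ioo s₁ s₂, u ∈ Ioo s₁ 1 := fun u hu => ⟨hu.1, hu.2.trans H.s₂_lt_one⟩
  have hord : ∀ u ∈ Icc s₁ 1, q₂ u ≤ q₁ u := fun u hu =>
    h₁.orbit.le_of_le h₂.orbit h₂.speed_pos.le hc.le (by rw [h₁.right, h₂.right]) hu
  have hcont : ∀ {q c}, IsFrontOrbit h s₁ 1 c q → ContinuousOn (fun u => √(2 * q u)) (Icc s₁ s₂) :=
    fun hq => (Real.continuous_sqrt.comp_continuousOn (hq.orbit.cont.const_smul (2 : ℝ))).mono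
      (Icc_subset_Icc_right H.s₂_lt_one.le)
  have hmono := monotoneOn_Icc_of_hasDerivAt (a := s₁) (b := s₂)
    (D := fun u => √(2 * q₂ u) - √(2 * q₁ u) - (c₂ - c₁) * u)
    (D' := fun u => (c₂ - h u / √(2 * q₂ u)) - (c₁ - h u / √(2 * q₁ u)) - (c₂ - c₁))
    (((hcont h₂).sub (hcont h₁)).sub (by fun_prop)) (fun u hu =>
      ((h₂.orbit.hasDerivAt_sqrt (hsub u hu) (h₂.pos u (hsub u hu))).sub
        (h₁.orbit.hasDerivAt_sqrt (hsub u hu) (h₁.pos u (hsub u hu)))).sub (by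
          simpa using (hasDerivAt_id u).const_mul (c₂ - c₁))) (fun u hu => by
      have p1 : 0 < √(2 * q₁ u) := Real.sqrt_pos.2 (by linarith [h₁.pos u (hsub u hu)])
      have p2 : 0 < √(2 * q₂ u) := Real.sqrt_pos.2 (by linarith [h₂.pos u (hsub u hu)])
      have p12 : √(2 * q₂ u) ≤ √(2 * q₁ u) :=
        Real.sqrt_le_sqrt (by linarith [hord u (Ioo_subset_Icc_self (hsub u hu))])
      have : h u / √(2 * q₂ u) ≤ h u / √(2 * q₁ u) := by
        rw [div_le_div_iff₀ p2 p1]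
        exact mul_le_mul_of_nonpos_left p12 (H.neg u hu).le
      linarith) ⟨le_rfl, H.s₁_lt_s₂.le⟩ ⟨H.s₁_lt_s₂.le, le_rfl⟩ H.s₁_lt_s₂.le
  simp only [h₁.left, h₂.left, sub_self, zero_sub] at hmono
  have : √(2 * q₂ s₂) ≤ √(2 * q₁ s₂) :=
    Real.sqrt_le_sqrt (by linarith [hord s₂ ⟨H.s₁_lt_s₂.le, H.s₂_lt_one.le⟩])
  nlinarith [H.s₁_lt_s₂]

end flux

/-! ### The orbits of the phase-plane equation -/

section orbits

variable {h : ℝ → ℝ} {s₁ s₂ : ℝ} (H : IsBistableFlux h s₁ s₂)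

include H

lemma IsBistableFlux.small_sharpOrbit {cs : ℝ} (hcs : 0 < cs) (hzero : backSol h cs s₁ 0 0 = 0)
    (hmin : ∀ c, 0 ≤ c → c < cs → 0 < backSol h c s₁ 0 0) :
    IsSharpOrbit h s₁ cs (backSol h cs s₁ 0) :=
  have hend := backSol_end H.cont hcs.le H.s₁_pos.le
  have horb := isOrbit_backSol H.cont hcs.le H.s₁_pos.le
  ⟨hcs, horb, hzero, hend, fun _ hu => horb.pos H.pos₁ hend.ge hu,
    H.sharp_of_minimal H.s₁_pos hcs hzero hmin⟩

lemma IsBistableFlux.frontOrbit {cz : ℝ} (hcz : 0 < cz) (hzero : backSol h cz 1 0 s₁ = 0) :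
    IsFrontOrbit h s₁ 1 cz (backSol h cz 1 0) :=
  have hend := backSol_end H.cont hcz.le zero_le_one
  have horb := isOrbit_backSol H.cont hcz.le zero_le_one
  ⟨hcz, horb.mono H.s₁_pos.le le_rfl, hzero, hend,
    H.pos_Ioo_of_pos hcz.le H.s₂_lt_one le_rfl horb hend.ge hzero.ge⟩

lemma IsBistableFlux.exists_big_sharpOrbit {cs cz : ℝ} (hcs : 0 < cs) (hlt : cs < cz)
    (hs0 : backSol h cs s₁ 0 0 = 0) (hsmin : ∀ c, 0 ≤ c → c < cs → 0 < backSol h c s₁ 0 0)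
    (hz0 : backSol h cz 1 0 s₁ = 0) (hzmin : ∀ c, 0 ≤ c → c < cz → 0 < backSol h c 1 0 s₁) :
    ∃ cb q, cs < cb ∧ cb < cz ∧ IsSharpOrbit h 1 cb q := by
  have hcz := hcs.trans hlt
  have hs := H.s₁_pos.le
  have hs1 := H.s₁_lt_one.le
  have hS := H.small_sharpOrbit hcs hs0 hsmin
  -- At speed `cz` the orbit from `1` passes through `(s₁, 0)`, so below `s₁` it is the orbit ending
  -- at `(s₁, 0)`, which `cz > cs` pushes to a nonpositive value at `0`.
  have hC : backSol h cz 1 0 0 ≤ 0 := by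
    have h1 := ((isOrbit_backSol H.cont hcz.le zero_le_one).mono le_rfl hs1).eqOn_backSol H.cont
      hcz.le hs hz0 (left_mem_Icc.2 hs)
    rw [h1]
    exact (backSol_le H.cont hcs.le hlt.le hs ⟨le_rfl, hs⟩).trans_eq hs0
  have h0 : 0 < backSol h 0 1 0 0 := by
    have h1 := (isOrbit_backSol H.cont le_rfl zero_le_one (θ := 0)).sub_eq_integral H.cont zero_le_one
    rw [backSol_end H.cont le_rfl zero_le_one, ← intervalIntegral.integral_add_adjacent_intervals
      (H.cont.intervalIntegrable 0 s₁) (H.cont.intervalIntegrable s₁ 1)] at h1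
    linarith [H.integral_pos, H.integral_pos_left]
  obtain ⟨cb, hcb, hle, hb0, hbmin⟩ :=
    exists_critical_speed H.cont zero_le_one (left_mem_Icc.2 zero_le_one) h0 hcz.le hC
  have horb := isOrbit_backSol H.cont hcb.le zero_le_one (θ := 0)
  have hend := backSol_end H.cont hcb.le zero_le_one (θ := 0)
  have hsharp := H.sharp_of_minimal one_pos hcb hb0 hbmin
  -- At `cb = cz` the big orbit restricted to `[0, s₁]` would be a second sharp orbit ending at
  -- `(s₁, 0)`, faster than the small one.
  have hbz : cb < cz := by
    refine hle.lt_of_ne ?_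
    rintro rfl
    exact hS.orbit.not_sharp_of_lt H.s₁_pos (horb.mono le_rfl hs1) hcs hlt
      (by rw [hz0, hS.right]) hS.sharp hsharp
  -- If `cb = cs`, uniqueness of sharp orbits contradicts the positive value of the big orbit at
  -- `s₁`. If `cb < cs`, the big orbit lies above an orbit that is positive at `0`.
  have hsb : cs < cb := by
    rcases lt_trichotomy cs cb with hh | hh | hh
    · exact hh
    · subst hh
      have := hS.orbit.le_of_isSharp H.flat H.s₁_pos (horb.mono le_rfl hs1) hcs hS.pos hS.sharp hsharp
      rw [hS.right] at this
      exact absurd this (not_le.2 (hzmin cs hcs.le hlt))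
    · have h2 := (horb.mono le_rfl hs1).le_of_le (isOrbit_backSol H.cont hcb.le hs (θ := 0)) hcb.le
        le_rfl (by rw [backSol_end H.cont hcb.le hs]; exact (hzmin cb hcb.le hbz).le)
        (left_mem_Icc.2 hs)
      linarith [hsmin cb hcb.le hh]
  exact ⟨cb, _, hsb, hbz, hcb, horb, hb0, hend,
    H.pos_of_pos hcb.le H.s₂_lt_one le_rfl horb hend.ge (hzmin cb hcb.le hbz), hsharp⟩

end orbits

/-- Shooting: the value at `0` depends continuously on the end value at `d`, is nonpositive for very
negative end values and positive for large ones. -/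
lemma exists_orbit_zero_left {h : ℝ → ℝ} (hh : Continuous h) {c d : ℝ} (hc : 0 ≤ c) (hd : 0 ≤ d) :
    ∃ q, IsOrbit h c 0 d q ∧ q 0 = 0 := by
  obtain ⟨K, hK0, hK⟩ := exists_bound_Icc hh 0 d
  set θ₂ := ((c + K + 1) * (d + 1)) ^ 2 / 2 with hθ₂
  have h1 := (isOrbit_backSol hh hc hd (θ := -K * d)).left_nonpos_of_small hc hd hK
    (backSol_end hh hc hd).le
  have h2 := (isOrbit_backSol hh hc hd (θ := θ₂)).left_pos_of_large hc hd hK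
    (backSol_end hh hc hd).ge
  have hle : -K * d ≤ θ₂ := by
    have : 0 ≤ K * d := by positivity
    have : 0 ≤ θ₂ := by positivity
    linarith
  obtain ⟨θ, -, hθ⟩ := intermediate_value_Icc hle
    (continuous_backSol_end hh hc hd (left_mem_Icc.2 hd)).continuousOn ⟨h1, h2.le⟩
  exact ⟨_, isOrbit_backSol hh hc hd, hθ⟩

/-- Reflecting `u ↦ d - u` turns negative speed with data at the right end into positive speed with
data at the left end, where the backward theory is replaced by shooting. Orbits of negative speed
describe increasing profiles after a reflection in space. -/
lemma exists_neg_speed_orbit {h : ℝ → ℝ} (hh : Continuous h) {c d : ℝ} (hc : 0 ≤ c) (hd : 0 ≤ d) :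
    ∃ q, IsOrbit h (-c) 0 d q ∧ q d = 0 := by
  obtain ⟨r, hr, hr0⟩ := exists_orbit_zero_left (h := fun t => - h (d - t)) (by fun_prop) hc hd
  refine ⟨fun u => r (d - u), ⟨hr.cont.comp (by fun_prop) fun u hu =>
    ⟨by linarith [hu.2], by linarith [hu.1]⟩, fun u hu => ?_⟩, by simpa using hr0⟩
  have := (hr.deriv (d - u) ⟨by linarith [hu.2], by linarith [hu.1]⟩).comp u
    ((hasDerivAt_id u).const_sub d)
  convert! this using 1
  simp; ring

section orbits

variable {h : ℝ → ℝ} {s₁ s₂ : ℝ} (H : IsBistableFlux h s₁ s₂)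

include H

lemma IsBistableFlux.isOrbit_integral (d : ℝ) : IsOrbit h 0 0 d fun u => ∫ x in u..d, h x := by
  have hd : ∀ u, HasDerivAt (fun u => ∫ x in u..d, h x) (- h u) u := fun u =>
    intervalIntegral.integral_hasDerivAt_left (H.cont.intervalIntegrable _ _)
      H.cont.stronglyMeasurable.stronglyMeasurableAtFilter H.cont.continuousAt
  exact ⟨fun u _ => (hd u).continuousAt.continuousWithinAt, fun u _ => by simpa using hd u⟩

/-- Below both critical speeds the orbit ending at `(1, 0)` is positive at `s₁` and at `0`, and its
value at `d` tends to `0` as `d → 1`; the orbit ending at `(d, 0)` is therefore positive too. The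
orbit of speed `-c` dominates the one of speed `0`, namely `∫ᵤᵈ h`, which is positive once `∫ h`
over `[s₁, d]` is. -/
lemma IsBistableFlux.exists_compact_orbits {c cs cz : ℝ} (hc : 0 < c) (hccs : c < cs)
    (hccz : c < cz) (hsmin : ∀ c, 0 ≤ c → c < cs → 0 < backSol h c s₁ 0 0)
    (hzmin : ∀ c, 0 ≤ c → c < cz → 0 < backSol h c 1 0 s₁) :
    ∃ δ > 0, ∀ d, 1 - δ < d → d < 1 → s₂ < d ∧ ∃ q₁ q₂, IsOrbit h c 0 d q₁ ∧ q₁ d = 0 ∧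
      (∀ u ∈ Ico 0 d, 0 < q₁ u) ∧ IsOrbit h (-c) 0 d q₂ ∧ q₂ d = 0 ∧ ∀ u ∈ Ico 0 d, 0 < q₂ u := by
  have hs := H.s₁_pos.le
  have hs1 := H.s₁_lt_one.le
  have horb := isOrbit_backSol H.cont hc.le zero_le_one (θ := 0)
  have hend := backSol_end H.cont hc.le zero_le_one (θ := 0)
  have hqs : 0 < backSol h c 1 0 s₁ := hzmin c hc.le hccz
  have hq0 : 0 < backSol h c 1 0 0 := by
    have h2 := (horb.mono le_rfl hs1).le_of_le (isOrbit_backSol H.cont hc.le hs (θ := 0)) hc.le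
      le_rfl (by rw [backSol_end H.cont hc.le hs]; exact hqs.le) (left_mem_Icc.2 hs)
    linarith [hsmin c hc.le hccs]
  set q := backSol h c 1 0 with hq
  have hlt : Ioo (0 : ℝ) 1 ∈ 𝓝[<] (1 : ℝ) := Ioo_mem_nhdsLT one_pos
  have e1 : ∀ᶠ d in 𝓝[<] (1 : ℝ), q d < min (q 0) (q s₁) := by
    have ht : Tendsto q (𝓝[<] 1) (𝓝 (q 1)) := (horb.cont 1 (right_mem_Icc.2 zero_le_one)).mono_left
      (nhdsWithin_le_iff.2 (mem_of_superset hlt Ioo_subset_Icc_self))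
    rw [hend] at ht
    exact ht.eventually_lt_const (lt_min hq0 hqs)
  have e2 : ∀ᶠ d in 𝓝[<] (1 : ℝ), 0 < ∫ u in s₁..d, h u := by
    have hcont : Continuous fun d => ∫ u in s₁..d, h u :=
      intervalIntegral.continuous_primitive (fun a b => H.cont.intervalIntegrable a b) s₁
    exact ((hcont.tendsto 1).mono_left nhdsWithin_le_nhds).eventually_const_lt H.integral_pos
  have e3 : ∀ᶠ d in 𝓝[<] (1 : ℝ), d ∈ Ioo s₂ 1 := Ioo_mem_nhdsLT H.s₂_lt_one
  obtain ⟨l, hl, hsub⟩ := mem_nhdsLT_iff_exists_Ioo_subset.1 (e1.and (e2.and e3))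
  refine ⟨1 - l, sub_pos.2 hl, fun d hd1 hd2 => ?_⟩
  obtain ⟨hqd, hint, hds, -⟩ := hsub ⟨by linarith, hd2⟩
  have hd0 : 0 < d := (H.s₁_pos.trans H.s₁_lt_s₂).trans hds
  have hsd : s₁ ≤ d := (H.s₁_lt_s₂.trans hds).le
  have horb₁ := isOrbit_backSol H.cont hc.le hd0.le (θ := 0)
  have hend₁ := backSol_end H.cont hc.le hd0.le (θ := 0)
  obtain ⟨q₂, horb₂, hend₂⟩ := exists_neg_speed_orbit H.cont hc.le hd0.le
  refine ⟨hds, backSol h c d 0, q₂, horb₁, hend₁, ?_, horb₂, hend₂, ?_⟩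
  · obtain ⟨M, hM0, hM⟩ := (horb.mono le_rfl hd2.le).exists_sqrt_le
    have hqd0 : 0 ≤ q d := by
      have := H.pos_of_pos hc.le H.s₂_lt_one le_rfl horb hend.ge hqs d ⟨hd0, hd2⟩
      exact this.le
    -- At equal speeds the gap at `d`, which is `q d`, is not amplified backward.
    have hclose : ∀ u ∈ Icc 0 d, q u - q d ≤ backSol h c d 0 u := fun u hu => by
      have := horb₁.sub_le_add (horb.mono le_rfl hd2.le) hc.le hM hu
      rw [sub_self, abs_zero, zero_mul, zero_mul, add_zero, hend₁, zero_sub, abs_neg,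
        abs_of_nonneg hqd0] at this
      linarith [(abs_le.1 this).1]
    have hs₁ : 0 < backSol h c d 0 s₁ := by
      linarith [hclose s₁ ⟨hs, hsd⟩, hqd.trans_le (min_le_right _ _)]
    intro u hu
    rcases hu.1.eq_or_lt with h0 | h0
    · rw [← h0]
      linarith [hclose 0 (left_mem_Icc.2 hd0.le), hqd.trans_le (min_le_left _ _)]
    · exact H.pos_of_pos hc.le hds hd2.le horb₁ hend₁.ge hs₁ u ⟨h0, hu.2⟩
  · have hI := H.isOrbit_integral d
    intro u hu
    refine lt_of_lt_of_le ?_ (horb₂.le_of_le hI le_rfl (by linarith) (by simp [hend₂]) ⟨hu.1, hu.2.le⟩)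
    rcases hu.1.eq_or_lt with h0 | h0
    · rw [← h0, ← intervalIntegral.integral_add_adjacent_intervals
        (H.cont.intervalIntegrable 0 s₁) (H.cont.intervalIntegrable s₁ d)]
      linarith [H.integral_pos_left]
    · exact H.pos_of_pos le_rfl hds hd2.le hI (by simp) hint u ⟨h0, hu.2⟩

/-! ### The maximal orbit issuing from the origin -/

omit H in
/-- The value at `R` of the maximal solution issuing from `0` at `0`. -/
noncomputable def maxOrbit (h : ℝ → ℝ) (c R : ℝ) : ℝ := sSup {θ | backSol h c R θ 0 ≤ 0}

omit H in
lemma maxOrbit_spec {h : ℝ → ℝ} (hh : Continuous h) {c R : ℝ} (hc : 0 ≤ c) (hR : 0 ≤ R) :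
    backSol h c R (maxOrbit h c R) 0 ≤ 0 ∧ ∀ θ, backSol h c R θ 0 ≤ 0 → θ ≤ maxOrbit h c R := by
  obtain ⟨K, hK0, hK⟩ := exists_bound_Icc hh 0 R
  have hne : {θ | backSol h c R θ 0 ≤ 0}.Nonempty :=
    ⟨-K * R, (isOrbit_backSol hh hc hR).left_nonpos_of_small hc hR hK (backSol_end hh hc hR).le⟩
  have hbdd : BddAbove {θ | backSol h c R θ 0 ≤ 0} := by
    refine ⟨((c + K + 1) * (R + 1)) ^ 2 / 2, fun θ hθ => ?_⟩
    by_contra! hlt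
    exact absurd ((isOrbit_backSol hh hc hR).left_pos_of_large hc hR hK
      (hlt.le.trans (backSol_end hh hc hR).ge)) (not_lt.2 hθ)
  have hcl : IsClosed {θ | backSol h c R θ 0 ≤ 0} :=
    isClosed_Iic.preimage (continuous_backSol_end hh hc hR (left_mem_Icc.2 hR))
  exact ⟨hcl.csSup_mem hne hbdd, fun θ hθ => le_csSup hbdd hθ⟩

omit H in
-- The maximal end values at different `R` fit together into one orbit: if the solution through the
-- maximal value at `R` were below the maximal value at `u`, the end value at `R` could be raised a
-- little.
lemma backSol_maxOrbit {h : ℝ → ℝ} (hh : Continuous h) {c R u : ℝ} (hc : 0 ≤ c)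
    (hu : u ∈ Icc 0 R) : backSol h c R (maxOrbit h c R) u = maxOrbit h c u := by
  have hR : 0 ≤ R := hu.1.trans hu.2
  obtain ⟨hR1, hR2⟩ := maxOrbit_spec hh hc hR
  obtain ⟨hu1, hu2⟩ := maxOrbit_spec hh hc hu.1
  refine le_antisymm (hu2 _ ?_) ?_
  · rw [← ((isOrbit_backSol hh hc hR).mono le_rfl hu.2).eqOn_backSol hh hc hu.1 rfl
      (left_mem_Icc.2 hu.1)]
    exact hR1
  · by_contra! hlt
    have hcont := continuous_backSol_end hh hc hR hu
    have hev : ∀ᶠ θ in 𝓝 (maxOrbit h c R), backSol h c R θ u < maxOrbit h c u :=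
      (hcont.tendsto _).eventually_lt_const hlt
    obtain ⟨θ, hθ1, hθ2⟩ := ((hev.filter_mono nhdsWithin_le_nhds).and
      (self_mem_nhdsWithin : Ioi (maxOrbit h c R) ∈ 𝓝[>] (maxOrbit h c R))).exists
    have h1 := (isOrbit_backSol hh hc hu.1 (θ := maxOrbit h c u)).le_of_le
      ((isOrbit_backSol hh hc hR (θ := θ)).mono le_rfl hu.2) hc le_rfl
      (by rw [backSol_end hh hc hu.1]; exact hθ1.le) (left_mem_Icc.2 hu.1)
    exact absurd (hR2 θ (h1.trans hu1)) (not_le.2 hθ2)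

omit H in
lemma isOrbit_maxOrbit {h : ℝ → ℝ} (hh : Continuous h) {c R : ℝ} (hc : 0 ≤ c) (hR : 0 ≤ R) :
    IsOrbit h c 0 R (maxOrbit h c) := by
  have heq : EqOn (maxOrbit h c) (backSol h c R (maxOrbit h c R)) (Icc 0 R) := fun u hu =>
    (backSol_maxOrbit hh hc hu).symm
  refine ⟨(isOrbit_backSol hh hc hR).cont.congr heq, fun u hu => ?_⟩
  rw [heq (Ioo_subset_Icc_self hu)]
  exact ((isOrbit_backSol hh hc hR).deriv u hu).congr_of_eventuallyEq
    (mem_of_superset (Icc_mem_nhds hu.1 hu.2) heq)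

/-- If the maximal orbit were not sharp, a slightly larger end value would still lead to a
nonpositive value at `0`. -/
lemma IsBistableFlux.isSharp_maxOrbit {c : ℝ} (hc : 0 < c) (h0 : maxOrbit h c 0 = 0) :
    IsSharpAtZero c (maxOrbit h c) := by
  by_contra hns
  have horb := isOrbit_maxOrbit H.cont hc.le zero_le_one
  obtain ⟨ε, hε, hnear⟩ := horb.left_nonpos_of_near H.flat hc one_pos h0 hns
  have := hnear c (backSol h c 1 (maxOrbit h c 1 + ε / 2)) (isOrbit_backSol H.cont hc.le zero_le_one)
    (by simpa using hε) (by
      rw [backSol_end H.cont hc.le zero_le_one, add_sub_cancel_left, abs_of_pos (half_pos hε)]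
      linarith)
  linarith [(maxOrbit_spec H.cont hc.le zero_le_one).2 _ this]

/-- Since `c > cs`, the orbit ending at `(s₁, 0)` competes in the supremum, so the maximal orbit is
nonnegative at `s₁`; a zero there would give two sharp orbits of different speeds. A nonpositive
value at `1` would put it below the front orbit of speed `cz`, which vanishes at `s₁`. Beyond `1` it
increases because `h < 0`. -/
lemma IsBistableFlux.maxOrbit_pos {c cs cz : ℝ} {qs : ℝ → ℝ} (hS : IsSharpOrbit h s₁ cs qs)
    (hcs : cs < c) (hcz0 : 0 < cz) (hcz : cz < c) (hz0 : backSol h cz 1 0 s₁ = 0) :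
    maxOrbit h c 0 = 0 ∧ ∀ u, 0 < u → 0 < maxOrbit h c u := by
  have hc : 0 < c := hcz0.trans hcz
  have hs := H.s₁_pos.le
  have hs1 := H.s₁_lt_one.le
  have horb := fun {R} (hR : 0 ≤ R) => isOrbit_maxOrbit (h := h) (R := R) H.cont hc.le hR
  have hback : backSol h c s₁ 0 0 ≤ 0 := by
    have := hS.orbit.le_of_le (isOrbit_backSol H.cont hc.le hs (θ := 0)) hc.le hcs.le
      (by rw [backSol_end H.cont hc.le hs, hS.right]) (left_mem_Icc.2 hs)
    rwa [hS.left] at this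
  have hms : 0 ≤ maxOrbit h c s₁ := (maxOrbit_spec H.cont hc.le hs).2 0 hback
  have h00 : maxOrbit h c 0 = 0 := by
    refine le_antisymm ?_ ((horb hs).nonneg H.pos₁ hms (left_mem_Icc.2 hs))
    rw [← backSol_maxOrbit H.cont hc.le (left_mem_Icc.2 hs)]
    exact (maxOrbit_spec H.cont hc.le hs).1
  have hsharp := H.isSharp_maxOrbit hc h00
  have hms' : 0 < maxOrbit h c s₁ := by
    refine hms.lt_of_ne fun heq => ?_
    exact hS.orbit.not_sharp_of_lt H.s₁_pos (horb hs) hS.speed_pos hcs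
      (by rw [← heq, hS.right]) hS.sharp hsharp
  have hm1 : 0 < maxOrbit h c 1 := by
    by_contra! hle
    have h1 := (isOrbit_backSol H.cont hcz0.le zero_le_one (θ := 0)).le_of_le (horb zero_le_one) hc.le
      hcz.le (by rw [backSol_end H.cont hcz0.le zero_le_one]; exact hle) ⟨hs, hs1⟩
    linarith
  refine ⟨h00, fun u hu => ?_⟩
  rcases lt_or_ge u 1 with h | h
  · exact H.pos_of_pos hc.le H.s₂_lt_one le_rfl (horb zero_le_one) hm1.le hms' u ⟨hu, h⟩
  · exact hm1.trans_le (((horb hu.le).mono zero_le_one le_rfl).monotoneOn hc.le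
      (fun x hx => (H.neg_top x hx.1).le) (left_mem_Icc.2 h) (right_mem_Icc.2 h) h)

end orbits

/-! ### Weak and classical formulations -/

lemma test_deriv {η : ℝ → ℝ} (h : ContDiff ℝ ∞ η) : ContDiff ℝ ∞ (deriv η) :=
  (contDiff_infty_iff_deriv.1 h).2

lemma test_hasDerivAt {η : ℝ → ℝ} (h : ContDiff ℝ ∞ η) (x : ℝ) : HasDerivAt η (deriv η x) x :=
  ((contDiff_infty_iff_deriv.1 h).1 x).hasDerivAt

lemma integrable_mul_test {F η : ℝ → ℝ} (hF : Continuous F) (hη : Continuous η)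
    (hs : HasCompactSupport η) : Integrable fun x => F x * η x :=
  (hF.mul hη).integrable_of_hasCompactSupport hs.mul_left

lemma integral_deriv_mul_add_mul_deriv {F F' η : ℝ → ℝ} (hF : ∀ x, HasDerivAt F (F' x) x)
    (hF' : Continuous F') (hη : ContDiff ℝ ∞ η) (hs : HasCompactSupport η) :
    ∫ x, (F' x * η x + F x * deriv η x) = 0 := by
  have hFc : Continuous F := continuous_iff_continuousAt.2 fun x => (hF x).continuousAt
  exact integral_eq_zero_of_hasDerivAt_of_integrable
    (fun x => (hF x).mul (test_hasDerivAt hη x))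
    ((integrable_mul_test hF' hη.continuous hs).add
      (integrable_mul_test hFc (test_deriv hη).continuous hs.deriv))
    (integrable_mul_test hFc hη.continuous hs)

lemma integral_weak_eq_zero {W V Z G η : ℝ → ℝ} (hW : ∀ x, HasDerivAt W (G x) x)
    (hG : Continuous G) (hGV : ∀ x, HasDerivAt (fun y => G y + V y) (-Z x) x)
    (hV : Continuous V) (hZ : Continuous Z)
    (hη : ContDiff ℝ ∞ η) (hs : HasCompactSupport η) :
    ∫ x, (W x * deriv (deriv η) x - V x * deriv η x + Z x * η x) = 0 := by
  have h1 := integral_deriv_mul_add_mul_deriv hW hG (test_deriv hη) hs.deriv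
  have h2 := integral_deriv_mul_add_mul_deriv hGV hZ.neg hη hs
  have hWc : Continuous W := continuous_iff_continuousAt.2 fun x => (hW x).continuousAt
  have hη0 := hη.continuous
  have hη1 := (test_deriv hη).continuous
  have hη2 := (test_deriv (test_deriv hη)).continuous
  have i1 := (integrable_mul_test hG hη1 hs.deriv).add (integrable_mul_test hWc hη2 hs.deriv.deriv)
  have i2 := (integrable_mul_test hZ.neg hη0 hs).add
    (integrable_mul_test (hG.add hV) hη1 hs.deriv)
  have := integral_sub i1 i2
  simp only [Pi.add_apply, Pi.neg_apply] at this h1 h2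
  rw [h1, h2, sub_zero] at this
  rw [← this]
  congr 1
  ext x
  ring

lemma exists_test_antideriv {ψ : ℝ → ℝ} (hψ : ContDiff ℝ ∞ ψ) (hs : HasCompactSupport ψ)
    (h0 : ∫ x, ψ x = 0) : ∃ η : ℝ → ℝ, ContDiff ℝ ∞ η ∧ HasCompactSupport η ∧ deriv η = ψ := by
  obtain ⟨r, hr⟩ := hs.isCompact.isBounded.subset_closedBall 0
  have hzero : ∀ x, r < |x| → ψ x = 0 := fun x hx => by
    by_contra hne
    have := hr (subset_tsupport _ hne)
    rw [Metric.mem_closedBall, Real.dist_eq, sub_zero] at this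
    linarith
  set R := max r 0 + 1 with hR
  have hrR : r < R := by linarith [le_max_left r 0]
  have hR0 : 0 < R := by linarith [le_max_right r 0]
  have hd : ∀ x, HasDerivAt (fun x => ∫ t in (-R)..x, ψ t) (ψ x) x := fun x =>
    intervalIntegral.integral_hasDerivAt_right (hψ.continuous.intervalIntegrable _ _)
      hψ.continuous.stronglyMeasurable.stronglyMeasurableAtFilter hψ.continuous.continuousAt
  have hderiv : deriv (fun x => ∫ t in (-R)..x, ψ t) = ψ := funext fun x => (hd x).deriv
  refine ⟨fun x => ∫ t in (-R)..x, ψ t, ?_, ?_, hderiv⟩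
  · rw [contDiff_infty_iff_deriv, hderiv]
    exact ⟨fun x => (hd x).differentiableAt, hψ⟩
  · refine HasCompactSupport.intro (isCompact_Icc (a := -R) (b := R)) fun x hx => ?_
    rcases lt_or_ge x (-R) with hlt | hge
    · rw [intervalIntegral.integral_symm, neg_eq_zero]
      refine intervalIntegral.integral_zero_ae (Eventually.of_forall fun t ht => hzero t ?_)
      rw [uIoc_of_le hlt.le] at ht
      rw [abs_of_neg (by linarith [ht.2])]
      linarith [ht.2]
    · have hxR : R < x := by
        by_contra! hle
        exact hx ⟨hge, hle⟩
      rw [intervalIntegral.integral_eq_integral_of_support_subset, h0]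
      intro t ht
      by_contra hnot
      refine ht (hzero t ?_)
      rw [mem_Ioc, not_and_or, not_lt, not_le] at hnot
      rcases hnot with h | h
      · rw [abs_of_neg (by linarith)]; linarith
      · rw [abs_of_pos (by linarith)]; linarith

lemma exists_unit_test : ∃ ρ : ℝ → ℝ, ContDiff ℝ ∞ ρ ∧ HasCompactSupport ρ ∧ ∫ x, ρ x = 1 := by
  let b : ContDiffBump (0 : ℝ) := ⟨1, 2, one_pos, one_lt_two⟩
  exact ⟨b.normed volume, b.contDiff_normed, b.hasCompactSupport_normed, b.integral_normed⟩

/-- Du Bois-Reymond: subtracting a multiple of a fixed bump of integral `1` makes any test function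
the derivative of a test function. -/
lemma eq_const_of_integral_deriv {w : ℝ → ℝ} (hw : Continuous w)
    (h : ∀ η : ℝ → ℝ, ContDiff ℝ ∞ η → HasCompactSupport η → ∫ x, w x * deriv η x = 0) :
    ∃ a, ∀ x, w x = a := by
  obtain ⟨ρ, hρ, hρs, hρ1⟩ := exists_unit_test
  refine ⟨∫ x, w x * ρ x, fun x => ?_⟩
  set a := ∫ x, w x * ρ x with ha
  have hae : ∀ᵐ x, w x - a = 0 := by
    refine ae_eq_zero_of_integral_contDiff_smul_eq_zero
      ((hw.sub continuous_const).locallyIntegrable) fun φ hφ hφs => ?_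
    have iφ := hφ.continuous.integrable_of_hasCompactSupport hφs (μ := volume)
    have iρ := hρ.continuous.integrable_of_hasCompactSupport hρs (μ := volume)
    obtain ⟨η, hη, hηs, hηd⟩ := exists_test_antideriv (ψ := fun x => φ x - (∫ y, φ y) * ρ x)
      (hφ.sub (contDiff_const.mul hρ)) (hφs.sub hρs.mul_left) (by
        rw [integral_sub iφ (iρ.const_mul _), integral_const_mul, hρ1, mul_one, sub_self])
    have h1 := h η hη hηs
    rw [hηd] at h1
    have i1 := integrable_mul_test hw hφ.continuous hφs
    have i2 := integrable_mul_test hw hρ.continuous hρs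
    have h2 : ∫ x, (w x * φ x - (∫ y, φ y) * (w x * ρ x)) = 0 := by
      rw [← h1]; congr 1; ext x; ring
    rw [integral_sub i1 (i2.const_mul _), integral_const_mul, ← ha] at h2
    have h3 : ∫ x, φ x • (w x - a) = ∫ x, (w x * φ x - φ x * a) := by
      congr 1; ext x; simp only [smul_eq_mul]; ring
    rw [h3, integral_sub i1 (iφ.mul_const _), integral_mul_const]
    exact h2
  have := (hw.sub (continuous_const (y := a))).ae_eq_iff_eq volume (continuous_const (y := (0 : ℝ)))
  exact sub_eq_zero.1 (congrFun (this.1 hae) x)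

/-- Reduction to the first-order case: `a = ∫ w ρ'` is minus the slope of `w`, so `w + a x` is
orthogonal to all derivatives of test functions. -/
lemma eq_affine_of_integral_deriv_two {w : ℝ → ℝ} (hw : Continuous w)
    (h : ∀ η : ℝ → ℝ, ContDiff ℝ ∞ η → HasCompactSupport η → ∫ x, w x * deriv (deriv η) x = 0) :
    ∃ a b, ∀ x, w x = a * x + b := by
  obtain ⟨ρ, hρ, hρs, hρ1⟩ := exists_unit_test
  set a := ∫ x, w x * deriv ρ x with ha
  obtain ⟨b, hb⟩ := eq_const_of_integral_deriv (w := fun x => w x + a * x) (by fun_prop) (by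
    intro φ hφ hφs
    have iφ := hφ.continuous.integrable_of_hasCompactSupport hφs (μ := volume)
    have iρ := hρ.continuous.integrable_of_hasCompactSupport hρs (μ := volume)
    obtain ⟨η, hη, hηs, hηd⟩ := exists_test_antideriv (ψ := fun x => φ x - (∫ y, φ y) * ρ x)
      (hφ.sub (contDiff_const.mul hρ)) (hφs.sub hρs.mul_left) (by
        rw [integral_sub iφ (iρ.const_mul _), integral_const_mul, hρ1, mul_one, sub_self])
    have h1 := h η hη hηs
    have hd : deriv (deriv η) = fun x => deriv φ x - (∫ y, φ y) * deriv ρ x := by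
      rw [hηd]
      exact funext fun x => ((test_hasDerivAt hφ x).sub ((test_hasDerivAt hρ x).const_mul _)).deriv
    rw [hd] at h1
    have hφ' := (test_deriv hφ).continuous
    have hρ' := (test_deriv hρ).continuous
    have i1 := integrable_mul_test hw hφ' hφs.deriv
    have i2 := integrable_mul_test hw hρ' hρs.deriv
    have h2 : ∫ x, (w x * deriv φ x - (∫ y, φ y) * (w x * deriv ρ x)) = 0 := by
      rw [← h1]; congr 1; ext x; ring
    rw [integral_sub i1 (i2.const_mul _), integral_const_mul, ← ha] at h2
    have i3 := integrable_mul_test continuous_id hφ' hφs.deriv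
    simp only [id_eq] at i3
    have h3 := integral_deriv_mul_add_mul_deriv (F := fun x => x) (F' := fun _ => 1)
      (fun x => hasDerivAt_id x) continuous_const hφ hφs
    simp only [one_mul] at h3
    rw [integral_add iφ i3] at h3
    have h4 : ∫ x, (w x + a * x) * deriv φ x = ∫ x, (w x * deriv φ x + a * (x * deriv φ x)) := by
      congr 1; ext x; ring
    rw [h4, integral_add i1 (i3.const_mul _), integral_const_mul]
    linear_combination h2 + a * h3)
  exact ⟨-a, b, fun x => by linarith [hb x]⟩

/-- Adding iterated antiderivatives of the lower-order terms to `W` gives a function with zero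
second distributional derivative, hence an affine one; the flux is obtained by differentiating this
identity. -/
lemma exists_flux_of_integral_weak {W V Z : ℝ → ℝ} (hW : Continuous W) (hV : Continuous V)
    (hZ : Continuous Z) (h : ∀ η : ℝ → ℝ, ContDiff ℝ ∞ η → HasCompactSupport η →
      ∫ x, (W x * deriv (deriv η) x - V x * deriv η x + Z x * η x) = 0) :
    ∃ G : ℝ → ℝ, (∀ x, HasDerivAt W (G x) x) ∧ ∀ x, HasDerivAt (fun y => G y + V y) (-Z x) x := by
  set Z₁ : ℝ → ℝ := fun x => ∫ t in (0 : ℝ)..x, Z t with hZ₁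
  have hprim : ∀ {F : ℝ → ℝ}, Continuous F → ∀ x,
      HasDerivAt (fun x => ∫ t in (0 : ℝ)..x, F t) (F x) x := fun hF x =>
    intervalIntegral.integral_hasDerivAt_right (hF.intervalIntegrable _ _)
      hF.stronglyMeasurable.stronglyMeasurableAtFilter hF.continuousAt
  have hZ₁d := hprim hZ
  have hZ₁c : Continuous Z₁ := continuous_iff_continuousAt.2 fun x => (hZ₁d x).continuousAt
  set G₀ : ℝ → ℝ := fun x => ∫ t in (0 : ℝ)..x, (V t + Z₁ t) with hG₀
  have hG₀d := hprim (hV.add hZ₁c)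
  have hG₀c : Continuous G₀ := continuous_iff_continuousAt.2 fun x => (hG₀d x).continuousAt
  obtain ⟨a, b, hab⟩ := eq_affine_of_integral_deriv_two (w := fun x => W x + G₀ x)
    (hW.add hG₀c) (by
    intro η hη hs
    have h1 := integral_deriv_mul_add_mul_deriv hZ₁d hZ hη hs
    have h2 := integral_deriv_mul_add_mul_deriv hG₀d (hV.add hZ₁c) (test_deriv hη) hs.deriv
    have h3 := h η hη hs
    have hη0 := hη.continuous
    have hη1 := (test_deriv hη).continuous
    have hη2 := (test_deriv (test_deriv hη)).continuous
    have i1 := (integrable_mul_test hZ hη0 hs).add (integrable_mul_test hZ₁c hη1 hs.deriv)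
    have i2 := (integrable_mul_test (hV.add hZ₁c) hη1 hs.deriv).add
      (integrable_mul_test hG₀c hη2 hs.deriv.deriv)
    have i3 := ((integrable_mul_test hW hη2 hs.deriv.deriv).sub
      (integrable_mul_test hV hη1 hs.deriv)).add (integrable_mul_test hZ hη0 hs)
    have e := integral_sub (i3.add i2) i1
    have e' := integral_add i3 i2
    simp only [Pi.add_apply, Pi.sub_apply] at e e' h1 h2 h3
    rw [h3, h2, add_zero] at e'
    rw [e', h1, sub_zero] at e
    rw [← e]
    congr 1
    ext x
    ring)
  refine ⟨fun x => a - (V x + Z₁ x), fun x => ?_, fun x => ?_⟩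
  · have : W = fun x => a * x + b - G₀ x := funext fun x => by linarith [hab x]
    rw [this]
    have hlin : HasDerivAt (fun x => a * x + b) a x := by
      simpa using ((hasDerivAt_id x).const_mul a).add_const b
    exact hlin.sub (hG₀d x)
  · have : (fun y => a - (V y + Z₁ y) + V y) = fun y => a - Z₁ y := funext fun y => by ring
    rw [this]
    exact (hZ₁d x).const_sub a

/-! ### The diffusion and reaction terms -/

namespace AdmissibleDiffusion

variable {A : ℝ → ℝ} (hA : AdmissibleDiffusion A)

include hA

lemma continuousOn : ContinuousOn A (Ici 0) := hA.contDiffOn_one.continuousOn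

lemma hasDerivAt {u : ℝ} (hu : 0 < u) : HasDerivAt A (deriv A u) u :=
  ((hA.contDiffOn_top.contDiffAt (Ioi_mem_nhds hu)).differentiableAt (by simp)).hasDerivAt

lemma contDiffOn_deriv : ContDiffOn ℝ ∞ (deriv A) (Ioi 0) :=
  ((contDiffOn_infty_iff_deriv_of_isOpen isOpen_Ioi).1 hA.contDiffOn_top).2

lemma hasDerivAt_deriv {u : ℝ} (hu : 0 < u) : HasDerivAt (deriv A) (deriv (deriv A) u) u :=
  ((hA.contDiffOn_deriv.contDiffAt (Ioi_mem_nhds hu)).differentiableAt (by simp)).hasDerivAt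

lemma continuousAt_deriv {u : ℝ} (hu : 0 < u) : ContinuousAt (deriv A) u :=
  (hA.hasDerivAt_deriv hu).continuousAt

lemma tendsto_deriv : Tendsto (deriv A) (𝓝[>] 0) (𝓝 0) := by
  have hc := hA.contDiffOn_one.continuousOn_derivWithin (uniqueDiffOn_Ici 0) le_rfl
  have h0 := (hc 0 self_mem_Ici).mono_left (nhdsWithin_mono 0 Ioi_subset_Ici_self)
  rw [hA.deriv_zero] at h0
  refine h0.congr' ?_
  filter_upwards [self_mem_nhdsWithin] with u hu
  exact derivWithin_of_mem_nhds (Ici_mem_nhds hu)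

lemma intervalIntegrable_pressure {u : ℝ} (hu : 0 < u) :
    IntervalIntegrable (fun r => deriv A r / r) volume 0 u := by
  have h1 : IntervalIntegrable (fun r => deriv A r / r) volume 0 1 :=
    (intervalIntegrable_iff_integrableOn_Ioc_of_le zero_le_one).2 hA.integrable
  refine h1.trans (ContinuousOn.intervalIntegrable fun r hr => ?_)
  have hr0 : 0 < r := (lt_min one_pos hu).trans_le hr.1
  exact ((hA.continuousAt_deriv hr0).div continuousAt_id hr0.ne').continuousWithinAt

lemma hasDerivAt_pressure {u : ℝ} (hu : 0 < u) : HasDerivAt (pressure A) (deriv A u / u) u := by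
  have hc : ContinuousOn (fun r => deriv A r / r) (Ioi 0) := fun r (hr : 0 < r) =>
    ((hA.continuousAt_deriv hr).div continuousAt_id hr.ne').continuousWithinAt
  exact intervalIntegral.integral_hasDerivAt_right (hA.intervalIntegrable_pressure hu)
    (hc.stronglyMeasurableAtFilter isOpen_Ioi u hu)
    ((hA.continuousAt_deriv hu).div continuousAt_id hu.ne')

omit hA in
lemma pressure_zero : pressure A 0 = 0 := by simp [pressure]

lemma pressure_nonneg {u : ℝ} (hu : 0 ≤ u) : 0 ≤ pressure A u := by
  rcases hu.eq_or_lt with h | h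
  · rw [← h, pressure_zero]
  · refine intervalIntegral.integral_nonneg_of_ae_restrict h.le ?_
    refine (ae_restrict_iff' measurableSet_Icc).2 (Eventually.of_forall fun r hr => ?_)
    rcases hr.1.eq_or_lt with h0 | h0
    · simp [← h0]
    · exact (div_pos (hA.deriv_pos r h0) h0).le

lemma tendsto_pressure : Tendsto (pressure A) (𝓝[≥] 0) (𝓝 0) := by
  have h1 : IntegrableOn (fun r => deriv A r / r) (uIcc 0 1) := by
    rw [uIcc_of_le zero_le_one, integrableOn_Icc_iff_integrableOn_Ioc]
    exact hA.integrable
  have h2 := intervalIntegral.continuousOn_primitive_interval h1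
  rw [uIcc_of_le zero_le_one] at h2
  have h3 := (h2 0 (left_mem_Icc.2 zero_le_one)).mono_left
    (nhdsWithin_le_iff.2 (Icc_mem_nhdsGE one_pos))
  simp only [intervalIntegral.integral_same] at h3
  exact h3

end AdmissibleDiffusion

/-- The product `A' f` on `(0,∞)`, extended by zero. -/
noncomputable def fluxReaction (A f : ℝ → ℝ) (u : ℝ) : ℝ := if 0 < u then deriv A u * f u else 0

lemma fluxReaction_of_pos {A f : ℝ → ℝ} {u : ℝ} (hu : 0 < u) :
    fluxReaction A f u = deriv A u * f u := if_pos hu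

namespace MonostableBistable

variable {A f : ℝ → ℝ} {s₁ s₂ : ℝ} (hA : AdmissibleDiffusion A) (hf : MonostableBistable A f s₁ s₂)

section reaction

include hf

lemma hasDerivAt {u : ℝ} (hu : 0 < u) : HasDerivAt f (deriv f u) u :=
  ((hf.contDiffOn.contDiffAt (Ici_mem_nhds hu)).differentiableAt (by simp)).hasDerivAt

lemma f_zero : f 0 = 0 := (hf.zeros 0 le_rfl).2 (.inl rfl)

lemma f_s₁ : f s₁ = 0 := (hf.zeros s₁ hf.s₁_pos.le).2 (.inr (.inl rfl))

lemma f_one : f 1 = 0 := (hf.zeros 1 zero_le_one).2 (.inr (.inr (.inr rfl)))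

/-- There is no zero beyond `1`, and `f'(1) < 0` fixes the sign just to the right of `1`. -/
lemma neg_of_one_lt {u : ℝ} (hu : 1 < u) : f u < 0 := by
  by_contra! hge
  have hne : ∀ x, 1 < x → f x ≠ 0 := fun x hx h0 => by
    have h1 := hf.s₁_lt_s₂
    have h2 := hf.s₂_lt_one
    rcases (hf.zeros x (by linarith)).1 h0 with h | h | h | h <;> linarith
  have hev : ∀ᶠ x in 𝓝[>] (1 : ℝ), f x < 0 := by
    have hs := (hasDerivAt_iff_tendsto_slope.1 (hf.hasDerivAt one_pos)).mono_left
      (nhdsGT_le_nhdsNE 1)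
    filter_upwards [hs.eventually_lt_const hf.deriv_one, self_mem_nhdsWithin] with x hx hx1
    rw [slope_def_field, hf.f_one, sub_zero] at hx
    have hx1' : 0 < x - 1 := sub_pos.2 hx1
    by_contra! h
    exact absurd (div_nonneg h hx1'.le) (not_le.2 hx)
  obtain ⟨x, hx, hxu⟩ := (hev.and (Ioo_mem_nhdsGT hu)).exists
  have hcont : ContinuousOn f (Icc x u) := fun y hy =>
    (hf.hasDerivAt (one_pos.trans (hxu.1.trans_le hy.1))).continuousAt.continuousWithinAt
  obtain ⟨y, hy, hy0⟩ := intermediate_value_Icc hxu.2.le hcont ⟨hx.le, hge⟩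
  exact hne y (hxu.1.trans_le hy.1) hy0

lemma exists_linear_bound_zero : ∃ K > 0, ∃ r > 0, ∀ u ∈ Ioo 0 r, |f u| ≤ K * u := by
  have hd : HasDerivWithinAt f (derivWithin f (Ici 0) 0) (Ici 0) 0 :=
    (hf.contDiffOn.differentiableOn (by simp) 0 self_mem_Ici).hasDerivWithinAt
  obtain ⟨K, hK, hb⟩ := hd.differentiableWithinAt.isBigO_sub.exists_pos
  rw [Asymptotics.isBigOWith_iff] at hb
  obtain ⟨r, hr, hsub⟩ := mem_nhdsGT_iff_exists_Ioo_subset.1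
    (hb.filter_mono (nhdsWithin_mono 0 Ioi_subset_Ici_self))
  refine ⟨K, hK, r, hr, fun u hu => ?_⟩
  have := hsub hu
  simpa [hf.f_zero, abs_of_pos hu.1] using this

end reaction

include hA hf

/-- `f = O(u)` by differentiability at `0`, and `A' → 0`. -/
lemma isFlatAtZero : IsFlatAtZero (fluxReaction A f) := by
  intro ε hε
  obtain ⟨K, hK, r, hr, hb⟩ := hf.exists_linear_bound_zero
  obtain ⟨r', hr', hsub⟩ := mem_nhdsGT_iff_exists_Ioo_subset.1
    (hA.tendsto_deriv.eventually_lt_const (show 0 < ε / K by positivity))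
  refine ⟨min r r', lt_min hr hr', fun u hu => ?_⟩
  have h1 : deriv A u < ε / K := hsub ⟨hu.1, hu.2.trans_le (min_le_right _ _)⟩
  have h2 := hb u ⟨hu.1, hu.2.trans_le (min_le_left _ _)⟩
  rw [fluxReaction_of_pos hu.1, abs_mul, abs_of_pos (hA.deriv_pos u hu.1)]
  calc deriv A u * |f u| ≤ ε / K * (K * u) :=
        mul_le_mul h1.le h2 (abs_nonneg _) (by positivity)
    _ = ε * u := by field_simp

lemma hasDerivAt_fluxReaction {u : ℝ} (hu : 0 < u) : HasDerivAt (fluxReaction A f)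
    (deriv (deriv A) u * f u + deriv A u * deriv f u) u :=
  ((hA.hasDerivAt_deriv hu).mul (hf.hasDerivAt hu)).congr_of_eventuallyEq
    (mem_of_superset (Ioi_mem_nhds hu) fun _ hx => fluxReaction_of_pos hx)

lemma continuous_fluxReaction : Continuous (fluxReaction A f) := by
  rw [continuous_iff_continuousAt]
  intro u
  rcases lt_trichotomy u 0 with hu | rfl | hu
  · refine (continuousAt_const (y := (0 : ℝ))).congr ?_
    filter_upwards [Iio_mem_nhds hu] with x hx
    exact (if_neg (not_lt.2 (le_of_lt hx))).symm
  · have h0 : fluxReaction A f 0 = 0 := if_neg (lt_irrefl 0)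
    rw [Metric.continuousAt_iff]
    intro ε hε
    obtain ⟨r, hr, hb⟩ := isFlatAtZero hA hf 1 one_pos
    refine ⟨min r ε, lt_min hr hε, fun {x} hx => ?_⟩
    rw [Real.dist_eq, sub_zero] at hx
    rw [h0, Real.dist_eq, sub_zero]
    rcases lt_or_ge 0 x with hx0 | hx0
    · rw [abs_of_pos hx0] at hx
      have := hb x ⟨hx0, hx.trans_le (min_le_left _ _)⟩
      linarith [hx.trans_le (min_le_right _ _)]
    · rw [fluxReaction, if_neg (not_lt.2 hx0), abs_zero]
      exact hε
  · exact (hasDerivAt_fluxReaction hA hf hu).continuousAt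

lemma isBistableFlux : IsBistableFlux (fluxReaction A f) s₁ s₂ where
  cont := continuous_fluxReaction hA hf
  flat := isFlatAtZero hA hf
  s₁_pos := hf.s₁_pos
  s₁_lt_s₂ := hf.s₁_lt_s₂
  s₂_lt_one := hf.s₂_lt_one
  pos₁ u hu := by
    rw [fluxReaction_of_pos hu.1]
    exact mul_pos (hA.deriv_pos u hu.1) (hf.monostable u hu)
  neg u hu := by
    have hu0 := hf.s₁_pos.trans hu.1
    rw [fluxReaction_of_pos hu0]
    exact mul_neg_of_pos_of_neg (hA.deriv_pos u hu0) (hf.bistable_neg u hu)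
  pos₂ u hu := by
    have hu0 := (hf.s₁_pos.trans hf.s₁_lt_s₂).trans hu.1
    rw [fluxReaction_of_pos hu0]
    exact mul_pos (hA.deriv_pos u hu0) (hf.bistable_pos u hu)
  neg_top u hu := by
    have hu0 := one_pos.trans hu
    rw [fluxReaction_of_pos hu0]
    exact mul_neg_of_pos_of_neg (hA.deriv_pos u hu0) (hf.neg_of_one_lt hu)
  integral_pos := by
    have h1 : s₁ ≤ 1 := (hf.s₁_lt_s₂.trans hf.s₂_lt_one).le
    refine hf.integral_pos.trans_eq (intervalIntegral.integral_congr fun u hu => ?_)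
    rw [uIcc_of_le h1] at hu
    exact (fluxReaction_of_pos (hf.s₁_pos.trans_le hu.1)).symm

lemma exists_linear_bound {s : ℝ} (hs : 0 < s) (hfs : f s = 0) :
    ∃ K > 0, ∃ r > 0, ∀ u ∈ Ioo (s - r) (s + r), |fluxReaction A f u| ≤ K * |u - s| := by
  obtain ⟨K, hK, hb⟩ := (hasDerivAt_fluxReaction hA hf hs).differentiableAt.isBigO_sub.exists_pos
  rw [Asymptotics.isBigOWith_iff] at hb
  obtain ⟨r, hr, hsub⟩ := Metric.eventually_nhds_iff_ball.1 hb
  refine ⟨K, hK, r, hr, fun u hu => ?_⟩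
  have := hsub u (by rw [Real.ball_eq_Ioo]; exact hu)
  simpa [fluxReaction_of_pos hs, hfs] using this

end MonostableBistable

/-! ### Inverse functions and antiderivatives on intervals -/

lemma strictAntiOn_of_hasDerivAt_neg {I : Set ℝ} (hIc : I.OrdConnected) {X X' : ℝ → ℝ}
    (hd : ∀ u ∈ I, HasDerivAt X (X' u) u) (hneg : ∀ u ∈ I, X' u < 0) : StrictAntiOn X I :=
  strictAntiOn_of_deriv_neg hIc.convex (fun u hu => (hd u hu).continuousAt.continuousWithinAt)
    fun u hu => by
      rw [(hd u (interior_subset hu)).deriv]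
      exact hneg u (interior_subset hu)

lemma ordConnected_image_of_hasDerivAt {I : Set ℝ} (hIc : I.OrdConnected) {X X' : ℝ → ℝ}
    (hd : ∀ u ∈ I, HasDerivAt X (X' u) u) : (X '' I).OrdConnected :=
  (hIc.isPreconnected.image X
    fun u hu => (hd u hu).continuousAt.continuousWithinAt).ordConnected

lemma exists_Ioo_image_subset {I : Set ℝ} (hI : IsOpen I) (hIc : I.OrdConnected) {X X' : ℝ → ℝ}
    (hd : ∀ u ∈ I, HasDerivAt X (X' u) u) (hneg : ∀ u ∈ I, X' u < 0) {u : ℝ} (hu : u ∈ I) {ε : ℝ}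
    (hε : 0 < ε) : ∃ a ∈ I, ∃ b ∈ I, u - ε < a ∧ a < u ∧ u < b ∧ b < u + ε ∧
      X b < X u ∧ X u < X a ∧ Ioo (X b) (X a) ⊆ X '' I := by
  obtain ⟨r, hr, hsub⟩ := Metric.isOpen_iff.1 hI u hu
  rw [Real.ball_eq_Ioo] at hsub
  set m := min r ε / 2 with hm
  have hm0 : 0 < min r ε := lt_min hr hε
  have hmr : m < r := (half_lt_self hm0).trans_le (min_le_left _ _)
  have hmε : m < ε := (half_lt_self hm0).trans_le (min_le_right _ _)
  have hm1 : 0 < m := half_pos hm0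
  have ha : u - m ∈ I := hsub ⟨by linarith, by linarith⟩
  have hb : u + m ∈ I := hsub ⟨by linarith, by linarith⟩
  have hanti := strictAntiOn_of_hasDerivAt_neg hIc hd hneg
  exact ⟨u - m, ha, u + m, hb, by linarith, by linarith, by linarith, by linarith,
    hanti hu hb (by linarith), hanti ha hu (by linarith), fun x hx =>
      (ordConnected_image_of_hasDerivAt hIc hd).out ⟨_, hb, rfl⟩ ⟨_, ha, rfl⟩ ⟨hx.1.le, hx.2.le⟩⟩

lemma isOpen_image_of_hasDerivAt_neg {I : Set ℝ} (hI : IsOpen I) (hIc : I.OrdConnected)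
    {X X' : ℝ → ℝ} (hd : ∀ u ∈ I, HasDerivAt X (X' u) u) (hneg : ∀ u ∈ I, X' u < 0) :
    IsOpen (X '' I) := by
  rw [isOpen_iff_mem_nhds]
  rintro _ ⟨u, hu, rfl⟩
  obtain ⟨a, -, b, -, -, -, -, -, h1, h2, hsub⟩ :=
    exists_Ioo_image_subset hI hIc hd hneg hu one_pos
  exact mem_of_superset (Ioo_mem_nhds h1 h2) hsub

/-- A function with negative derivative on an open interval has a differentiable inverse there,
which we extend by zero. -/
lemma exists_inverse {I : Set ℝ} (hI : IsOpen I) (hIc : I.OrdConnected) {X X' : ℝ → ℝ}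
    (hd : ∀ u ∈ I, HasDerivAt X (X' u) u) (hneg : ∀ u ∈ I, X' u < 0) :
    ∃ Q : ℝ → ℝ, (∀ u ∈ I, Q (X u) = u) ∧ (∀ x ∉ X '' I, Q x = 0) ∧
      ∀ u ∈ I, HasDerivAt Q (X' u)⁻¹ (X u) := by
  have hanti := strictAntiOn_of_hasDerivAt_neg hIc hd hneg
  classical
  have hinv : ∀ u ∈ I, (X '' I).indicator (Function.invFunOn X I) (X u) = u := fun u hu => by
    rw [indicator_of_mem (mem_image_of_mem X hu)]
    exact hanti.injOn.leftInvOn_invFunOn hu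
  refine ⟨(X '' I).indicator (Function.invFunOn X I), hinv,
    fun x hx => indicator_of_notMem hx _, fun u hu => ?_⟩
  set Q := (X '' I).indicator (Function.invFunOn X I)
  have hcont : ContinuousAt Q (X u) := by
    rw [Metric.continuousAt_iff]
    intro ε hε
    obtain ⟨a, ha, b, hb, h1, h2, h3, h4, h5, h6, hsub⟩ :=
      exists_Ioo_image_subset hI hIc hd hneg hu hε
    obtain ⟨δ, hδ, hball⟩ := Metric.mem_nhds_iff.1 (Ioo_mem_nhds h5 h6)
    refine ⟨δ, hδ, fun {x} hx => ?_⟩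
    have hx' := hball hx
    obtain ⟨v, hv, rfl⟩ := hsub hx'
    rw [hinv v hv, hinv u hu, Real.dist_eq, abs_lt]
    have hva : a < v := (hanti.lt_iff_gt hv ha).1 hx'.2
    have hvb : v < b := (hanti.lt_iff_gt hb hv).1 hx'.1
    constructor <;> linarith
  have hd' : HasDerivAt X (X' u) (Q (X u)) := by rw [hinv u hu]; exact hd u hu
  refine hd'.of_local_left_inverse hcont (hneg u hu).ne ?_
  filter_upwards [(isOpen_image_of_hasDerivAt_neg hI hIc hd hneg).mem_nhds
    (mem_image_of_mem X hu)] with x hx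
  obtain ⟨v, hv, rfl⟩ := hx
  rw [hinv v hv]

lemma exists_hasDerivAt_of_continuousOn {I : Set ℝ} (hI : IsOpen I) (hIc : I.OrdConnected)
    {g : ℝ → ℝ} (hg : ContinuousOn g I) : ∃ X : ℝ → ℝ, ∀ u ∈ I, HasDerivAt X (g u) u := by
  rcases I.eq_empty_or_nonempty with rfl | ⟨u₀, hu₀⟩
  · exact ⟨0, by simp⟩
  refine ⟨fun u => ∫ t in u₀..u, g t, fun u hu => ?_⟩
  exact intervalIntegral.integral_hasDerivAt_right
    ((hg.mono (hIc.uIcc_subset hu₀ hu)).intervalIntegrable)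
    (hg.stronglyMeasurableAtFilter hI u hu) (hg.continuousAt (hI.mem_nhds hu))

/-- By the mean value theorem each slope is a value of `g'` at an intermediate point. The limit is
taken in `EReal`, since the pressure of a compactly supported profile has slope `-∞`. -/
lemma hasLeftDeriv_of_tendsto {g g' : ℝ → ℝ} {x₀ : ℝ} {m : EReal} (hx₀ : x₀ < 0)
    (hc : ContinuousOn g (Ioc x₀ 0)) (hd : ∀ x ∈ Ioo x₀ 0, HasDerivAt g (g' x) x)
    (hlim : Tendsto (fun x => ((g' x : ℝ) : EReal)) (𝓝[<] 0) (𝓝 m)) : HasLeftDeriv g 0 m := by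
  have hmem : Ioo x₀ 0 ∈ 𝓝[<] (0 : ℝ) := Ioo_mem_nhdsLT hx₀
  have hmvt : ∀ x ∈ Ioo x₀ 0, ∃ y ∈ Ioo x 0, g' y = slope g 0 x := fun x hx => by
    obtain ⟨y, hy, hy'⟩ := exists_hasDerivAt_eq_slope g g' hx.2
      (hc.mono fun z hz => ⟨hx.1.trans_le hz.1, hz.2⟩)
      (fun z hz => hd z ⟨hx.1.trans hz.1, hz.2⟩)
    refine ⟨y, hy, ?_⟩
    rw [hy', slope_comm, slope_def_field]
  choose! y hy hy' using hmvt
  have hylim : Tendsto y (𝓝[<] 0) (𝓝[<] 0) := by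
    refine tendsto_nhdsWithin_iff.2 ⟨?_, mem_of_superset hmem fun x hx => (hy x hx).2⟩
    refine tendsto_of_tendsto_of_tendsto_of_le_of_le' (tendsto_id.mono_left nhdsWithin_le_nhds)
      tendsto_const_nhds (mem_of_superset hmem fun x hx => (hy x hx).1.le)
      (mem_of_superset hmem fun x hx => (hy x hx).2.le)
  refine (hlim.comp hylim).congr' ?_
  filter_upwards [hmem] with x hx
  rw [Function.comp_apply, hy' x hx]

/-! ### Profiles as solutions of a first-order system -/

/-- `U` and its flux `V = [A(U)]'` solve the profile equation on `J` as a first-order system. -/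
def IsProfileOn (A f : ℝ → ℝ) (c : ℝ) (U V : ℝ → ℝ) (J : Set ℝ) : Prop :=
  ∀ x ∈ J, 0 < U x ∧ HasDerivAt U (V x / deriv A (U x)) x ∧
    HasDerivAt V (-(c * (V x / deriv A (U x))) - f (U x)) x

lemma IsProfileOn.hasDerivAt_comp {A f : ℝ → ℝ} (hA : AdmissibleDiffusion A) {c : ℝ} {U V : ℝ → ℝ}
    {J : Set ℝ} (h : IsProfileOn A f c U V J) {x : ℝ} (hx : x ∈ J) :
    HasDerivAt (fun y => A (U y)) (V x) x := by
  obtain ⟨h0, h1, -⟩ := h x hx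
  have := (hA.hasDerivAt h0).comp x h1
  rwa [mul_div_cancel₀ _ (hA.deriv_pos _ h0).ne'] at this

lemma IsProfileOn.hasDerivAt_pressure {A f : ℝ → ℝ} (hA : AdmissibleDiffusion A) {c : ℝ}
    {U V : ℝ → ℝ} {J : Set ℝ} (h : IsProfileOn A f c U V J) {x : ℝ} (hx : x ∈ J) :
    HasDerivAt (fun y => pressure A (U y)) (V x / U x) x := by
  obtain ⟨h0, h1, -⟩ := h x hx
  have := (hA.hasDerivAt_pressure h0).comp x h1
  have h2 := (hA.deriv_pos _ h0).ne'
  convert! this using 1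
  field_simp

lemma IsProfileOn.isClassical {A f : ℝ → ℝ} (hA : AdmissibleDiffusion A)
    (hf : ContinuousOn f (Ici 0)) {c : ℝ} {U V : ℝ → ℝ}
    {J : Set ℝ} (hJ : IsOpen J) (h : IsProfileOn A f c U V J) : IsClassicalProfileOn A f c U J := by
  have hUc : ContinuousOn U J := fun x hx => (h x hx).2.1.continuousAt.continuousWithinAt
  have hVc : ContinuousOn V J := fun x hx => (h x hx).2.2.continuousAt.continuousWithinAt
  have hmaps : MapsTo U J (Ioi 0) := fun x hx => (h x hx).1
  have hA'c : ContinuousOn (fun x => deriv A (U x)) J := hA.contDiffOn_deriv.continuousOn.comp hUc hmaps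
  have hA'0 : ∀ x ∈ J, deriv A (U x) ≠ 0 := fun x hx => (hA.deriv_pos _ (h x hx).1).ne'
  have hdU : EqOn (deriv U) (fun x => V x / deriv A (U x)) J := fun x hx => (h x hx).2.1.deriv
  have hdV : EqOn (deriv V) (fun x => -(c * (V x / deriv A (U x))) - f (U x)) J :=
    fun x hx => (h x hx).2.2.deriv
  have hU1 : ContDiffOn ℝ 1 U J := by
    rw [show (1 : WithTop ℕ∞) = 0 + 1 from (zero_add 1).symm, contDiffOn_succ_iff_deriv_of_isOpen hJ]
    refine ⟨fun x hx => (h x hx).2.1.differentiableAt.differentiableWithinAt, by simp, ?_⟩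
    rw [contDiffOn_zero]
    exact (hVc.div hA'c hA'0).congr hdU
  have hV1 : ContDiffOn ℝ 1 V J := by
    rw [show (1 : WithTop ℕ∞) = 0 + 1 from (zero_add 1).symm, contDiffOn_succ_iff_deriv_of_isOpen hJ]
    refine ⟨fun x hx => (h x hx).2.2.differentiableAt.differentiableWithinAt, by simp, ?_⟩
    rw [contDiffOn_zero]
    have hfc : ContinuousOn (fun x => f (U x)) J :=
      hf.comp hUc fun x hx => (h x hx).1.le
    exact (((continuousOn_const.mul (hVc.div hA'c hA'0)).neg).sub hfc).congr hdV
  refine ⟨?_, fun x hx => ?_⟩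
  · rw [show (2 : WithTop ℕ∞) = 1 + 1 by norm_num, contDiffOn_succ_iff_deriv_of_isOpen hJ]
    refine ⟨fun x hx => (h x hx).2.1.differentiableAt.differentiableWithinAt, by simp, ?_⟩
    exact (hV1.div ((hA.contDiffOn_deriv.of_le (by simp)).comp hU1 hmaps) hA'0).congr hdU
  · have hev : deriv (fun y => A (U y)) =ᶠ[𝓝 x] V := by
      filter_upwards [hJ.mem_nhds hx] with y hy using (h.hasDerivAt_comp hA hy).deriv
    rw [hev.deriv_eq, hdV hx, hdU hx]
    ring

lemma IsProfileOn.congr {A f : ℝ → ℝ} {c : ℝ} {U V U' V' : ℝ → ℝ} {J : Set ℝ} (hJ : IsOpen J)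
    (h : IsProfileOn A f c U V J) (hU : EqOn U' U J) (hV : EqOn V' V J) :
    IsProfileOn A f c U' V' J := fun x hx => by
  obtain ⟨h0, h1, h2⟩ := h x hx
  rw [hU hx, hV hx]
  exact ⟨h0, h1.congr_of_eventuallyEq (mem_of_superset (hJ.mem_nhds hx) hU),
    h2.congr_of_eventuallyEq (mem_of_superset (hJ.mem_nhds hx) hV)⟩

/-- An orbit on an open interval of densities, parametrized by an antiderivative of `-A'/√(2q)`. -/
lemma exists_profile_of_orbit {A f : ℝ → ℝ} (hA : AdmissibleDiffusion A) {c : ℝ} {q X : ℝ → ℝ}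
    {I : Set ℝ} (hI : IsOpen I) (hIc : I.OrdConnected) (hI0 : I ⊆ Ioi 0) (hpos : ∀ u ∈ I, 0 < q u)
    (hq : ∀ u ∈ I, HasDerivAt q (c * √(2 * q u) - fluxReaction A f u) u)
    (hX : ∀ u ∈ I, HasDerivAt X (-(deriv A u / √(2 * q u))) u) :
    ∃ Q : ℝ → ℝ, (∀ u ∈ I, Q (X u) = u) ∧ (∀ x ∉ X '' I, Q x = 0) ∧
      IsProfileOn A f c Q (fun x => -√(2 * q (Q x))) (X '' I) := by
  have hp : ∀ u ∈ I, 0 < √(2 * q u) := fun u hu => Real.sqrt_pos.2 (by linarith [hpos u hu])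
  have hA' : ∀ u ∈ I, 0 < deriv A u := fun u hu => hA.deriv_pos u (hI0 hu)
  obtain ⟨Q, hQ1, hQ0, hQd⟩ := exists_inverse hI hIc hX
    fun u hu => neg_lt_zero.2 (div_pos (hA' u hu) (hp u hu))
  refine ⟨Q, hQ1, hQ0, ?_⟩
  rintro _ ⟨u, hu, rfl⟩
  have hu0 : 0 < u := hI0 hu
  have hpu := (hp u hu).ne'
  have hAu := (hA' u hu).ne'
  have hd1 : HasDerivAt Q (-√(2 * q u) / deriv A u) (X u) := by
    convert! hQd u hu using 1
    rw [← neg_div', inv_neg, inv_div]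
  simp only [hQ1 u hu]
  refine ⟨hu0, hd1, ?_⟩
  have hd2 : HasDerivAt (fun v => √(2 * q v)) (c - fluxReaction A f u / √(2 * q u)) (Q (X u)) := by
    rw [hQ1 u hu]
    have := ((hq u hu).const_mul 2).sqrt (by have := hpos u hu; positivity)
    convert! this using 1
    field_simp
  have := (hd2.comp (X u) hd1).neg
  convert! this using 1
  rw [fluxReaction_of_pos hu0]
  field_simp

/-- The position stays finite at density `0`: if `p ≥ κu`, then `A' / p` is at most `κ⁻¹ A' / u`,
the derivative of `κ⁻¹` times the pressure, so `X + κ⁻¹ Λ` is nondecreasing and the decreasing `X`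
is bounded near `0`. -/
lemma tendsto_nhdsGT_of_antitone_of_lower {A : ℝ → ℝ} (hA : AdmissibleDiffusion A)
    {p X : ℝ → ℝ} {r κ : ℝ} (hr : 0 < r) (hκ : 0 < κ) (hp : ∀ u ∈ Ioo 0 r, κ * u ≤ p u)
    (hX : ∀ u ∈ Ioo 0 r, HasDerivAt X (-(deriv A u / p u)) u) :
    ∃ l, Tendsto X (𝓝[>] 0) (𝓝 l) := by
  have hp0 : ∀ u ∈ Ioo 0 r, 0 < p u := fun u hu => (mul_pos hκ hu.1).trans_le (hp u hu)
  have hanti := strictAntiOn_of_hasDerivAt_neg ordConnected_Ioo hX fun u hu =>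
    neg_lt_zero.2 (div_pos (hA.deriv_pos u hu.1) (hp0 u hu))
  have hmono : MonotoneOn (fun u => X u + κ⁻¹ * pressure A u) (Ioo 0 r) := by
    have hd : ∀ u ∈ Ioo 0 r, HasDerivAt (fun u => X u + κ⁻¹ * pressure A u)
        (-(deriv A u / p u) + κ⁻¹ * (deriv A u / u)) u := fun u hu =>
      (hX u hu).add ((hA.hasDerivAt_pressure hu.1).const_mul _)
    refine monotoneOn_of_deriv_nonneg (convex_Ioo 0 r)
      (fun u hu => (hd u hu).continuousAt.continuousWithinAt)
      (fun u hu => (hd u (interior_subset hu)).differentiableAt.differentiableWithinAt)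
      fun u hu => ?_
    rw [interior_Ioo] at hu
    rw [(hd u hu).deriv]
    have h1 : deriv A u / p u ≤ deriv A u / (κ * u) :=
      div_le_div_of_nonneg_left (hA.deriv_pos u hu.1).le (mul_pos hκ hu.1) (hp u hu)
    have h2 : κ⁻¹ * (deriv A u / u) = deriv A u / (κ * u) := by
      have := hu.1.ne'
      field_simp
    linarith
  have hu0 : r / 2 ∈ Ioo 0 r := ⟨half_pos hr, half_lt_self hr⟩
  have hbdd : BddBelow ((fun u => - X u) '' Ioo 0 (r / 2)) := by
    refine ⟨-(X (r / 2) + κ⁻¹ * pressure A (r / 2)), ?_⟩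
    rintro _ ⟨u, hu, rfl⟩
    have h1 := hmono ⟨hu.1, hu.2.trans hu0.2⟩ hu0 hu.2.le
    have h2 : 0 ≤ κ⁻¹ * pressure A u :=
      mul_nonneg (inv_nonneg.2 hκ.le) (hA.pressure_nonneg hu.1.le)
    simp only at h1 ⊢
    linarith
  have hm : MonotoneOn (fun u => - X u) (Ioo 0 (r / 2)) := fun u hu v hv huv =>
    neg_le_neg (hanti.antitoneOn ⟨hu.1, hu.2.trans hu0.2⟩ ⟨hv.1, hv.2.trans hu0.2⟩ huv)
  have := (hm.tendsto_nhdsWithin_Ioo_right (nonempty_Ioo.2 hu0.1) hbdd).neg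
  exact ⟨_, by simpa using this⟩

/-! ### Parametrization of orbits issuing from the origin -/

/-- `X` parametrizes by position the orbit `q` over an initial segment `I` of densities, with the
density `0` reached at the position `0`; `Q` is the inverse function, extended by zero. -/
structure IsParametrization (A f : ℝ → ℝ) (c : ℝ) (q : ℝ → ℝ) (I : Set ℝ) (X Q : ℝ → ℝ) :
    Prop where
  hasDerivAt : ∀ u ∈ I, HasDerivAt X (-(deriv A u / √(2 * q u))) u
  anti : StrictAntiOn X I
  isOpen_image : IsOpen (X '' I)
  tail : ∀ u ∈ I, Ioo (X u) 0 ⊆ X '' I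
  neg : ∀ u ∈ I, X u < 0
  inv : ∀ u ∈ I, Q (X u) = u
  zero : ∀ x ∉ X '' I, Q x = 0
  profile : IsProfileOn A f c Q (fun x => -√(2 * q (Q x))) (X '' I)

lemma exists_parametrization {A f : ℝ → ℝ} (hA : AdmissibleDiffusion A) {c κ r : ℝ} {q : ℝ → ℝ}
    {I : Set ℝ} (hI : IsOpen I) (hI0 : I ⊆ Ioi 0) (hinit : ∀ u ∈ I, Ioc 0 u ⊆ I) (hne : I.Nonempty)
    (hpos : ∀ u ∈ I, 0 < q u)
    (hq : ∀ u ∈ I, HasDerivAt q (c * √(2 * q u) - fluxReaction A f u) u)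
    (hr : 0 < r) (hκ : 0 < κ) (hlow : ∀ u ∈ Ioo 0 r, u ∈ I → κ * u ≤ √(2 * q u)) :
    ∃ X Q : ℝ → ℝ, IsParametrization A f c q I X Q := by
  have hIc : I.OrdConnected := ⟨fun a ha b hb x hx => hinit b hb ⟨(hI0 ha).trans_le hx.1, hx.2⟩⟩
  have hp : ∀ u ∈ I, 0 < √(2 * q u) := fun u hu => Real.sqrt_pos.2 (by linarith [hpos u hu])
  obtain ⟨Y, hY⟩ := exists_hasDerivAt_of_continuousOn hI hIc
    (g := fun u => -(deriv A u / √(2 * q u))) fun u hu =>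
      (((hA.continuousAt_deriv (hI0 hu)).div
        (Real.continuous_sqrt.continuousAt.comp ((hq u hu).continuousAt.const_mul 2))
        (hp u hu).ne').neg).continuousWithinAt
  obtain ⟨u₁, hu₁⟩ := hne
  have hm : 0 < min r u₁ := lt_min hr (hI0 hu₁)
  have hmI : ∀ u ∈ Ioo 0 (min r u₁), u ∈ I := fun u hu =>
    hinit u₁ hu₁ ⟨hu.1, hu.2.le.trans (min_le_right _ _)⟩
  obtain ⟨l, hl⟩ := tendsto_nhdsGT_of_antitone_of_lower hA hm hκ
    (fun u hu => hlow u ⟨hu.1, hu.2.trans_le (min_le_left _ _)⟩ (hmI u hu))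
    fun u hu => hY u (hmI u hu)
  set X : ℝ → ℝ := fun u => Y u - l with hXdef
  have hX : ∀ u ∈ I, HasDerivAt X (-(deriv A u / √(2 * q u))) u := fun u hu => (hY u hu).sub_const l
  have hXneg : ∀ u ∈ I, -(deriv A u / √(2 * q u)) < 0 := fun u hu =>
    neg_lt_zero.2 (div_pos (hA.deriv_pos u (hI0 hu)) (hp u hu))
  have hanti := strictAntiOn_of_hasDerivAt_neg hIc hX hXneg
  have hlim : Tendsto X (𝓝[>] 0) (𝓝 0) := by simpa using hl.sub_const l
  have hev : ∀ u ∈ I, ∀ᶠ v in 𝓝[>] (0 : ℝ), v ∈ I ∧ v < u := fun u hu => by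
    filter_upwards [Ioo_mem_nhdsGT (hI0 hu)] with v hv using ⟨hinit u hu ⟨hv.1, hv.2.le⟩, hv.2⟩
  have hle : ∀ u ∈ I, X u ≤ 0 := fun u hu => by
    refine ge_of_tendsto hlim ?_
    filter_upwards [hev u hu] with v hv using (hanti hv.1 hu hv.2).le
  have hneg : ∀ u ∈ I, X u < 0 := fun u hu => by
    obtain ⟨v, hv⟩ := (hev u hu).exists
    exact (hanti hv.1 hu hv.2).trans_le (hle v hv.1)
  obtain ⟨Q, hQ1, hQ0, hQ⟩ := exists_profile_of_orbit hA hI hIc hI0 hpos hq hX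
  refine ⟨X, Q, hX, hanti, isOpen_image_of_hasDerivAt_neg hI hIc hX hXneg, fun u hu x hx => ?_,
    hneg, hQ1, hQ0, hQ⟩
  obtain ⟨v, hv, hvI⟩ := ((hlim.eventually_const_lt hx.2).and (hev u hu)).exists
  exact (ordConnected_image_of_hasDerivAt hIc hX).out ⟨u, hu, rfl⟩ ⟨v, hvI.1, rfl⟩ ⟨hx.1.le, hv.le⟩

namespace IsParametrization

variable {A f : ℝ → ℝ} {c : ℝ} {q X Q : ℝ → ℝ} {I : Set ℝ}

lemma Q_nonneg (h : IsParametrization A f c q I X Q) (x : ℝ) : 0 ≤ Q x := by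
  by_cases hx : x ∈ X '' I
  · exact (h.profile x hx).1.le
  · exact (h.zero x hx).ge

lemma Q_of_nonneg (h : IsParametrization A f c q I X Q) {x : ℝ} (hx : 0 ≤ x) : Q x = 0 :=
  h.zero x (by rintro ⟨u, hu, rfl⟩; exact absurd (h.neg u hu) (not_lt.2 hx))

lemma Q_lt (h : IsParametrization A f c q I X Q) {u x : ℝ} (hu : u ∈ I) (hx : x ∈ Ioo (X u) 0) :
    Q x < u := by
  obtain ⟨v, hv, rfl⟩ := h.tail u hu hx
  rw [h.inv v hv]
  exact (h.anti.lt_iff_gt hu hv).1 hx.1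

lemma tendsto_nhdsLT (h : IsParametrization A f c q I X Q) (hinit : ∀ u ∈ I, Ioc 0 u ⊆ I)
    (hI0 : I ⊆ Ioi 0) (hne : I.Nonempty) : Tendsto Q (𝓝[<] 0) (𝓝[>] 0) := by
  obtain ⟨u₀, hu₀⟩ := hne
  refine tendsto_nhdsWithin_iff.2 ⟨?_, ?_⟩
  · rw [Metric.tendsto_nhds]
    intro ε hε
    have hu : min ε u₀ ∈ I := hinit u₀ hu₀ ⟨lt_min hε (hI0 hu₀), min_le_right _ _⟩
    filter_upwards [Ioo_mem_nhdsLT (h.neg _ hu)] with x hx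
    rw [Real.dist_eq, sub_zero, abs_of_nonneg (h.Q_nonneg x)]
    exact (h.Q_lt hu hx).trans_le (min_le_left _ _)
  · filter_upwards [Ioo_mem_nhdsLT (h.neg _ hu₀)] with x hx
    exact (h.profile x (h.tail _ hu₀ hx)).1

lemma continuousAt_zero (h : IsParametrization A f c q I X Q) (hinit : ∀ u ∈ I, Ioc 0 u ⊆ I)
    (hI0 : I ⊆ Ioi 0) (hne : I.Nonempty) : ContinuousAt Q 0 := by
  rw [continuousAt_iff_continuous_left'_right']
  constructor
  · rw [ContinuousWithinAt, h.Q_of_nonneg le_rfl]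
    exact (h.tendsto_nhdsLT hinit hI0 hne).mono_right nhdsWithin_le_nhds
  · refine (continuousWithinAt_const (b := (0 : ℝ))).congr (fun x hx => ?_) (h.Q_of_nonneg le_rfl)
    exact h.Q_of_nonneg (le_of_lt hx)

/-- The pressure has derivative `V / Q`, which at density `u` is `-√(2q) / u`; its slope at the free
boundary is therefore read off from the orbit at the origin. -/
lemma hasLeftDeriv (h : IsParametrization A f c q I X Q) (hA : AdmissibleDiffusion A)
    (hinit : ∀ u ∈ I, Ioc 0 u ⊆ I) (hI0 : I ⊆ Ioi 0) (hne : I.Nonempty) {m : EReal}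
    (hm : Tendsto (fun u => ((-√(2 * q u) / u : ℝ) : EReal)) (𝓝[>] 0) (𝓝 m)) :
    HasLeftDeriv (fun x => pressure A (Q x)) 0 m := by
  have hQlim := h.tendsto_nhdsLT hinit hI0 hne
  obtain ⟨u₀, hu₀⟩ := hne
  have hsub := h.tail u₀ hu₀
  have hd : ∀ x ∈ Ioo (X u₀) 0, HasDerivAt (fun x => pressure A (Q x)) (-√(2 * q (Q x)) / Q x) x :=
    fun x hx => h.profile.hasDerivAt_pressure hA (hsub hx)
  refine hasLeftDeriv_of_tendsto (h.neg u₀ hu₀) (fun x hx => ?_) hd (hm.comp hQlim)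
  rcases hx.2.lt_or_eq with hx0 | rfl
  · exact (hd x ⟨hx.1, hx0⟩).continuousAt.continuousWithinAt
  · have h0 : Q 0 = 0 := h.Q_of_nonneg le_rfl
    have h1 : Tendsto Q (𝓝 0) (𝓝[≥] 0) := tendsto_nhdsWithin_iff.2
      ⟨by have := h.continuousAt_zero hinit hI0 ⟨u₀, hu₀⟩; rwa [ContinuousAt, h0] at this,
        Eventually.of_forall h.Q_nonneg⟩
    have h2 : ContinuousAt (fun x => pressure A (Q x)) 0 := by
      have := hA.tendsto_pressure.comp h1
      rw [ContinuousAt, h0, AdmissibleDiffusion.pressure_zero]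
      exact this
    exact h2.continuousWithinAt

end IsParametrization

/-! ### Behavior of the parametrization at the far end -/

lemma tendsto_atTop_of_deriv_le {Y Y' : ℝ → ℝ} {r κ : ℝ} (hr : 0 < r) (hκ : 0 < κ)
    (hd : ∀ t ∈ Ioo 0 r, HasDerivAt Y (Y' t) t) (hle : ∀ t ∈ Ioo 0 r, Y' t ≤ -(κ / t)) :
    Tendsto Y (𝓝[>] 0) atTop := by
  have hd2 : ∀ t ∈ Ioo 0 r, HasDerivAt (fun t => Y t + κ * Real.log t) (Y' t + κ * t⁻¹) t :=
    fun t ht => (hd t ht).add ((Real.hasDerivAt_log ht.1.ne').const_mul κ)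
  have hanti : AntitoneOn (fun t => Y t + κ * Real.log t) (Ioo 0 r) := by
    refine antitoneOn_of_deriv_nonpos (convex_Ioo 0 r)
      (fun u hu => (hd2 u hu).continuousAt.continuousWithinAt)
      (fun u hu => (hd2 u (interior_subset hu)).differentiableAt.differentiableWithinAt)
      fun u hu => ?_
    rw [interior_Ioo] at hu
    rw [(hd2 u hu).deriv, ← div_eq_mul_inv]
    linarith [hle u hu]
  have ht0 : r / 2 ∈ Ioo 0 r := ⟨half_pos hr, half_lt_self hr⟩
  have hlog : Tendsto (fun t => (Y (r / 2) + κ * Real.log (r / 2)) + κ * (-Real.log t)) (𝓝[>] 0)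
      atTop := tendsto_atTop_add_const_left _ _
        ((tendsto_neg_atBot_atTop.comp Real.tendsto_log_nhdsGT_zero).const_mul_atTop hκ)
  refine tendsto_atTop_mono' _ ?_ hlog
  filter_upwards [Ioo_mem_nhdsGT ht0.1] with t ht
  have := hanti ⟨ht.1, ht.2.trans ht0.2⟩ ht0 ht.2.le
  simp only at this
  linarith

/-- A flux at most linear in the distance to the state `s` makes `A' / p` non-integrable like `1 /
t`, so the state is reached only at infinity. The sign `σ` selects the side of approach. -/
lemma tendsto_atTop_of_speed_le {A : ℝ → ℝ} (hA : AdmissibleDiffusion A) {p Y : ℝ → ℝ}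
    {s M r σ : ℝ} (hs : 0 < s) (hr : 0 < r) (hM : 0 < M)
    (hp : ∀ t ∈ Ioo 0 r, 0 < p t ∧ p t ≤ M * t)
    (hd : ∀ t ∈ Ioo 0 r, HasDerivAt Y (-(deriv A (s + σ * t) / p t)) t) :
    Tendsto Y (𝓝[>] 0) atTop := by
  have hcont : Tendsto (fun t => deriv A (s + σ * t)) (𝓝[>] 0) (𝓝 (deriv A s)) := by
    have h1 : Tendsto (fun t : ℝ => s + σ * t) (𝓝[>] 0) (𝓝 s) := by
      have : Continuous fun t : ℝ => s + σ * t := by fun_prop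
      simpa using (this.tendsto 0).mono_left nhdsWithin_le_nhds
    exact (hA.continuousAt_deriv hs).tendsto.comp h1
  have hA0 := hA.deriv_pos s hs
  obtain ⟨r', hr', hsub⟩ := mem_nhdsGT_iff_exists_Ioo_subset.1
    (hcont.eventually_const_lt (half_lt_self hA0))
  refine tendsto_atTop_of_deriv_le (lt_min hr hr') (κ := deriv A s / 2 / M) (by positivity)
    (fun t ht => hd t ⟨ht.1, ht.2.trans_le (min_le_left _ _)⟩) fun t ht => neg_le_neg ?_
  obtain ⟨h1, h2⟩ := hp t ⟨ht.1, ht.2.trans_le (min_le_left _ _)⟩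
  have h3 : deriv A s / 2 < deriv A (s + σ * t) := hsub ⟨ht.1, ht.2.trans_le (min_le_right _ _)⟩
  rw [div_div]
  exact div_le_div₀ (by linarith) h3.le h1 h2

/-- Since `q' ≥ -h ≥ -K (s - u)` and `q(s) = 0`, integration gives `q ≤ K (s - u)² / 2`. -/
lemma IsOrbit.sqrt_le_of_right {h : ℝ → ℝ} {c a s K r : ℝ} {q : ℝ → ℝ} (hq : IsOrbit h c a s q)
    (hc : 0 ≤ c) (hqs : q s = 0) (hK : 0 ≤ K)
    (hh : ∀ u ∈ Ioo (s - r) (s + r), |h u| ≤ K * |u - s|) (hr : 0 < r) {u : ℝ}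
    (hu : u ∈ Ioo (s - r) s) (hua : a ≤ u) : √(2 * q u) ≤ √K * (s - u) := by
  have hsub := hq.mono hua le_rfl
  have key := backward_bound (D := fun x => q x - K * (s - x) ^ 2 / 2)
    (D' := fun x => (c * √(2 * q x) - h x) + K * (s - x)) (le_refl (0 : ℝ))
    (hsub.cont.sub (by fun_prop)) (fun x hx => by
      have h1 := ((((hasDerivAt_id x).const_sub s).pow 2).const_mul K).div_const 2
      convert! (hsub.deriv x hx).sub h1 using 1
      simp; ring) (fun x hx _ => by
      have h1 := mul_nonneg hc (Real.sqrt_nonneg (2 * q x))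
      have h2 := (le_abs_self _).trans (hh x ⟨hu.1.trans hx.1, by linarith [hx.2]⟩)
      rw [abs_of_neg (by linarith [hx.2])] at h2
      linarith) (left_mem_Icc.2 hu.2.le)
  simp only [hqs, sub_self] at key
  norm_num at key
  refine Real.sqrt_le_iff.2 ⟨mul_nonneg (Real.sqrt_nonneg _) (by linarith [hu.2]), ?_⟩
  rw [mul_pow, Real.sq_sqrt hK]
  linarith

/-- Here the bound runs forward from `a`, on the flux itself: above the line of slope `c + K + 1 ≥
1` one has `x - a ≤ √(2q)`, so `-h / √(2q) ≤ K` and the flux grows with slope at most `c + K`. -/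
lemma IsOrbit.sqrt_le_of_left {h : ℝ → ℝ} {c a b K r : ℝ} {q : ℝ → ℝ} (hq : IsOrbit h c a b q)
    (hc : 0 ≤ c) (hqa : q a = 0) (hK : 0 ≤ K) (hpos : ∀ u ∈ Ioo a b, 0 < q u)
    (hh : ∀ u ∈ Ioo (a - r) (a + r), |h u| ≤ K * |u - a|) (hr : 0 < r) {u : ℝ}
    (hu : u ∈ Ioo a (a + r)) (hub : u ≤ b) : √(2 * q u) ≤ (c + K + 1) * (u - a) := by
  have hsub := hq.mono le_rfl hub
  have key := forward_bound (a := a) (b := u) (D := fun x => √(2 * q x) - (c + K + 1) * (x - a))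
    (D' := fun x => (c - h x / √(2 * q x)) - (c + K + 1))
    ((Real.continuous_sqrt.comp_continuousOn (hsub.cont.const_smul (2 : ℝ))).sub (by fun_prop))
    (fun x hx => by
      have h1 := ((hasDerivAt_id x).sub_const a).const_mul (c + K + 1)
      rw [mul_one] at h1
      exact (hsub.hasDerivAt_sqrt hx (hpos x ⟨hx.1, hx.2.trans_le hub⟩)).sub h1)
    (fun x hx hx0 => by
      have hp : 0 < √(2 * q x) :=
        Real.sqrt_pos.2 (by linarith [hpos x ⟨hx.1, hx.2.trans_le hub⟩])
      have hxa : 0 < x - a := sub_pos.2 hx.1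
      have h2 := neg_le_of_abs_le (hh x ⟨by linarith [hx.1], by linarith [hx.2, hu.2]⟩)
      rw [abs_of_pos hxa] at h2
      have h3 : -(h x / √(2 * q x)) ≤ K := by
        rw [← neg_div, div_le_iff₀ hp]
        have : K * (x - a) ≤ K * √(2 * q x) := by
          refine mul_le_mul_of_nonneg_left ?_ hK
          have : x - a ≤ (c + K + 1) * (x - a) := by nlinarith
          linarith
        linarith
      linarith) (right_mem_Icc.2 hu.1.le)
  simp only [hqa, mul_zero, Real.sqrt_zero, sub_self, max_self] at key
  linarith

/-! ### Existence of sharp and monotone waves -/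

lemma continuous_comp_of_nonneg {F Q : ℝ → ℝ} (hF : ContinuousOn F (Ici 0)) (hQ : Continuous Q)
    (h0 : ∀ x, 0 ≤ Q x) : Continuous fun x => F (Q x) :=
  continuousOn_univ.1 (hF.comp hQ.continuousOn fun x _ => h0 x)

/-- A continuous profile whose flux is the derivative of `A(Q)` on the whole line. -/
lemma isTravelingWave_of_flux {A f : ℝ → ℝ} (hfc : ContinuousOn f (Ici 0))
    {c : ℝ} (hc : 0 < c) {Q V : ℝ → ℝ} (hQ : Continuous Q)
    (h0 : ∀ x, 0 ≤ Q x) (hV : Continuous V) (hA : ∀ x, HasDerivAt (fun y => A (Q y)) (V x) x)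
    (hVQ : ∀ x, HasDerivAt (fun y => V y + c * Q y) (-f (Q x)) x) : IsTravelingWave A f c Q :=
  ⟨hc, hQ, h0, fun _ hη hs => integral_weak_eq_zero hA hV hVQ (by fun_prop)
    (continuous_comp_of_nonneg hfc hQ h0) hη hs⟩

lemma IsProfileOn.hasDerivAt_flux_add {A f : ℝ → ℝ} {c : ℝ} {U V : ℝ → ℝ} {J : Set ℝ}
    (h : IsProfileOn A f c U V J) {x : ℝ} (hx : x ∈ J) :
    HasDerivAt (fun y => V y + c * U y) (-f (U x)) x := by
  obtain ⟨-, h1, h2⟩ := h x hx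
  convert! h2.add (h1.const_mul c) using 1
  ring

theorem IsSharpOrbit.exists_wave {A f : ℝ → ℝ} {s₁ s₂ s c : ℝ} (hA : AdmissibleDiffusion A)
    (hf : MonostableBistable A f s₁ s₂) {q : ℝ → ℝ} (hs : 0 < s) (hfs : f s = 0)
    (hq : IsSharpOrbit (fluxReaction A f) s c q) : ∃ Q, IsSharpWave A f s c Q := by
  have hc := hq.speed_pos
  have hI0 : Ioo 0 s ⊆ Ioi 0 := fun u hu => hu.1
  have hinit : ∀ u ∈ Ioo 0 s, Ioc 0 u ⊆ Ioo 0 s := fun u hu v hv => ⟨hv.1, hv.2.trans_lt hu.2⟩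
  have hne : (Ioo 0 s).Nonempty := nonempty_Ioo.2 hs
  obtain ⟨r, hr, hlow⟩ := hq.sharp.eventually_le hc
  obtain ⟨X, Q, hP⟩ := exists_parametrization hA isOpen_Ioo hI0 hinit hne hq.pos hq.orbit.deriv hr
    (half_pos hc) fun u hu _ => hlow u hu
  -- The state `s` is an equilibrium, so it is approached only as the position tends to `-∞`, and
  -- the profile is positive on the whole half-line.
  have hfar : ∀ x, ∃ u ∈ Ioo 0 s, X u < x := by
    obtain ⟨K, hK, r', hr', hb⟩ := MonostableBistable.exists_linear_bound hA hf hs hfs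
    have hm : 0 < min r' s := lt_min hr' hs
    have hmem : ∀ t ∈ Ioo 0 (min r' s), s - t ∈ Ioo 0 s := fun t ht =>
      ⟨by linarith [ht.2.trans_le (min_le_right _ _)], by linarith [ht.1]⟩
    have hY := tendsto_atTop_of_speed_le hA (Y := fun t => -X (s - t))
      (p := fun t => √(2 * q (s - t))) (σ := -1) (M := √K) hs hm (Real.sqrt_pos.2 hK)
      (fun t ht => ⟨Real.sqrt_pos.2 (by linarith [hq.pos _ (hmem t ht)]), by
        have := hq.orbit.sqrt_le_of_right hc.le hq.right hK.le hb hr' (u := s - t)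
          ⟨by linarith [ht.2.trans_le (min_le_left _ _)], by linarith [ht.1]⟩ (hmem t ht).1.le
        simpa using this⟩) (fun t ht => by
        have := ((hP.hasDerivAt _ (hmem t ht)).comp t ((hasDerivAt_id t).const_sub s)).neg
        convert! this using 1
        simp [← sub_eq_add_neg])
    intro x
    obtain ⟨t, ht1, ht2⟩ := ((hY.eventually_gt_atTop (-x)).and (Ioo_mem_nhdsGT hm)).exists
    exact ⟨s - t, hmem t ht2, by linarith⟩
  have himg : ∀ x < 0, x ∈ X '' Ioo 0 s := fun x hx => by
    obtain ⟨u, hu, hux⟩ := hfar x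
    exact hP.tail u hu ⟨hux, hx⟩
  have hQlt : ∀ x < 0, Q x ∈ Ioo 0 s := fun x hx => by
    obtain ⟨u, hu, rfl⟩ := himg x hx
    rwa [hP.inv u hu]
  have hQc : Continuous Q := continuous_iff_continuousAt.2 fun x => by
    rcases lt_trichotomy x 0 with hx | rfl | hx
    · exact (hP.profile x (himg x hx)).2.1.continuousAt
    · exact hP.continuousAt_zero hinit hI0 hne
    · refine (continuousAt_const (y := (0 : ℝ))).congr ?_
      filter_upwards [Ioi_mem_nhds hx] with y hy using (hP.Q_of_nonneg (le_of_lt hy)).symm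
  have hQmem : ∀ x, Q x ∈ Icc 0 s := fun x => by
    rcases lt_or_ge x 0 with hx | hx
    · exact Ioo_subset_Icc_self (hQlt x hx)
    · rw [hP.Q_of_nonneg hx]; exact left_mem_Icc.2 hs.le
  set V : ℝ → ℝ := fun x => -√(2 * q (Q x)) with hV
  have hVc : Continuous V := by
    have : Continuous fun x => q (Q x) :=
      continuousOn_univ.1 (hq.orbit.cont.comp hQc.continuousOn fun x _ => hQmem x)
    exact (Real.continuous_sqrt.comp (this.const_mul 2)).neg
  have hAQ : Continuous fun x => A (Q x) :=
    continuous_comp_of_nonneg hA.continuousOn hQc hP.Q_nonneg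
  have hfQ : Continuous fun x => -f (Q x) :=
    (continuous_comp_of_nonneg hf.contDiffOn.continuousOn hQc hP.Q_nonneg).neg
  have hzero : ∀ x, 0 < x → ∀ᶠ y in 𝓝 x, Q y = 0 := fun x hx => by
    filter_upwards [Ioi_mem_nhds hx] with y hy using hP.Q_of_nonneg (le_of_lt hy)
  have hVzero : ∀ y, Q y = 0 → V y = 0 := fun y hy => by simp [hV, hy, hq.left]
  -- The identities hold on both sides of the free boundary and the candidate derivatives are
  -- continuous there, so they extend across `0`; no extra term arises in the weak equation.
  have hA' : ∀ x, HasDerivAt (fun y => A (Q y)) (V x) x :=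
    hasDerivAt_of_hasDerivAt_of_ne' (x := 0) (fun x hx => by
      rcases hx.lt_or_gt with hx | hx
      · exact hP.profile.hasDerivAt_comp hA (himg x hx)
      · rw [hVzero x (hP.Q_of_nonneg hx.le)]
        refine (hasDerivAt_const x (A 0)).congr_of_eventuallyEq ?_
        filter_upwards [hzero x hx] with y hy
        rw [hy]) hAQ.continuousAt hVc.continuousAt
  have hVQ : ∀ x, HasDerivAt (fun y => V y + c * Q y) (-f (Q x)) x :=
    hasDerivAt_of_hasDerivAt_of_ne' (x := 0) (fun x hx => by
      rcases hx.lt_or_gt with hx | hx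
      · exact hP.profile.hasDerivAt_flux_add (himg x hx)
      · rw [hP.Q_of_nonneg hx.le, hf.f_zero, neg_zero]
        refine (hasDerivAt_const x (0 : ℝ)).congr_of_eventuallyEq ?_
        filter_upwards [hzero x hx] with y hy
        rw [hVzero y hy, hy, mul_zero, add_zero]) (hVc.add (hQc.const_mul c)).continuousAt
        hfQ.continuousAt
  refine ⟨Q, isTravelingWave_of_flux hf.contDiffOn.continuousOn hc hQc hP.Q_nonneg
    hVc hA' hVQ, ?_, fun x hx => hP.Q_of_nonneg hx, fun x hx => ?_, ?_⟩
  · rw [Metric.tendsto_nhds]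
    intro ε hε
    obtain ⟨u, hu1, hu2⟩ := exists_between (show max 0 (s - ε) < s from max_lt hs (by linarith))
    have hu : u ∈ Ioo 0 s := ⟨(le_max_left _ _).trans_lt hu1, hu2⟩
    filter_upwards [Iio_mem_atBot (X u)] with x hx
    obtain ⟨v, hv, rfl⟩ := himg x (lt_trans hx (hP.neg u hu))
    have huv : u < v := (hP.anti.lt_iff_gt hv hu).1 hx
    have := (le_max_right 0 (s - ε)).trans_lt hu1
    rw [hP.inv v hv, Real.dist_eq, abs_of_neg (by linarith [hv.2])]
    linarith
  · obtain ⟨h0, h1, -⟩ := hP.profile x (himg x hx)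
    rw [h1.deriv]
    exact div_neg_of_neg_of_pos (neg_lt_zero.2 (Real.sqrt_pos.2 (by linarith [hq.pos _ (hQlt x hx)])))
      (hA.deriv_pos _ h0)
  · refine hP.hasLeftDeriv hA hinit hI0 hne ?_
    refine (continuous_coe_real_ereal.tendsto _).comp ?_
    simpa only [neg_div] using hq.sharp.neg

/-- Both end states are positive equilibria, so `X` covers the whole line and the inverse profile is
smooth enough everywhere; there is no free boundary to treat. -/
theorem IsFrontOrbit.exists_wave {A f : ℝ → ℝ} {s₁ s₂ a b c : ℝ} (hA : AdmissibleDiffusion A)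
    (hf : MonostableBistable A f s₁ s₂) {q : ℝ → ℝ} (ha : 0 < a) (hab : a < b) (hfa : f a = 0)
    (hfb : f b = 0) (hq : IsFrontOrbit (fluxReaction A f) a b c q) :
    ∃ Q, IsMonotoneWave A f b a c Q := by
  have hc := hq.speed_pos
  have hI0 : Ioo a b ⊆ Ioi 0 := fun u hu => ha.trans hu.1
  have hb := ha.trans hab
  have hp : ∀ u ∈ Ioo a b, 0 < √(2 * q u) := fun u hu => Real.sqrt_pos.2 (by linarith [hq.pos u hu])
  obtain ⟨X, hX⟩ := exists_hasDerivAt_of_continuousOn (I := Ioo a b) isOpen_Ioo ordConnected_Ioo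
    (g := fun u => -(deriv A u / √(2 * q u))) fun u hu =>
      (((hA.continuousAt_deriv (hI0 hu)).div
        (Real.continuous_sqrt.continuousAt.comp ((hq.orbit.deriv u hu).continuousAt.const_mul 2))
        (hp u hu).ne').neg).continuousWithinAt
  have hanti := strictAntiOn_of_hasDerivAt_neg ordConnected_Ioo hX fun u hu =>
    neg_lt_zero.2 (div_pos (hA.deriv_pos u (hI0 hu)) (hp u hu))
  obtain ⟨Q, hQ1, -, hQ⟩ := exists_profile_of_orbit hA isOpen_Ioo ordConnected_Ioo hI0 hq.pos
    hq.orbit.deriv hX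
  have hbot : ∀ x, ∃ u ∈ Ioo a b, X u < x := by
    obtain ⟨K, hK, r', hr', hbd⟩ := MonostableBistable.exists_linear_bound hA hf hb hfb
    have hm : 0 < min r' (b - a) := lt_min hr' (by linarith)
    have hmem : ∀ t ∈ Ioo 0 (min r' (b - a)), b - t ∈ Ioo a b := fun t ht =>
      ⟨by linarith [ht.2.trans_le (min_le_right _ _)], by linarith [ht.1]⟩
    have hY := tendsto_atTop_of_speed_le hA (Y := fun t => -X (b - t))
      (p := fun t => √(2 * q (b - t))) (σ := -1) (M := √K) hb hm (Real.sqrt_pos.2 hK)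
      (fun t ht => ⟨hp _ (hmem t ht), by
        have := hq.orbit.sqrt_le_of_right hc.le hq.right hK.le hbd hr' (u := b - t)
          ⟨by linarith [ht.2.trans_le (min_le_left _ _)], by linarith [ht.1]⟩ (hmem t ht).1.le
        simpa using this⟩) (fun t ht => by
        have := ((hX _ (hmem t ht)).comp t ((hasDerivAt_id t).const_sub b)).neg
        convert! this using 1
        simp [← sub_eq_add_neg])
    intro x
    obtain ⟨t, ht1, ht2⟩ := ((hY.eventually_gt_atTop (-x)).and (Ioo_mem_nhdsGT hm)).exists
    exact ⟨b - t, hmem t ht2, by linarith⟩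
  have htop : ∀ x, ∃ u ∈ Ioo a b, x < X u := by
    obtain ⟨K, hK, r', hr', hbd⟩ := MonostableBistable.exists_linear_bound hA hf ha hfa
    have hm : 0 < min r' (b - a) := lt_min hr' (by linarith)
    have hmem : ∀ t ∈ Ioo 0 (min r' (b - a)), a + t ∈ Ioo a b := fun t ht =>
      ⟨by linarith [ht.1], by linarith [ht.2.trans_le (min_le_right _ _)]⟩
    have hY := tendsto_atTop_of_speed_le hA (Y := fun t => X (a + t))
      (p := fun t => √(2 * q (a + t))) (σ := 1) (M := c + K + 1) ha hm (by linarith)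
      (fun t ht => ⟨hp _ (hmem t ht), by
        have := hq.orbit.sqrt_le_of_left hc.le hq.left hK.le hq.pos hbd hr' (u := a + t)
          ⟨by linarith [ht.1], by linarith [ht.2.trans_le (min_le_left _ _)]⟩ (hmem t ht).2.le
        simpa using this⟩) (fun t ht => by
        have := ((hX _ (hmem t ht)).comp t ((hasDerivAt_id t).const_add a))
        convert! this using 1
        simp)
    intro x
    obtain ⟨t, ht1, ht2⟩ := ((hY.eventually_gt_atTop x).and (Ioo_mem_nhdsGT hm)).exists
    exact ⟨a + t, hmem t ht2, ht1⟩
  have himg : ∀ x, x ∈ X '' Ioo a b := fun x => by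
    obtain ⟨u, hu, hux⟩ := hbot x
    obtain ⟨v, hv, hvx⟩ := htop x
    exact (ordConnected_image_of_hasDerivAt ordConnected_Ioo hX).out ⟨u, hu, rfl⟩ ⟨v, hv, rfl⟩
      ⟨hux.le, hvx.le⟩
  have hQmem : ∀ x, Q x ∈ Ioo a b := fun x => by
    obtain ⟨u, hu, rfl⟩ := himg x
    rwa [hQ1 u hu]
  have hQc : Continuous Q := continuous_iff_continuousAt.2 fun x => (hQ x (himg x)).2.1.continuousAt
  have hVc : Continuous fun x => -√(2 * q (Q x)) :=
    continuous_iff_continuousAt.2 fun x => (hQ x (himg x)).2.2.continuousAt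
  refine ⟨Q, isTravelingWave_of_flux hf.contDiffOn.continuousOn hc hQc
    (fun x => (hI0 (hQmem x)).le) hVc (fun x => hQ.hasDerivAt_comp hA (himg x))
    (fun x => hQ.hasDerivAt_flux_add (himg x)), ?_, ?_, fun x => ?_⟩
  · rw [Metric.tendsto_nhds]
    intro ε hε
    obtain ⟨u, hu1, hu2⟩ := exists_between (show max a (b - ε) < b from max_lt hab (by linarith))
    have hu : u ∈ Ioo a b := ⟨(le_max_left _ _).trans_lt hu1, hu2⟩
    filter_upwards [Iio_mem_atBot (X u)] with x hx
    obtain ⟨v, hv, rfl⟩ := himg x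
    have huv : u < v := (hanti.lt_iff_gt hv hu).1 hx
    have := (le_max_right a (b - ε)).trans_lt hu1
    rw [hQ1 v hv, Real.dist_eq, abs_of_neg (by linarith [hv.2])]
    linarith
  · rw [Metric.tendsto_nhds]
    intro ε hε
    obtain ⟨u, hu1, hu2⟩ := exists_between (show a < min b (a + ε) from lt_min hab (by linarith))
    have hu : u ∈ Ioo a b := ⟨hu1, hu2.trans_le (min_le_left _ _)⟩
    filter_upwards [Ioi_mem_atTop (X u)] with x hx
    obtain ⟨v, hv, rfl⟩ := himg x
    have huv : v < u := (hanti.lt_iff_gt hu hv).1 hx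
    have := hu2.trans_le (min_le_right b (a + ε))
    rw [hQ1 v hv, Real.dist_eq, abs_of_pos (by linarith [hv.1])]
    linarith
  · obtain ⟨h0, h1, -⟩ := hQ x (himg x)
    rw [h1.deriv]
    exact div_neg_of_neg_of_pos (neg_lt_zero.2 (hp _ (hQmem x))) (hA.deriv_pos _ h0)

/-! ### Blow-up profiles -/

theorem exists_blowUpProfile {A f : ℝ → ℝ} {s₁ s₂ c : ℝ} (hA : AdmissibleDiffusion A)
    (hf : MonostableBistable A f s₁ s₂) {q : ℝ → ℝ} (hc : 0 < c) (hpos : ∀ u, 0 < u → 0 < q u)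
    (hq : ∀ u, 0 < u → HasDerivAt q (c * √(2 * q u) - fluxReaction A f u) u)
    (hsharp : IsSharpAtZero c q) : ∃ (L : EReal) (U : ℝ → ℝ), IsBlowUpProfile A f c L U := by
  have hinit : ∀ u ∈ Ioi (0 : ℝ), Ioc 0 u ⊆ Ioi 0 := fun u _ v hv => hv.1
  have hne : (Ioi (0 : ℝ)).Nonempty := ⟨1, mem_Ioi.2 one_pos⟩
  obtain ⟨r, hr, hlow⟩ := hsharp.eventually_le hc
  obtain ⟨X, Q, hP⟩ := exists_parametrization hA isOpen_Ioi subset_rfl hinit hne hpos hq hr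
    (half_pos hc) fun u hu _ => hlow u hu
  -- The infimum of the positions is the blow-up point. It may be `-∞`, and the length is `L = -ℓ`,
  -- whence the double negations below.
  set ℓ : EReal := sInf ((fun u => ((X u : ℝ) : EReal)) '' Ioi 0) with hℓ
  have hlt : ∀ x : ℝ, - -ℓ < (x : EReal) ↔ ∃ u, 0 < u ∧ X u < x := fun x => by
    rw [neg_neg, hℓ, sInf_lt_iff]
    simp
  have himg : ∀ x : ℝ, - -ℓ < (x : EReal) → x < 0 → x ∈ X '' Ioi 0 := fun x hx hx0 => by
    obtain ⟨u, hu, hux⟩ := (hlt x).1 hx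
    exact hP.tail u hu ⟨hux, hx0⟩
  have hset : {x : ℝ | - -ℓ < (x : EReal) ∧ x < 0} = X '' Ioi 0 := by
    ext x
    refine ⟨fun hx => himg x hx.1 hx.2, ?_⟩
    rintro ⟨u, hu, rfl⟩
    exact ⟨(hlt _).2 ⟨u + 1, by linarith [mem_Ioi.1 hu], hP.anti hu
      (by linarith [mem_Ioi.1 hu] : (0 : ℝ) < u + 1) (by linarith)⟩, hP.neg u hu⟩
  have hcl := hP.profile.isClassical hA hf.contDiffOn.continuousOn hP.isOpen_image
  refine ⟨-ℓ, Q, ?_, fun x hx => ?_, fun x hx hx0 => (hP.profile x (himg x hx hx0)).1,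
    fun x hx => hP.Q_of_nonneg hx, ?_, fun M => ?_, ?_⟩
  · have : - -ℓ < ((0 : ℝ) : EReal) := (hlt 0).2 ⟨1, one_pos, hP.neg 1 (mem_Ioi.2 one_pos)⟩
    rw [EReal.coe_zero] at this
    exact EReal.neg_lt_zero.1 this
  · rcases lt_trichotomy x 0 with hx0 | rfl | hx0
    · exact (hP.profile x (himg x hx hx0)).2.1.continuousAt.continuousWithinAt
    · exact (hP.continuousAt_zero hinit subset_rfl hne).continuousWithinAt
    · refine ((continuousAt_const (y := (0 : ℝ))).congr ?_).continuousWithinAt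
      filter_upwards [Ioi_mem_nhds hx0] with y hy using (hP.Q_of_nonneg (le_of_lt hy)).symm
  · rw [hset]; exact hcl
  · have hM : 0 < max M 1 := lt_max_of_lt_right one_pos
    refine ⟨X (max M 1), (hlt _).2 ⟨max M 1 + 1, by linarith, hP.anti hM
      (by linarith : (0 : ℝ) < max M 1 + 1) (by linarith)⟩, fun x hx hxM => ?_⟩
    obtain ⟨v, hv, rfl⟩ := himg x hx (hxM.trans (hP.neg _ hM))
    rw [hP.inv v hv]
    exact (le_max_left _ _).trans_lt ((hP.anti.lt_iff_gt hv hM).1 hxM)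
  · refine ⟨((-c : ℝ) : EReal), hP.hasLeftDeriv hA hinit subset_rfl hne ?_, le_rfl⟩
    refine (continuous_coe_real_ereal.tendsto _).comp ?_
    simpa only [neg_div] using hsharp.neg

/-! ### Compactly supported profiles -/

/-- Used at the maximum of a compactly supported profile, where two branches are glued. -/
lemma hasDerivAt_of_hasDerivAt_of_ne_local {F G : ℝ → ℝ} {a b m : ℝ} (hm : m ∈ Ioo a b)
    (hd : ∀ x ∈ Ioo a b, x ≠ m → HasDerivAt F (G x) x) (hF : ContinuousAt F m)
    (hG : ContinuousAt G m) : HasDerivAt F (G m) m := by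
  have hr : HasDerivWithinAt F (G m) (Ici m) m := by
    refine hasDerivWithinAt_Ici_of_tendsto_deriv (s := Ioo m b) (fun x hx =>
      (hd x ⟨hm.1.trans hx.1, hx.2⟩ hx.1.ne').differentiableAt.differentiableWithinAt)
      hF.continuousWithinAt (Ioo_mem_nhdsGT hm.2) ?_
    refine (hG.tendsto.mono_left nhdsWithin_le_nhds).congr' ?_
    filter_upwards [Ioo_mem_nhdsGT hm.2] with x hx
    exact (hd x ⟨hm.1.trans hx.1, hx.2⟩ hx.1.ne').deriv.symm
  have hl : HasDerivWithinAt F (G m) (Iic m) m := by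
    refine hasDerivWithinAt_Iic_of_tendsto_deriv (s := Ioo a m) (fun x hx =>
      (hd x ⟨hx.1, hx.2.trans hm.2⟩ hx.2.ne).differentiableAt.differentiableWithinAt)
      hF.continuousWithinAt (Ioo_mem_nhdsLT hm.1) ?_
    refine (hG.tendsto.mono_left nhdsWithin_le_nhds).congr' ?_
    filter_upwards [Ioo_mem_nhdsLT hm.1] with x hx
    exact (hd x ⟨hx.1, hx.2.trans hm.2⟩ hx.2.ne).deriv.symm
  simpa using hl.union hr

/-- Since `q'(u) → -h(d) < 0` at `d`, `q` vanishes there only linearly and the flux like a square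
root; the maximal density `d` is thus reached at a finite position. -/
lemma IsOrbit.exists_lower_bound_right {h : ℝ → ℝ} (hh : Continuous h) {c a d : ℝ} {q : ℝ → ℝ}
    (had : a < d) (hq : IsOrbit h c a d q) (hqd : q d = 0) (hd : 0 < h d) :
    ∃ μ > 0, ∃ r > 0, r ≤ d - a ∧ ∀ t ∈ Ioo 0 r, μ * √t ≤ √(2 * q (d - t)) := by
  have hq0 : Tendsto q (𝓝[<] d) (𝓝 0) := by
    have := (hq.cont d (right_mem_Icc.2 had.le)).mono_left
      (nhdsWithin_le_iff.2 (mem_of_superset (Ioo_mem_nhdsLT had) Ioo_subset_Icc_self))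
    rwa [hqd] at this
  have hlim : Tendsto (fun u => c * √(2 * q u) - h u) (𝓝[<] d) (𝓝 (-h d)) := by
    have h1 : Tendsto (fun u => √(2 * q u)) (𝓝[<] d) (𝓝 0) := by
      have := (Real.continuous_sqrt.tendsto (2 * 0)).comp (hq0.const_mul 2)
      rwa [mul_zero, Real.sqrt_zero] at this
    simpa using (h1.const_mul c).sub ((hh.tendsto d).mono_left nhdsWithin_le_nhds)
  obtain ⟨l, hl, hsub⟩ := mem_nhdsLT_iff_exists_Ioo_subset.1
    (hlim.eventually_lt_const (show -h d < -(h d / 2) by linarith))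
  have hl : l < d := hl
  refine ⟨√(h d), Real.sqrt_pos.2 hd, d - max l a, by simp [hl, had],
    by linarith [le_max_right l a], fun t ht => ?_⟩
  have ht1 : max l a < d - t := by linarith [ht.2]
  have hta : a ≤ d - t := (le_max_right _ _).trans ht1.le
  have hmono := monotoneOn_Icc_of_hasDerivAt (a := d - t) (b := d)
    (D := fun u => -q u - h d / 2 * u) (D' := fun u => -(c * √(2 * q u) - h u) - h d / 2)
    (((hq.cont.mono (Icc_subset_Icc_left hta)).neg).sub (by fun_prop)) (fun u hu => by
      have h1 := (hasDerivAt_id u).const_mul (h d / 2)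
      rw [mul_one] at h1
      exact (hq.deriv u ⟨hta.trans_lt hu.1, hu.2⟩).neg.sub h1)
    (fun u hu => by
      have : c * √(2 * q u) - h u < -(h d / 2) :=
        hsub ⟨(le_max_left _ _).trans_lt (ht1.trans hu.1), hu.2⟩
      linarith) (left_mem_Icc.2 (by linarith [ht.1])) (right_mem_Icc.2 (by linarith [ht.1]))
    (by linarith [ht.1])
  simp only [hqd] at hmono
  rw [← Real.sqrt_mul hd.le]
  exact Real.sqrt_le_sqrt (by linarith)

/-- The decreasing branch of a compactly supported profile, extended by its extreme values. -/
lemma exists_compact_branch {A f : ℝ → ℝ} {s₁ s₂ c d : ℝ} (hA : AdmissibleDiffusion A)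
    (hf : MonostableBistable A f s₁ s₂) {q : ℝ → ℝ} (hd : 0 < d)
    (hfd : 0 < f d) (hq : IsOrbit (fluxReaction A f) c 0 d q) (hqd : q d = 0)
    (hpos : ∀ u ∈ Ico 0 d, 0 < q u) :
    ∃ (m : ℝ) (Q : ℝ → ℝ), m < 0 ∧ Continuous Q ∧ (∀ x ≤ m, Q x = d) ∧ (∀ x, 0 ≤ x → Q x = 0) ∧
      (∀ x ∈ Ioo m 0, Q x < d) ∧ IsProfileOn A f c Q (fun x => -√(2 * q (Q x))) (Ioo m 0) ∧
      HasLeftDeriv (fun x => pressure A (Q x)) 0 ⊥ := by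
  have hI0 : Ioo 0 d ⊆ Ioi 0 := fun u hu => hu.1
  have hinit : ∀ u ∈ Ioo 0 d, Ioc 0 u ⊆ Ioo 0 d := fun u hu v hv => ⟨hv.1, hv.2.trans_lt hu.2⟩
  have hne : (Ioo 0 d).Nonempty := nonempty_Ioo.2 hd
  have hpc : ContinuousOn (fun u => √(2 * q u)) (Icc 0 d) :=
    Real.continuous_sqrt.comp_continuousOn (hq.cont.const_smul (2 : ℝ))
  have hp0 : 0 < √(2 * q 0) := Real.sqrt_pos.2 (by linarith [hpos 0 ⟨le_rfl, hd⟩])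
  have hplim : Tendsto (fun u => √(2 * q u)) (𝓝[>] 0) (𝓝 (√(2 * q 0))) :=
    (hpc 0 (left_mem_Icc.2 hd.le)).mono_left
      (nhdsWithin_le_iff.2 (mem_of_superset (Ioo_mem_nhdsGT hd) Ioo_subset_Icc_self))
  obtain ⟨r, hr, hlow⟩ := mem_nhdsGT_iff_exists_Ioo_subset.1
    (hplim.eventually_const_lt (half_lt_self hp0))
  have hr : 0 < r := hr
  obtain ⟨X, Q, hP⟩ := exists_parametrization hA isOpen_Ioo hI0 hinit hne
    -- Here `q 0 > 0`, so the flux stays above `√(2 q 0) / 2` on `(0, r)`, which is at least `κu`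
    -- with this `κ`.
    (fun u hu => hpos u ⟨hu.1.le, hu.2⟩) hq.deriv hr (κ := √(2 * q 0) / 2 / r) (by positivity)
    fun u hu _ => by
      have h1 : √(2 * q 0) / 2 < √(2 * q u) := hlow hu
      have h2 : √(2 * q 0) / 2 / r * u ≤ √(2 * q 0) / 2 := by
        rw [div_mul_eq_mul_div, div_le_iff₀ hr]
        exact mul_le_mul_of_nonneg_left hu.2.le (by positivity)
      linarith
  -- the position of the maximum
  have hbdd : ∃ B, ∀ u ∈ Ioo 0 d, B ≤ X u := by
    obtain ⟨μ, hμ, r', hr', hr'd, hlow'⟩ := hq.exists_lower_bound_right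
      (MonostableBistable.continuous_fluxReaction hA hf) hd hqd
      (by rw [fluxReaction_of_pos hd]; exact mul_pos (hA.deriv_pos d hd) hfd)
    obtain ⟨K, hK⟩ := (isCompact_Icc (a := d - r' / 2) (b := d)).exists_bound_of_continuousOn
      (f := deriv A) fun u hu => (hA.continuousAt_deriv (by
        have : d - r' / 2 ≤ u := hu.1
        linarith)).continuousWithinAt
    have hK0 : 0 ≤ K := (norm_nonneg _).trans (hK d ⟨by linarith, le_rfl⟩)
    set t₀ := r' / 2 with ht₀
    have hmem : ∀ t ∈ Ioc 0 t₀, d - t ∈ Ioo 0 d := fun t ht =>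
      ⟨by linarith [ht.2], by linarith [ht.1]⟩
    have hdY : ∀ t ∈ Ioc 0 t₀, HasDerivAt (fun t => X (d - t) - 2 * (K / μ) * √t)
        (deriv A (d - t) / √(2 * q (d - t)) - 2 * (K / μ) * (1 / (2 * √t))) t := fun t ht => by
      have h1 := (hP.hasDerivAt _ (hmem t ht)).comp t ((hasDerivAt_id t).const_sub d)
      have h2 := (Real.hasDerivAt_sqrt ht.1.ne').const_mul (2 * (K / μ))
      convert! h1.sub h2 using 1
      simp
    -- The derivative `A' / √(2q)` of `t ↦ X (d - t)` is at most `K / (μ √t)`, which is the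
    -- derivative of `2 (K / μ) √t`.
    refine ⟨X (d - t₀) - 2 * (K / μ) * √t₀, fun u hu => ?_⟩
    rcases le_or_gt u (d - t₀) with hle | hgt
    · have h1 := hP.anti.antitoneOn hu (hmem t₀ ⟨by positivity, le_rfl⟩) hle
      have : 0 ≤ 2 * (K / μ) * √t₀ := by positivity
      linarith
    · have hu0 : 0 < d - u := by linarith [hu.2]
      have hmono := monotoneOn_Icc_of_hasDerivAt (a := d - u) (b := t₀)
        (D := fun t => -(X (d - t) - 2 * (K / μ) * √t))
        (fun t ht => (hdY t ⟨hu0.trans_le ht.1, ht.2⟩).neg.continuousAt.continuousWithinAt)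
        (fun t ht => (hdY t ⟨hu0.trans ht.1, ht.2.le⟩).neg) (fun t ht => by
          have ht0 : 0 < t := hu0.trans ht.1
          have hst := Real.sqrt_pos.2 ht0
          have h1 := hlow' t ⟨ht0, by linarith [ht.2]⟩
          have h2 := (le_abs_self _).trans (hK (d - t) ⟨by linarith [ht.2], by linarith⟩)
          have h3 : deriv A (d - t) / √(2 * q (d - t)) ≤ K / (μ * √t) :=
            div_le_div₀ hK0 h2 (by positivity) h1
          have h4 : 2 * (K / μ) * (1 / (2 * √t)) = K / (μ * √t) := by field_simp
          linarith) (left_mem_Icc.2 (by linarith)) (right_mem_Icc.2 (by linarith)) (by linarith)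
      simp only [sub_sub_cancel] at hmono
      have : 0 ≤ 2 * (K / μ) * √(d - u) := by positivity
      linarith
  have hbddB : BddBelow (X '' Ioo 0 d) := by
    obtain ⟨B, hB⟩ := hbdd
    exact ⟨B, by rintro _ ⟨u, hu, rfl⟩; exact hB u hu⟩
  set m := sInf (X '' Ioo 0 d) with hm
  have hmle : ∀ u ∈ Ioo 0 d, m < X u := fun u hu => by
    obtain ⟨v, hv⟩ := exists_between hu.2
    have hvI : v ∈ Ioo 0 d := ⟨hu.1.trans hv.1, hv.2⟩
    exact (csInf_le hbddB (mem_image_of_mem X hvI)).trans_lt (hP.anti hu hvI hv.1)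
  have himg : X '' Ioo 0 d = Ioo m 0 := by
    ext x
    constructor
    · rintro ⟨u, hu, rfl⟩
      exact ⟨hmle u hu, hP.neg u hu⟩
    · intro hx
      obtain ⟨_, ⟨u, hu, rfl⟩, hux⟩ := exists_lt_of_csInf_lt (hne.image X) hx.1
      exact hP.tail u hu ⟨hux, hx.2⟩
  have hm0 : m < 0 := (hmle (d / 2) ⟨by linarith, by linarith⟩).trans
    (hP.neg (d / 2) ⟨by linarith, by linarith⟩)
  have hQd : ∀ x ∈ Ioo m 0, Q x ∈ Ioo 0 d := fun x hx => by
    rw [← himg] at hx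
    obtain ⟨u, hu, rfl⟩ := hx
    rwa [hP.inv u hu]
  set Q' : ℝ → ℝ := fun x => if x ≤ m then d else Q x with hQ'
  have hQ'1 : ∀ x ≤ m, Q' x = d := fun x hx => if_pos hx
  have hQ'2 : ∀ x, m < x → Q' x = Q x := fun x hx => if_neg (not_le.2 hx)
  have hev : ∀ x, m < x → Q' =ᶠ[𝓝 x] Q := fun x hx => by
    filter_upwards [Ioi_mem_nhds hx] with y hy using hQ'2 y hy
  have hprof : IsProfileOn A f c Q' (fun x => -√(2 * q (Q' x))) (Ioo m 0) := by
    have := hP.profile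
    rw [himg] at this
    exact this.congr isOpen_Ioo (fun x hx => hQ'2 x hx.1) fun x hx => by
      simp only [hQ'2 x hx.1]
  have hcont : Continuous Q' := continuous_iff_continuousAt.2 fun x => by
    rcases lt_trichotomy x m with hx | rfl | hx
    · refine (continuousAt_const (y := d)).congr ?_
      filter_upwards [Iio_mem_nhds hx] with y hy using (hQ'1 y (le_of_lt hy)).symm
    · rw [Metric.continuousAt_iff]
      intro ε hε
      obtain ⟨u, hu1, hu2⟩ := exists_between (show max 0 (d - ε) < d from max_lt hd (by linarith))
      have hu : u ∈ Ioo 0 d := ⟨(le_max_left _ _).trans_lt hu1, hu2⟩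
      refine ⟨X u - m, sub_pos.2 (hmle u hu), fun {x} hx => ?_⟩
      rw [hQ'1 m le_rfl]
      rcases le_or_gt x m with hxm | hxm
      · rw [hQ'1 x hxm, dist_self]; exact hε
      · rw [Real.dist_eq, abs_lt] at hx
        have hxu : x < X u := by linarith [hx.2]
        have hx' : x ∈ Ioo m 0 := ⟨hxm, hxu.trans (hP.neg u hu)⟩
        rw [hQ'2 x hxm]
        have hx'' := hx'
        rw [← himg] at hx''
        obtain ⟨v, hv, rfl⟩ := hx''
        rw [hP.inv v hv, Real.dist_eq, abs_of_neg (by linarith [hv.2])]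
        have := (hP.anti.lt_iff_gt hv hu).1 hxu
        have := (le_max_right 0 (d - ε)).trans_lt hu1
        linarith
    · refine ContinuousAt.congr ?_ (hev x hx).symm
      rcases lt_trichotomy x 0 with hx0 | rfl | hx0
      · exact (hP.profile x (by rw [himg]; exact ⟨hx, hx0⟩)).2.1.continuousAt
      · exact hP.continuousAt_zero hinit hI0 hne
      · refine (continuousAt_const (y := (0 : ℝ))).congr ?_
        filter_upwards [Ioi_mem_nhds hx0] with y hy using (hP.Q_of_nonneg (le_of_lt hy)).symm
  -- The flux is nonzero at density `0`, so the pressure slope is `-∞`.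
  have hbot : Tendsto (fun u => ((-√(2 * q u) / u : ℝ) : EReal)) (𝓝[>] 0) (𝓝 ⊥) := by
    have h1 : Tendsto (fun u => √(2 * q u) * u⁻¹) (𝓝[>] 0) atTop :=
      hplim.pos_mul_atTop hp0 tendsto_inv_nhdsGT_zero
    have h2 : Tendsto (fun u => -√(2 * q u) / u) (𝓝[>] 0) atBot := by
      refine (tendsto_neg_atTop_atBot.comp h1).congr fun u => ?_
      simp only [Function.comp_apply]
      ring
    exact EReal.tendsto_coe_nhds_bot_iff.2 h2
  refine ⟨m, Q', hm0, hcont, hQ'1, fun x hx => ?_, fun x hx => ?_, hprof, ?_⟩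
  · rw [hQ'2 x (hm0.trans_le hx)]; exact hP.Q_of_nonneg hx
  · rw [hQ'2 x hx.1]; exact (hQd x hx).2
  · refine (hP.hasLeftDeriv hA hinit hI0 hne hbot).congr' ?_
    filter_upwards [Ioo_mem_nhdsLT hm0] with x hx
    simp only [slope_def_field, hQ'2 x hx.1, hQ'2 0 hm0]

/-- The decreasing branch comes from the orbit of speed `c`; the increasing one is the spatial
reflection of a decreasing branch of speed `-c`. They meet at the maximum `d` with zero flux, and
the equation extends across that point by continuity. -/
theorem exists_compactProfile {A f : ℝ → ℝ} {s₁ s₂ c d : ℝ} (hA : AdmissibleDiffusion A)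
    (hf : MonostableBistable A f s₁ s₂) {q₁ q₂ : ℝ → ℝ} (hd : 0 < d)
    (hfd : 0 < f d) (hq₁ : IsOrbit (fluxReaction A f) c 0 d q₁) (hqd₁ : q₁ d = 0)
    (hpos₁ : ∀ u ∈ Ico 0 d, 0 < q₁ u) (hq₂ : IsOrbit (fluxReaction A f) (-c) 0 d q₂)
    (hqd₂ : q₂ d = 0) (hpos₂ : ∀ u ∈ Ico 0 d, 0 < q₂ u) :
    ∃ (L : ℝ) (U : ℝ → ℝ), IsCompactProfile A f c d L U := by
  obtain ⟨m₁, Q₁, hm₁, hc₁, hd₁, hz₁, hlt₁, hp₁, hslope⟩ :=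
    exists_compact_branch hA hf hd hfd hq₁ hqd₁ hpos₁
  obtain ⟨m₂, Q₂, hm₂, hc₂, hd₂, hz₂, hlt₂, hp₂, -⟩ :=
    exists_compact_branch hA hf hd hfd hq₂ hqd₂ hpos₂
  have hmem : ∀ {Q q : ℝ → ℝ} {m σ : ℝ}, (∀ x ≤ m, Q x = d) → (∀ x, 0 ≤ x → Q x = 0) →
      (∀ x ∈ Ioo m 0, Q x < d) → IsProfileOn A f σ Q (fun x => -√(2 * q (Q x))) (Ioo m 0) →
      ∀ x, Q x ∈ Icc 0 d := by
    intro Q q m σ h1 h2 h3 h4 x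
    rcases le_or_gt x m with hx | hx
    · rw [h1 x hx]; exact right_mem_Icc.2 hd.le
    · rcases lt_or_ge x 0 with hx0 | hx0
      · exact ⟨(h4 x ⟨hx, hx0⟩).1.le, (h3 x ⟨hx, hx0⟩).le⟩
      · rw [h2 x hx0]; exact left_mem_Icc.2 hd.le
  have hmem₁ := hmem hd₁ hz₁ hlt₁ hp₁
  have hmem₂ := hmem hd₂ hz₂ hlt₂ hp₂
  have hV : ∀ {Q q : ℝ → ℝ} {σ : ℝ}, IsOrbit (fluxReaction A f) σ 0 d q → Continuous Q →
      (∀ x, Q x ∈ Icc 0 d) → Continuous fun x => √(2 * q (Q x)) := by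
    intro Q q σ h1 h2 h3
    have : Continuous fun x => q (Q x) :=
      continuousOn_univ.1 (h1.cont.comp h2.continuousOn fun x _ => h3 x)
    exact Real.continuous_sqrt.comp (this.const_mul 2)
  have hV₁ := hV hq₁ hc₁ hmem₁
  have hV₂ := hV hq₂ hc₂ hmem₂
  set a := m₁ + m₂ with ha
  -- On each side of `m₁` one of the two branches is constantly `d`, so this sum glues them and is
  -- visibly continuous and at most `d`.
  set U : ℝ → ℝ := fun x => Q₁ x + Q₂ (a - x) - d with hU
  set V : ℝ → ℝ := fun x => -√(2 * q₁ (Q₁ x)) + √(2 * q₂ (Q₂ (a - x))) with hVdef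
  have hUc : Continuous U := by fun_prop
  have hVc : Continuous V := hV₁.neg.add (hV₂.comp (by fun_prop))
  have hUr : ∀ x, m₁ ≤ x → U x = Q₁ x := fun x hx => by
    simp only [hU, hd₂ (a - x) (by linarith)]; ring
  have hUl : ∀ x ≤ m₁, U x = Q₂ (a - x) := fun x hx => by
    simp only [hU, hd₁ x hx]; ring
  have hVr : ∀ x, m₁ ≤ x → V x = -√(2 * q₁ (Q₁ x)) := fun x hx => by
    simp [hVdef, hd₂ (a - x) (by linarith), hqd₂]
  have hVl : ∀ x ≤ m₁, V x = √(2 * q₂ (Q₂ (a - x))) := fun x hx => by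
    simp [hVdef, hd₁ x hx, hqd₁]
  have hUm : U m₁ = d := by rw [hUr m₁ le_rfl, hd₁ m₁ le_rfl]
  have hright : IsProfileOn A f c U V (Ioo m₁ 0) :=
    hp₁.congr isOpen_Ioo (fun x hx => hUr x hx.1.le) fun x hx => hVr x hx.1.le
  have hleft : IsProfileOn A f c U V (Ioo a m₁) := by
    have hrefl : IsProfileOn A f c (fun x => Q₂ (a - x)) (fun x => √(2 * q₂ (Q₂ (a - x))))
        (Ioo a m₁) := fun x hx => by
      obtain ⟨h0, h1, h2⟩ := hp₂ (a - x) ⟨by linarith [hx.2], by linarith [hx.1]⟩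
      have hsub := (hasDerivAt_id x).const_sub a
      refine ⟨h0, ?_, ?_⟩
      · convert! h1.comp x hsub using 1
        ring
      · have := (h2.comp x hsub).neg
        convert! this using 1
        · ext y; simp
        · ring
    exact hrefl.congr isOpen_Ioo (fun x hx => hUl x hx.2.le) fun x hx => hVl x hx.2.le
  have ham : a < m₁ := by linarith
  have hall : IsProfileOn A f c U V (Ioo a 0) := by
    have hne : ∀ x ∈ Ioo a 0, x ≠ m₁ → 0 < U x ∧ HasDerivAt U (V x / deriv A (U x)) x ∧
        HasDerivAt V (-(c * (V x / deriv A (U x))) - f (U x)) x := fun x hx hxm => by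
      rcases hxm.lt_or_gt with h | h
      · exact hleft x ⟨hx.1, h⟩
      · exact hright x ⟨h, hx.2⟩
    intro x hx
    rcases eq_or_ne x m₁ with hxm | hxm
    · rw [hxm] at hx ⊢
      have hU0 : 0 < U m₁ := by rw [hUm]; exact hd
      have hA' : ContinuousAt (fun x => deriv A (U x)) m₁ :=
        ContinuousAt.comp (g := deriv A) (hA.continuousAt_deriv hU0) hUc.continuousAt
      have hdiv : ContinuousAt (fun x => V x / deriv A (U x)) m₁ :=
        hVc.continuousAt.div hA' (hA.deriv_pos _ hU0).ne'
      have hfU : ContinuousAt (fun x => f (U x)) m₁ :=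
        ContinuousAt.comp (g := f) (hf.hasDerivAt hU0).continuousAt hUc.continuousAt
      exact ⟨hU0, hasDerivAt_of_hasDerivAt_of_ne_local (G := fun x => V x / deriv A (U x)) hx
        (fun y hy hym => (hne y hy hym).2.1) hUc.continuousAt hdiv,
        hasDerivAt_of_hasDerivAt_of_ne_local
          (G := fun x => -(c * (V x / deriv A (U x))) - f (U x)) hx
          (fun y hy hym => (hne y hy hym).2.2) hVc.continuousAt
          ((continuousAt_const.mul hdiv).neg.sub hfU)⟩
    · exact hne x hx hxm
  refine ⟨-a, U, by linarith, hUc, ?_, ?_, ?_, ?_, ⊥, ?_, EReal.bot_lt_coe _⟩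
  · rw [neg_neg]; exact fun x hx => (hall x hx).1
  · rw [neg_neg]
    intro x hx
    rcases le_or_gt x a with h | h
    · rw [hUl x (h.trans ham.le), hz₂ _ (by linarith)]
    · have : 0 ≤ x := by
        by_contra! hlt
        exact hx ⟨h, hlt⟩
      rw [hUr x (hm₁.le.trans this), hz₁ x this]
  · rw [neg_neg]
    exact hall.isClassical hA hf.contDiffOn.continuousOn isOpen_Ioo
  · rw [neg_neg]
    refine ⟨⟨m₁, ⟨ham.le, hm₁.le⟩, hUm⟩, ?_⟩
    rintro _ ⟨x, -, rfl⟩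
    have h1 := (hmem₁ x).2
    have h2 := (hmem₂ (a - x)).2
    simp only [hU]
    linarith
  · refine hslope.congr' ?_
    filter_upwards [Ioo_mem_nhdsLT hm₁] with x hx
    simp only [slope_def_field, hUr x hx.1.le, hUr 0 hm₁.le]

/-! ### From waves to orbits -/

/-- By the mean value theorem on intervals of length `1`, the derivative takes values `G x - G (x -
1)`, which tend to `0`. -/
lemma eq_zero_of_tendsto_deriv_atBot {G V : ℝ → ℝ} {l m : ℝ} (hd : ∀ x, HasDerivAt G (V x) x)
    (hG : Tendsto G atBot (𝓝 l)) (hV : Tendsto V atBot (𝓝 m)) : m = 0 := by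
  have hmvt : ∀ x, ∃ y ∈ Ioo (x - 1) x, V y = G x - G (x - 1) := fun x => by
    obtain ⟨y, hy, hy'⟩ := exists_hasDerivAt_eq_slope G V (sub_one_lt x)
      (fun z _ => (hd z).continuousAt.continuousWithinAt) (fun z _ => hd z)
    exact ⟨y, hy, by rw [hy']; simp⟩
  choose y hy hy' using hmvt
  have h1 : Tendsto (fun x => V (y x)) atBot (𝓝 m) :=
    hV.comp (tendsto_atBot_mono (fun x => (hy x).2.le) tendsto_id)
  have h2 : Tendsto (fun x => G x - G (x - 1)) atBot (𝓝 (l - l)) :=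
    hG.sub (hG.comp (tendsto_atBot_add_const_right _ (-1) tendsto_id))
  rw [sub_self] at h2
  simp only [hy'] at h1
  exact tendsto_nhds_unique h1 h2

/-- If `A(Q)` converges at `-∞` and `V + cQ` is eventually antitone there, then the flux `V`
vanishes at `-∞`. -/
lemma tendsto_flux_atBot {G V Q : ℝ → ℝ} {c l s B x₀ : ℝ} (hd : ∀ x, HasDerivAt G (V x) x)
    (hG : Tendsto G atBot (𝓝 l)) (hQ : Tendsto Q atBot (𝓝 s))
    (hT : AntitoneOn (fun x => V x + c * Q x) (Iic x₀)) (hB : ∀ x ≤ x₀, V x + c * Q x ≤ B) :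
    Tendsto V atBot (𝓝 0) := by
  have hanti : Antitone fun x => V (min x x₀) + c * Q (min x x₀) := fun x y hxy =>
    hT (min_le_right x x₀) (min_le_right y x₀) (min_le_min_right _ hxy)
  have hlim := tendsto_atBot_ciSup hanti ⟨B, by rintro _ ⟨x, rfl⟩; exact hB _ (min_le_right _ _)⟩
  set S := ⨆ x, (V (min x x₀) + c * Q (min x x₀))
  have h1 : Tendsto (fun x => V x + c * Q x) atBot (𝓝 S) := by
    refine hlim.congr' ?_
    filter_upwards [Iic_mem_atBot x₀] with x hx
    rw [min_eq_left hx]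
  have h2 : Tendsto V atBot (𝓝 (S - c * s)) :=
    (h1.sub (hQ.const_mul c)).congr fun x => by ring
  have := eq_zero_of_tendsto_deriv_atBot hd hG h2
  rwa [this] at h2

/-- The orbit and the inverse function of a decreasing profile. -/
lemma exists_orbit_of_profile {A f : ℝ → ℝ} (hA : AdmissibleDiffusion A) {c a b : ℝ} {Q V : ℝ → ℝ}
    {I : Set ℝ} (ha : 0 ≤ a) (hI : IsOpen I) (hIc : I.OrdConnected)
    (himg : Q '' I = Ioo a b) (hQ : ∀ x ∈ I, deriv Q x < 0)
    (hAQ : ∀ x, HasDerivAt (fun y => A (Q y)) (V x) x)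
    (hVQ : ∀ x, HasDerivAt (fun y => V y + c * Q y) (-f (Q x)) x)
    (hright : ∀ ε > 0, ∃ x₀ ∈ I, ∀ x ∈ I, x₀ < x → |V x| < ε)
    (hleft : ∀ ε > 0, ∃ x₀ ∈ I, ∀ x ∈ I, x < x₀ → |V x| < ε) :
    ∃ q Y : ℝ → ℝ, IsOrbit (fluxReaction A f) c a b q ∧ q a = 0 ∧ q b = 0 ∧
      (∀ u ∈ Ioo a b, 0 < q u) ∧ (∀ u ∈ Ioo a b, HasDerivAt Y (-(deriv A u / √(2 * q u))) u) ∧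
      (∀ x ∈ I, Y (Q x) = x) ∧ ∀ x ∈ I, V x = -√(2 * q (Q x)) := by
  have hQd : ∀ x ∈ I, HasDerivAt Q (deriv Q x) x := fun x hx =>
    (differentiableAt_of_deriv_ne_zero (hQ x hx).ne).hasDerivAt
  have hQmem : ∀ x ∈ I, Q x ∈ Ioo a b := fun x hx => by
    rw [← himg]; exact mem_image_of_mem Q hx
  have hanti := strictAntiOn_of_hasDerivAt_neg hIc hQd hQ
  obtain ⟨Y, hY, -, hYd⟩ := exists_inverse hI hIc hQd hQ
  have hV : ∀ x ∈ I, V x = deriv A (Q x) * deriv Q x := fun x hx =>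
    (hAQ x).unique ((hA.hasDerivAt (ha.trans_lt (hQmem x hx).1)).comp x (hQd x hx))
  have hVneg : ∀ x ∈ I, V x < 0 := fun x hx => by
    rw [hV x hx]
    exact mul_neg_of_pos_of_neg (hA.deriv_pos _ (ha.trans_lt (hQmem x hx).1)) (hQ x hx)
  -- The indicator builds in the end values `0`; continuity at the ends is then the vanishing of the
  -- flux there.
  set q : ℝ → ℝ := (Ioo a b).indicator fun u => V (Y u) ^ 2 / 2 with hq
  have hqQ : ∀ x ∈ I, q (Q x) = V x ^ 2 / 2 := fun x hx => by
    rw [hq, indicator_of_mem (hQmem x hx), hY x hx]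
  have hsq : ∀ x ∈ I, √(2 * q (Q x)) = -V x := fun x hx => by
    rw [hqQ x hx, show 2 * (V x ^ 2 / 2) = (-V x) ^ 2 by ring,
      Real.sqrt_sq (by linarith [hVneg x hx])]
  have hsurj : ∀ u ∈ Ioo a b, ∃ x ∈ I, Q x = u := fun u hu => by rwa [← himg] at hu
  have hqa : q a = 0 := indicator_of_notMem (fun h => lt_irrefl _ h.1) _
  have hqb : q b = 0 := indicator_of_notMem (fun h => lt_irrefl _ h.2) _
  have hqd : ∀ u ∈ Ioo a b, HasDerivAt q (c * √(2 * q u) - fluxReaction A f u) u := by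
    intro u hu
    obtain ⟨x, hx, rfl⟩ := hsurj u hu
    have hVd : HasDerivAt V (-f (Q x) - c * deriv Q x) x := by
      have := (hVQ x).sub ((hQd x hx).const_mul c)
      refine this.congr_of_eventuallyEq (Eventually.of_forall fun y => ?_)
      simp
    have h1 : HasDerivAt (fun u => V (Y u) ^ 2 / 2)
        (2 * V x * ((-f (Q x) - c * deriv Q x) * (deriv Q x)⁻¹) / 2) (Q x) := by
      have h2 : HasDerivAt V (-f (Q x) - c * deriv Q x) (Y (Q x)) := by rwa [hY x hx]
      have h3 := ((h2.comp (Q x) (hYd x hx)).pow 2).div_const 2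
      convert! h3 using 1
      simp [hY x hx]
    have h4 : HasDerivAt q (2 * V x * ((-f (Q x) - c * deriv Q x) * (deriv Q x)⁻¹) / 2) (Q x) := by
      refine h1.congr_of_eventuallyEq ?_
      filter_upwards [isOpen_Ioo.mem_nhds hu] with v hv
      exact indicator_of_mem hv _
    convert! h4 using 1
    have hne := (hQ x hx).ne
    rw [hsq x hx, fluxReaction_of_pos (ha.trans_lt hu.1), hV x hx]
    field_simp
    ring
  have hclose : ∀ x ∈ I, ∀ ε > 0, |V x| < min ε 1 → |q (Q x)| < ε := fun x hx ε hε h => by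
    rw [hqQ x hx, abs_of_nonneg (by positivity), ← sq_abs]
    have h1 := h.trans_le (min_le_left _ _)
    have h2 := h.trans_le (min_le_right _ _)
    nlinarith [abs_nonneg (V x)]
  refine ⟨q, Y, ⟨fun u hu => ?_, hqd⟩, hqa, hqb, fun u hu => ?_, fun u hu => ?_, hY, fun x hx => ?_⟩
  · rcases hu.1.eq_or_lt with rfl | hau
    · rw [Metric.continuousWithinAt_iff]
      intro ε hε
      obtain ⟨x₀, hx₀, hx⟩ := hright (min ε 1) (lt_min hε one_pos)
      have h0 := hQmem x₀ hx₀
      refine ⟨Q x₀ - a, sub_pos.2 h0.1, fun {v} hv hva => ?_⟩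
      rw [hqa, Real.dist_eq, sub_zero]
      rcases hv.1.eq_or_lt with rfl | hav
      · rw [hqa, abs_zero]; exact hε
      · rw [Real.dist_eq, abs_of_pos (sub_pos.2 hav)] at hva
        obtain ⟨y, hy, rfl⟩ := hsurj v ⟨hav, (show v < Q x₀ by linarith).trans h0.2⟩
        exact hclose y hy ε hε (hx y hy ((hanti.lt_iff_gt hy hx₀).1 (by linarith)))
    · rcases hu.2.eq_or_lt with rfl | hub
      · rw [Metric.continuousWithinAt_iff]
        intro ε hε
        obtain ⟨x₀, hx₀, hx⟩ := hleft (min ε 1) (lt_min hε one_pos)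
        have h0 := hQmem x₀ hx₀
        refine ⟨u - Q x₀, sub_pos.2 h0.2, fun {v} hv hva => ?_⟩
        rw [hqb, Real.dist_eq, sub_zero]
        rcases hv.2.eq_or_lt with rfl | hvb
        · rw [hqb, abs_zero]; exact hε
        · rw [Real.dist_eq, abs_of_neg (sub_neg.2 hvb)] at hva
          obtain ⟨y, hy, rfl⟩ := hsurj v ⟨h0.1.trans (by linarith), hvb⟩
          exact hclose y hy ε hε (hx y hy ((hanti.lt_iff_gt hx₀ hy).1 (by linarith)))
      · exact (hqd u ⟨hau, hub⟩).continuousAt.continuousWithinAt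
  · obtain ⟨x, hx, rfl⟩ := hsurj u hu
    rw [hqQ x hx]
    have := (hVneg x hx).ne
    positivity
  · obtain ⟨x, hx, rfl⟩ := hsurj u hu
    convert! hYd x hx using 1
    have := (hA.deriv_pos _ (ha.trans_lt hu.1)).ne'
    have := (hQ x hx).ne
    rw [hsq x hx, hV x hx]
    field_simp
  · rw [hsq x hx, neg_neg]

lemma IsTravelingWave.exists_flux {A f : ℝ → ℝ} (hAc : ContinuousOn A (Ici 0))
    (hfc : ContinuousOn f (Ici 0)) {c : ℝ} {Q : ℝ → ℝ} (h : IsTravelingWave A f c Q) :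
    ∃ V : ℝ → ℝ, Continuous V ∧ (∀ x, HasDerivAt (fun y => A (Q y)) (V x) x) ∧
      ∀ x, HasDerivAt (fun y => V y + c * Q y) (-f (Q x)) x := by
  obtain ⟨V, h1, h2⟩ := exists_flux_of_integral_weak
    (continuous_comp_of_nonneg hAc h.continuous h.nonneg) (V := fun x => c * Q x)
    (h.continuous.const_mul c) (continuous_comp_of_nonneg hfc h.continuous h.nonneg) h.weak
  refine ⟨V, ?_, h1, h2⟩
  have : Continuous fun y => V y + c * Q y :=
    continuous_iff_continuousAt.2 fun x => (h2 x).continuousAt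
  exact (this.sub (h.continuous.const_mul c)).congr fun y => by simp

lemma antitoneOn_flux_add {f : ℝ → ℝ} {c x₀ : ℝ} {Q V : ℝ → ℝ}
    (hVQ : ∀ x, HasDerivAt (fun y => V y + c * Q y) (-f (Q x)) x)
    (hf : ∀ x ≤ x₀, 0 ≤ f (Q x)) : AntitoneOn (fun x => V x + c * Q x) (Iic x₀) := by
  refine antitoneOn_of_deriv_nonpos (convex_Iic x₀)
    (fun x _ => (hVQ x).continuousAt.continuousWithinAt)
    (fun x _ => (hVQ x).differentiableAt.differentiableWithinAt) fun x hx => ?_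
  rw [(hVQ x).deriv]
  exact neg_nonpos.2 (hf x (mem_Iic.1 (interior_subset hx)))

lemma tendsto_comp_of_pos {A : ℝ → ℝ} (hA : AdmissibleDiffusion A) {Q : ℝ → ℝ} {s : ℝ} (hs : 0 < s)
    {l : Filter ℝ} (hQ : Tendsto Q l (𝓝 s)) : Tendsto (fun x => A (Q x)) l (𝓝 (A s)) :=
  (hA.hasDerivAt hs).continuousAt.tendsto.comp hQ

/-- The orbit of a sharp wave. -/
lemma IsSharpWave.exists_orbit {A f : ℝ → ℝ} {s₁ s₂ s l c : ℝ} (hA : AdmissibleDiffusion A)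
    (hf : MonostableBistable A f s₁ s₂) (hs : 0 < s) (hls : l < s)
    (hfl : ∀ u ∈ Ioo l s, 0 < f u) {Q : ℝ → ℝ} (h : IsSharpWave A f s c Q) :
    ∃ q Y : ℝ → ℝ, IsSharpOrbit (fluxReaction A f) s c q ∧
      (∀ u ∈ Ioo 0 s, HasDerivAt Y (-(deriv A u / √(2 * q u))) u) ∧
      (∀ x < 0, Q x ∈ Ioo 0 s ∧ Y (Q x) = x) ∧ ∀ u ∈ Ioo 0 s, ∃ x < 0, Q x = u := by
  have hfc := hf.contDiffOn.continuousOn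
  obtain ⟨V, hVc, hAQ, hVQ⟩ := h.wave.exists_flux hA.continuousOn hfc
  have hc := h.wave.speed_pos
  have hQc := h.wave.continuous
  have hanti : StrictAntiOn Q (Iio 0) :=
    strictAntiOn_of_deriv_neg (convex_Iio 0) hQc.continuousOn fun x hx =>
      h.deriv_neg x (mem_Iio.1 (interior_subset hx))
  have hpos : ∀ x < 0, 0 < Q x := fun x hx =>
    (h.wave.nonneg (x / 2)).trans_lt (hanti hx (by simp; linarith) (by linarith))
  have hlt : ∀ x < 0, Q x < s := fun x hx => by
    have h1 : Q (x - 1) ≤ s := by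
      refine ge_of_tendsto h.limit ?_
      filter_upwards [Iio_mem_atBot (x - 1)] with y hy
      exact (hanti (by simp at hy ⊢; linarith) (by simp; linarith) hy).le
    exact (hanti (by simp; linarith) hx (by linarith)).trans_le h1
  have hsurj : ∀ u ∈ Ioo 0 s, ∃ x < 0, Q x = u := fun u hu => by
    obtain ⟨x₁, hx₁, hx0⟩ := ((h.limit.eventually_const_lt hu.2).and (Iio_mem_atBot 0)).exists
    obtain ⟨x, hx, rfl⟩ := intermediate_value_Icc' (le_of_lt hx0) hQc.continuousOn
      ⟨by rw [h.zero 0 le_rfl]; exact hu.1.le, hx₁.le⟩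
    refine ⟨x, hx.2.lt_of_ne ?_, rfl⟩
    rintro rfl
    exact hu.1.ne' (h.zero 0 le_rfl)
  have himg : Q '' Iio 0 = Ioo 0 s := by
    ext u
    constructor
    · rintro ⟨x, hx, rfl⟩; exact ⟨hpos x hx, hlt x hx⟩
    · intro hu
      obtain ⟨x, hx, rfl⟩ := hsurj u hu
      exact ⟨x, hx, rfl⟩
  have hVneg : ∀ x < 0, V x ≤ 0 := fun x hx => by
    have h1 : HasDerivAt Q (deriv Q x) x :=
      (differentiableAt_of_deriv_ne_zero (h.deriv_neg x hx).ne).hasDerivAt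
    rw [(hAQ x).unique ((hA.hasDerivAt (hpos x hx)).comp x h1)]
    exact mul_nonpos_of_nonneg_of_nonpos (hA.deriv_pos _ (hpos x hx)).le (h.deriv_neg x hx).le
  -- The flux is continuous and vanishes on the right, where the profile is zero.
  have hV0 : V 0 = 0 := by
    have h1 : Tendsto V (𝓝[>] 0) (𝓝 (V 0)) := (hVc.tendsto 0).mono_left nhdsWithin_le_nhds
    refine tendsto_nhds_unique h1 (tendsto_const_nhds.congr' ?_)
    filter_upwards [self_mem_nhdsWithin] with x hx
    have h2 : HasDerivAt (fun y => A (Q y)) 0 x := by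
      refine (hasDerivAt_const x (A 0)).congr_of_eventuallyEq ?_
      filter_upwards [Ioi_mem_nhds hx] with y hy
      rw [h.zero y (le_of_lt hy)]
    exact h2.unique (hAQ x)
  -- Near `-∞` the density lies in `(l, s)`, where `f > 0`, so `V + cQ` is antitone; it is bounded
  -- by `c s` because `V ≤ 0`.
  have hVbot : Tendsto V atBot (𝓝 0) := by
    obtain ⟨x₀, hx₀, hx₀0⟩ := ((h.limit.eventually_const_lt hls).and (Iio_mem_atBot 0)).exists
    have hx₀0 : x₀ < 0 := hx₀0
    refine tendsto_flux_atBot (x₀ := x₀) (B := c * s) hAQ (tendsto_comp_of_pos hA hs h.limit) h.limit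
      (antitoneOn_flux_add hVQ fun x hx => (hfl _ ⟨?_, hlt x (hx.trans_lt hx₀0)⟩).le) fun x hx => ?_
    · exact hx₀.trans_le (hanti.antitoneOn (hx.trans_lt hx₀0) hx₀0 hx)
    · have h1 := hVneg x (hx.trans_lt hx₀0)
      have h2 := mul_le_mul_of_nonneg_left (hlt x (hx.trans_lt hx₀0)).le hc.le
      linarith
  obtain ⟨q, Y, hq, hqa, hqb, hqpos, hYd, hY, hVq⟩ := exists_orbit_of_profile hA le_rfl isOpen_Iio
    ordConnected_Iio himg h.deriv_neg hAQ hVQ (fun ε hε => by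
      have h1 : Tendsto V (𝓝[<] 0) (𝓝 (V 0)) := (hVc.tendsto 0).mono_left nhdsWithin_le_nhds
      rw [hV0] at h1
      obtain ⟨x₀, hx₀, hsub⟩ := mem_nhdsLT_iff_exists_Ioo_subset.1
        (Metric.tendsto_nhds.1 h1 ε hε)
      refine ⟨x₀, hx₀, fun x hx hxx => ?_⟩
      have : dist (V x) 0 < ε := hsub ⟨hxx, hx⟩
      simpa [Real.dist_eq] using this) (fun ε hε => by
      obtain ⟨x₀, hx₀⟩ := (eventually_atBot.1 (Metric.tendsto_nhds.1 hVbot ε hε))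
      refine ⟨min x₀ (-1), by simp, fun x _ hxx => ?_⟩
      simpa [Real.dist_eq] using hx₀ x (hxx.le.trans (min_le_left _ _)))
  refine ⟨q, Y, ⟨hc, hq, hqa, hqb, hqpos, ?_⟩, hYd, fun x hx => ⟨⟨hpos x hx, hlt x hx⟩, hY x hx⟩,
    hsurj⟩
  -- Darcy's law excludes the slow behavior at the origin
  have hflat := MonostableBistable.isFlatAtZero hA hf
  refine (hq.sharp_or_slow hflat hc hs hqa).resolve_right fun hslow => ?_
  obtain ⟨r, hr, hrh⟩ := hflat (c ^ 2 / 4) (by positivity)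
  obtain ⟨u₁, hu₁, hqu₁⟩ := hslow r hr
  have hu₁s : u₁ < s := hu₁.2.trans_le (min_le_right _ _)
  have hpar : ∀ u ∈ Ioo 0 u₁, √(2 * q u) ≤ c / 2 * u := fun u hu => by
    have h1 := (hq.mono le_rfl hu₁s.le).le_parabola hc.le (η := c / 2) (fun x hx => by
      refine ((le_abs_self _).trans
        (hrh x ⟨hx.1, hx.2.trans (hu₁.2.trans_le (min_le_left _ _))⟩)).trans_eq ?_
      ring) hqu₁.le (Ioo_subset_Icc_self hu)
    have := hu.1
    exact Real.sqrt_le_iff.2 ⟨by positivity, by linarith⟩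
  obtain ⟨x₁, hx₁, rfl⟩ := hsurj u₁ ⟨hu₁.1, hu₁s⟩
  have hge : ∀ x ∈ Ioo x₁ 0, -(c / 2) ≤ slope (fun x => pressure A (Q x)) 0 x := fun x hx => by
    have hPc : Continuous fun x => pressure A (Q x) := by
      refine continuous_comp_of_nonneg (fun u (hu : 0 ≤ u) => ?_) hQc h.wave.nonneg
      rcases hu.eq_or_lt with rfl | hu
      · rw [ContinuousWithinAt, AdmissibleDiffusion.pressure_zero]
        exact hA.tendsto_pressure
      · exact (hA.hasDerivAt_pressure hu).continuousAt.continuousWithinAt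
    have hPd : ∀ y ∈ Ioo x 0, HasDerivAt (fun x => pressure A (Q x)) (V y / Q y) y := by
      intro y hy
      have h1 : HasDerivAt Q (deriv Q y) y :=
        (differentiableAt_of_deriv_ne_zero (h.deriv_neg y hy.2).ne).hasDerivAt
      have h2 := (hA.hasDerivAt_pressure (hpos y hy.2)).comp y h1
      rw [(hAQ y).unique ((hA.hasDerivAt (hpos y hy.2)).comp y h1)]
      convert! h2 using 1
      ring
    obtain ⟨y, hy, hy'⟩ := exists_hasDerivAt_eq_slope (fun x => pressure A (Q x)) _ hx.2
      hPc.continuousOn hPd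
    rw [slope_comm, slope_def_field, ← hy', le_div_iff₀ (hpos y hy.2), hVq y hy.2]
    have := hpar (Q y) ⟨hpos y hy.2, hanti hx₁ hy.2 (hx.1.trans hy.1)⟩
    linarith
  have hle : ((-(c / 2) : ℝ) : EReal) ≤ ((-c : ℝ) : EReal) := by
    refine ge_of_tendsto h.darcy ?_
    filter_upwards [Ioo_mem_nhdsLT hx₁] with x hx
    exact EReal.coe_le_coe_iff.2 (hge x hx)
  rw [EReal.coe_le_coe_iff] at hle
  linarith

/-! ### Uniqueness of profiles, and the orbit of a monotone wave. -/

lemma exists_const_sub {A q Y₁ Y₂ : ℝ → ℝ} {a b : ℝ} (hab : a < b)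
    (h₁ : ∀ u ∈ Ioo a b, HasDerivAt Y₁ (-(deriv A u / √(2 * q u))) u)
    (h₂ : ∀ u ∈ Ioo a b, HasDerivAt Y₂ (-(deriv A u / √(2 * q u))) u) :
    ∃ k, ∀ u ∈ Ioo a b, Y₁ u = Y₂ u + k := by
  have hd : ∀ u ∈ Ioo a b, HasDerivAt (fun u => Y₁ u - Y₂ u) 0 u := fun u hu => by
    have := (h₁ u hu).sub (h₂ u hu)
    rw [sub_self] at this
    exact this
  obtain ⟨u₀, hu₀⟩ := nonempty_Ioo.2 hab
  refine ⟨Y₁ u₀ - Y₂ u₀, fun u hu => ?_⟩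
  have := isOpen_Ioo.is_const_of_deriv_eq_zero isPreconnected_Ioo
    (fun v hv => (hd v hv).differentiableAt.differentiableWithinAt)
    (fun v hv => (hd v hv).deriv) hu hu₀
  linarith

/-- The orbits have the same speed and, by backward uniqueness from `q(s) = 0`, coincide. Positions
as functions of density then differ by a constant, which the free boundary at `0` fixes. -/
theorem IsSharpWave.unique {A f : ℝ → ℝ} {s₁ s₂ s l c₁ c₂ : ℝ} (hA : AdmissibleDiffusion A)
    (hf : MonostableBistable A f s₁ s₂) (hs : 0 < s) (hls : l < s)
    (hfl : ∀ u ∈ Ioo l s, 0 < f u) {Q₁ Q₂ : ℝ → ℝ} (h₁ : IsSharpWave A f s c₁ Q₁)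
    (h₂ : IsSharpWave A f s c₂ Q₂) : c₁ = c₂ ∧ Q₁ = Q₂ := by
  obtain ⟨q₁, Y₁, ho₁, hd₁, hY₁, hsurj₁⟩ := h₁.exists_orbit hA hf hs hls hfl
  obtain ⟨q₂, Y₂, ho₂, hd₂, hY₂, hsurj₂⟩ := h₂.exists_orbit hA hf hs hls hfl
  obtain rfl := ho₁.speed_unique hs ho₂
  have hq := ho₁.orbit.eqOn ho₂.orbit ho₁.speed_pos.le (by rw [ho₁.right, ho₂.right])
  obtain ⟨k, hk⟩ := exists_const_sub hs hd₁ fun u hu => by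
    rw [hq (Ioo_subset_Icc_self hu)]; exact hd₂ u hu
  -- Both positions range over exactly `(-∞, 0)`: a shift `k ≠ 0` would move the position `-|k| / 2`
  -- of one wave to the positive position `|k| / 2` of the other.
  have hk0 : k = 0 := by
    rcases lt_trichotomy k 0 with h | h | h
    · obtain ⟨hm, he⟩ := hY₁ (k / 2) (by linarith)
      obtain ⟨x, hx, hxe⟩ := hsurj₂ _ hm
      have := hk _ hm
      rw [he, ← hxe, (hY₂ x hx).2] at this
      linarith
    · exact h
    · obtain ⟨hm, he⟩ := hY₂ (-k / 2) (by linarith)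
      obtain ⟨x, hx, hxe⟩ := hsurj₁ _ hm
      have := hk _ hm
      rw [he, ← hxe, (hY₁ x hx).2] at this
      linarith
  refine ⟨rfl, funext fun x => ?_⟩
  rcases lt_or_ge x 0 with hx | hx
  · obtain ⟨hm, he⟩ := hY₁ x hx
    obtain ⟨y, hy, hye⟩ := hsurj₂ _ hm
    have := hk _ hm
    rw [he, ← hye, (hY₂ y hy).2, hk0, add_zero] at this
    rw [← hye, this]
  · rw [h₁.zero x hx, h₂.zero x hx]

/-- The orbit of a monotone wave. -/
lemma IsMonotoneWave.exists_orbit {A f : ℝ → ℝ} {s₁ s₂ a b l c : ℝ} (hA : AdmissibleDiffusion A)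
    (hf : MonostableBistable A f s₁ s₂) (ha : 0 < a) (hal : a < l) (hlb : l < b)
    (hfa : ∀ u ∈ Ioo a l, f u < 0) (hfb : ∀ u ∈ Ioo l b, 0 < f u) {Q : ℝ → ℝ}
    (h : IsMonotoneWave A f b a c Q) :
    ∃ q Y : ℝ → ℝ, IsFrontOrbit (fluxReaction A f) a b c q ∧
      (∀ u ∈ Ioo a b, HasDerivAt Y (-(deriv A u / √(2 * q u))) u) ∧
      (∀ x, Q x ∈ Ioo a b ∧ Y (Q x) = x) ∧ ∀ u ∈ Ioo a b, ∃ x, Q x = u := by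
  have hfc := hf.contDiffOn.continuousOn
  obtain ⟨V, hVc, hAQ, hVQ⟩ := h.wave.exists_flux hA.continuousOn hfc
  have hc := h.wave.speed_pos
  have hQc := h.wave.continuous
  have hanti : StrictAnti Q := strictAnti_of_deriv_neg h.deriv_neg
  have hlt : ∀ x, Q x < b := fun x =>
    (hanti (sub_one_lt x)).trans_le (ge_of_tendsto h.limit_left <| by
      filter_upwards [Iic_mem_atBot (x - 1)] with y hy using hanti.antitone hy)
  have hgt : ∀ x, a < Q x := fun x =>
    (hanti.antitone.le_of_tendsto h.limit_right (x + 1)).trans_lt (hanti (lt_add_one x))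
  have hsurj : ∀ u ∈ Ioo a b, ∃ x, Q x = u := fun u hu => by
    obtain ⟨x₁, hx₁⟩ := (h.limit_left.eventually_const_lt hu.2).exists
    obtain ⟨x₂, hx₂⟩ := (h.limit_right.eventually_lt_const hu.1).exists
    exact mem_range_of_exists_le_of_exists_ge hQc ⟨x₂, hx₂.le⟩ ⟨x₁, hx₁.le⟩
  have himg : Q '' univ = Ioo a b := by
    ext u
    constructor
    · rintro ⟨x, -, rfl⟩; exact ⟨hgt x, hlt x⟩
    · intro hu
      obtain ⟨x, rfl⟩ := hsurj u hu
      exact ⟨x, trivial, rfl⟩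
  have hVneg : ∀ x, V x ≤ 0 := fun x => by
    have h0 := ha.trans (hgt x)
    have h1 : HasDerivAt Q (deriv Q x) x :=
      (differentiableAt_of_deriv_ne_zero (h.deriv_neg x).ne).hasDerivAt
    rw [(hAQ x).unique ((hA.hasDerivAt h0).comp x h1)]
    exact mul_nonpos_of_nonneg_of_nonpos (hA.deriv_pos _ h0).le (h.deriv_neg x).le
  have hB : ∀ x, V x + c * Q x ≤ c * b := fun x => by
    have h2 := mul_le_mul_of_nonneg_left (hlt x).le hc.le
    linarith [hVneg x]
  have hVbot : Tendsto V atBot (𝓝 0) := by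
    obtain ⟨x₀, hx₀⟩ := (h.limit_left.eventually_const_lt hlb).exists
    refine tendsto_flux_atBot (x₀ := x₀) hAQ (tendsto_comp_of_pos hA (ha.trans (hal.trans hlb))
      h.limit_left) h.limit_left (antitoneOn_flux_add hVQ fun x hx =>
        (hfb _ ⟨hx₀.trans_le (hanti.antitone hx), hlt x⟩).le) fun x _ => hB x
  -- Reflection `x ↦ -x` reduces this to `-∞`; near the state `a` the reaction is negative, which
  -- restores the same monotonicity after the reflection.
  have hVtop : Tendsto V atTop (𝓝 0) := by
    obtain ⟨x₀, hx₀⟩ := (h.limit_right.eventually_lt_const hal).exists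
    have hanti' : AntitoneOn (fun x => V (-x) + c * Q (-x)) (Iic (-x₀)) := by
      refine antitoneOn_of_deriv_nonpos (convex_Iic _)
        (fun x _ => ?_) (fun x _ => ?_) fun x hx => ?_ <;>
        have hd := (hVQ (-x)).comp x (hasDerivAt_neg x)
      · exact hd.continuousAt.continuousWithinAt
      · exact hd.differentiableAt.differentiableWithinAt
      · have hd' : deriv (fun x => V (-x) + c * Q (-x)) x = -f (Q (-x)) * -1 := hd.deriv
        rw [hd']
        have hx' : x ≤ -x₀ := mem_Iic.1 (interior_subset hx)
        have := hfa (Q (-x)) ⟨hgt _, (hanti.antitone (show x₀ ≤ -x by linarith)).trans_lt hx₀⟩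
        linarith
    have hG : ∀ x, HasDerivAt (fun y => -A (Q (-y))) (V (-x)) x := fun x => by
      have := ((hAQ (-x)).comp x (hasDerivAt_neg x)).neg
      convert! this using 1
      ring
    have hlim : Tendsto (fun x => V (-x)) atBot (𝓝 0) :=
      tendsto_flux_atBot (x₀ := -x₀) (Q := fun x => Q (-x)) hG
        (((tendsto_comp_of_pos hA ha h.limit_right).comp tendsto_neg_atBot_atTop).neg)
        (h.limit_right.comp tendsto_neg_atBot_atTop) hanti' fun x _ => hB (-x)
    have := hlim.comp tendsto_neg_atTop_atBot
    simpa [Function.comp_def] using this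
  obtain ⟨q, Y, hq, hqa, hqb, hqpos, hYd, hY, -⟩ := exists_orbit_of_profile hA ha.le isOpen_univ
    ordConnected_univ himg (fun x _ => h.deriv_neg x) hAQ hVQ (fun ε hε => by
      obtain ⟨x₀, hx₀⟩ := (eventually_atTop.1 (Metric.tendsto_nhds.1 hVtop ε hε))
      exact ⟨x₀, trivial, fun x _ hxx => by simpa [Real.dist_eq] using hx₀ x hxx.le⟩)
    (fun ε hε => by
      obtain ⟨x₀, hx₀⟩ := (eventually_atBot.1 (Metric.tendsto_nhds.1 hVbot ε hε))
      exact ⟨x₀, trivial, fun x _ hxx => by simpa [Real.dist_eq] using hx₀ x hxx.le⟩)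
  exact ⟨q, Y, ⟨hc, hq, hqa, hqb, hqpos⟩, hYd, fun x => ⟨⟨hgt x, hlt x⟩, hY x trivial⟩, hsurj⟩

theorem IsMonotoneWave.unique {A f : ℝ → ℝ} {s₁ s₂ c₁ c₂ : ℝ} (hA : AdmissibleDiffusion A)
    (hf : MonostableBistable A f s₁ s₂) {Q₁ Q₂ : ℝ → ℝ} (h₁ : IsMonotoneWave A f 1 s₁ c₁ Q₁)
    (h₂ : IsMonotoneWave A f 1 s₁ c₂ Q₂) : c₁ = c₂ ∧ ∃ y, ∀ x, Q₁ x = Q₂ (x - y) := by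
  obtain ⟨q₁, Y₁, ho₁, hd₁, hY₁, -⟩ := h₁.exists_orbit hA hf hf.s₁_pos hf.s₁_lt_s₂ hf.s₂_lt_one
    hf.bistable_neg hf.bistable_pos
  obtain ⟨q₂, Y₂, ho₂, hd₂, hY₂, hsurj₂⟩ := h₂.exists_orbit hA hf hf.s₁_pos hf.s₁_lt_s₂
    hf.s₂_lt_one hf.bistable_neg hf.bistable_pos
  obtain rfl := (MonostableBistable.isBistableFlux hA hf).front_speed_unique ho₁ ho₂
  have hq := ho₁.orbit.eqOn ho₂.orbit ho₁.speed_pos.le (by rw [ho₁.right, ho₂.right])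
  obtain ⟨k, hk⟩ := exists_const_sub (hf.s₁_lt_s₂.trans hf.s₂_lt_one) hd₁ fun u hu => by
    rw [hq (Ioo_subset_Icc_self hu)]; exact hd₂ u hu
  refine ⟨rfl, k, fun x => ?_⟩
  obtain ⟨hm, he⟩ := hY₁ x
  obtain ⟨y, hye⟩ := hsurj₂ _ hm
  have := hk _ hm
  rw [he, ← hye, (hY₂ y).2] at this
  rw [← hye, this, add_sub_cancel_right]

end DegenDiff

/-! ### Assembly of the waves and comparison profiles. -/

theorem proposition2p1 (A f : ℝ → ℝ) (s₁ s₂ : ℝ)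
    (hA : DegenDiff.AdmissibleDiffusion A) (hf : DegenDiff.MonostableBistable A f s₁ s₂) :
    ∃ c_s c_z : ℝ, 0 < c_s ∧ 0 < c_z ∧
      -- small sharp wave, unique among all speeds and profiles
      (∃ Q_s : ℝ → ℝ, DegenDiff.IsSharpWave A f s₁ c_s Q_s ∧
        ∀ (c : ℝ) (Q : ℝ → ℝ), DegenDiff.IsSharpWave A f s₁ c Q → c = c_s ∧ Q = Q_s) ∧
      -- monotone wave connecting 1 and s₁, unique up to translation among all speeds and profiles
      (∃ Q_z : ℝ → ℝ, DegenDiff.IsMonotoneWave A f 1 s₁ c_z Q_z ∧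
        ∀ (c : ℝ) (Q : ℝ → ℝ), DegenDiff.IsMonotoneWave A f 1 s₁ c Q →
          c = c_z ∧ ∃ y : ℝ, ∀ x, Q x = Q_z (x - y)) ∧
      -- big sharp wave, unique among all speeds and profiles
      (c_s < c_z → ∃ c_b : ℝ, c_s < c_b ∧ c_b < c_z ∧
        ∃ Q_b : ℝ → ℝ, DegenDiff.IsSharpWave A f 1 c_b Q_b ∧
          ∀ (c : ℝ) (Q : ℝ → ℝ), DegenDiff.IsSharpWave A f 1 c Q → c = c_b ∧ Q = Q_b) ∧
      -- comparison profiles in the critical case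
      (c_s = c_z →
        (∀ c' : ℝ, 0 < c' → c' < c_s → ∃ δ : ℝ, 0 < δ ∧ ∀ d : ℝ, 1 - δ < d → d < 1 →
          ∃ (L₁ : ℝ) (U₁ : ℝ → ℝ), DegenDiff.IsCompactProfile A f c' d L₁ U₁) ∧
        (∀ c'' : ℝ, c_s < c'' →
          ∃ (L₂ : EReal) (U₂ : ℝ → ℝ), DegenDiff.IsBlowUpProfile A f c'' L₂ U₂)) := by
  have H := DegenDiff.MonostableBistable.isBistableFlux hA hf
  obtain ⟨cs, hcs, hs0, hsmin⟩ := H.exists_small_speed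
  obtain ⟨cz, hcz, hz0, hzmin⟩ := H.exists_bistable_speed
  have hS := H.small_sharpOrbit hcs hs0 hsmin
  obtain ⟨Qs, hQs⟩ := hS.exists_wave hA hf hf.s₁_pos hf.f_s₁
  obtain ⟨Qz, hQz⟩ := (H.frontOrbit hcz hz0).exists_wave hA hf hf.s₁_pos H.s₁_lt_one hf.f_s₁ hf.f_one
  refine ⟨cs, cz, hcs, hcz, ⟨Qs, hQs, fun c Q hQ => hQ.unique hA hf hf.s₁_pos hf.s₁_pos
    hf.monostable hQs⟩, ⟨Qz, hQz, fun c Q hQ => hQ.unique hA hf hQz⟩, fun hlt => ?_,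
    fun heq => ⟨fun c' hc' hc's => ?_, fun c'' hc'' => ?_⟩⟩
  · obtain ⟨cb, q, h1, h2, hq⟩ := H.exists_big_sharpOrbit hcs hlt hs0 hsmin hz0 hzmin
    obtain ⟨Qb, hQb⟩ := hq.exists_wave hA hf one_pos hf.f_one
    exact ⟨cb, h1, h2, Qb, hQb, fun c Q hQ => hQ.unique hA hf one_pos hf.s₂_lt_one
      hf.bistable_pos hQb⟩
  -- As `c_s = c_z`, the speed `c'` is below both critical speeds; likewise `c''` is above both in
  -- the last case.
  · obtain ⟨δ, hδ, h⟩ := H.exists_compact_orbits hc' hc's (heq ▸ hc's) hsmin hzmin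
    refine ⟨δ, hδ, fun d hd1 hd2 => ?_⟩
    obtain ⟨hsd, q₁, q₂, hq₁, hd₁, hp₁, hq₂, hd₂, hp₂⟩ := h d hd1 hd2
    exact DegenDiff.exists_compactProfile hA hf ((hf.s₁_pos.trans hf.s₁_lt_s₂).trans hsd)
      (hf.bistable_pos d ⟨hsd, hd2⟩) hq₁ hd₁ hp₁ hq₂ hd₂ hp₂
  · have hc0 := hcs.trans hc''
    obtain ⟨h0, hpos⟩ := H.maxOrbit_pos hS hc'' hcz (heq ▸ hc'') hz0
    exact DegenDiff.exists_blowUpProfile hA hf hc0 hpos (fun u hu =>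
      (DegenDiff.isOrbit_maxOrbit H.cont hc0.le (show 0 ≤ u + 1 by linarith)).deriv u
        ⟨hu, lt_add_one u⟩) (H.isSharp_maxOrbit hc0 h0)
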